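/- A (non-flat) \emph{convex polyhedron} is the convex hull of finitely many points of $\mathbb{R}^3$ with nonempty interior. We say that a convex polyhedron $P$ is \emph{obtained by gluing regular hexagons edge-to-edge} if there are finitely many copies of the regular hexagon of side length $1$ and a pairing of all their edges, each edge being paired with a different edge and glued to it along its whole length by an orientation-compatible isometry, such that each hexagon can be folded along finitely many straight creases (that is, it is divided into finitely many convex polygons, each of which is mapped isometrically into $\mathbb{R}^3$) so that the images of the hexagons together are exactly the boundary of $P$, and two points of the hexagons have the same image if and only if the gluing identifies them. For each of the following six combinatorial types there is a convex polyhedron of this type that is obtained by gluing regular hexagons edge-to-edge: (i) the tetrahedron; (ii) the triangular bipyramid, with $5$ vertices (three of degree $4$, two of degree $3$) and $6$ triangular faces; (iii) the square pyramid, with $5$ vertices (one of degree $4$, four of degree $3$), one quadrilateral and $4$ triangular faces; moreover, the polyhedron can be chosen to be a right pyramid over a rectangle; (iv) the octahedron, with $6$ vertices of degree $4$ and $8$ triangular faces; moreover, the polyhedron can be chosen to be a regular octahedron; (v) the triangular bipyramid with a further vertex stacked on one of its faces, with $6$ vertices (two of degree $5$, two of degree $4$, two of degree $3$) and $8$ triangular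 faces; (vi) the triangular prism, with $6$ vertices of degree $3$, two triangular and three quadrilateral faces; moreover, the polyhedron can be chosen to be a geometric prism, spanned by a triangle and a translate of it. These include all simplicial types with at most $6$ vertices: every convex polyhedron with at most $6$ vertices all of whose faces are triangles has one of the combinatorial types (i), (ii), (iv), (v). -/

import Mathlib

namespace HexGlue

/-- Euclidean 3-space. -/
abbrev E3 : Type := EuclideanSpace ℝ (Fin 3)

/-! ### Convex polyhedra and their combinatorial types -/

/-- A non-flat convex polyhedron: the convex hull of finitely many points of 3-space,
with nonempty interior. -/
def IsConvexPolyhedron (P : Set E3) : Prop :=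
  (∃ s : Set E3, s.Finite ∧ P = convexHull ℝ s) ∧ (interior P).Nonempty

/-- `F` is a `d`-dimensional face of `P`. For `d = 1` these are the edges of a convex polyhedron,
for `d = 2` its faces in the everyday sense. -/
def IsFaceOfDim (P : Set E3) (d : ℕ) (F : Set E3) : Prop :=
  F.Nonempty ∧ IsExposed ℝ P F ∧ Module.finrank ℝ (vectorSpan ℝ F) = d

/-- All 2-dimensional faces of `P` are triangles. -/
def IsSimplicial (P : Set E3) : Prop :=
  ∀ F : Set E3, IsFaceOfDim P 2 F → (F.extremePoints ℝ).ncard = 3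

/-- A combinatorial type with vertices `0, …, n - 1`: the vertex sets of its edges and of its
2-dimensional faces. -/
structure CombType (n : ℕ) where
  edges : Finset (Finset (Fin n))
  faces : Finset (Finset (Fin n))

/-- `P` has combinatorial type `T`: the vertices of `P` can be labelled by `0, …, n - 1` so that the
edges and the 2-dimensional faces of `P` are spanned exactly by the sets listed in `T`. -/
def HasType {n : ℕ} (P : Set E3) (T : CombType n) : Prop :=
  ∃ v : Fin n → E3, Function.Injective v ∧ Set.range v = P.extremePoints ℝ ∧
    (∀ S : Finset (Fin n), S ∈ T.edges ↔ IsFaceOfDim P 1 (convexHull ℝ (v '' (S : Set (Fin n))))) ∧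
    (∀ S : Finset (Fin n), S ∈ T.faces ↔ IsFaceOfDim P 2 (convexHull ℝ (v '' (S : Set (Fin n)))))

/-- Tetrahedron. -/
def tetrahedron : CombType 4 where
  edges := {{0, 1}, {0, 2}, {0, 3}, {1, 2}, {1, 3}, {2, 3}}
  faces := {{0, 1, 2}, {0, 1, 3}, {0, 2, 3}, {1, 2, 3}}

/-- Triangular bipyramid with apices `0`, `1` (degree 3) and equator `2, 3, 4` (degree 4). -/
def triangularBipyramid : CombType 5 where
  edges := {{0, 2}, {0, 3}, {0, 4}, {1, 2}, {1, 3}, {1, 4}, {2, 3}, {2, 4}, {3, 4}}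
  faces := {{0, 2, 3}, {0, 2, 4}, {0, 3, 4}, {1, 2, 3}, {1, 2, 4}, {1, 3, 4}}

/-- Pyramid with apex `0` (degree 4) over the quadrilateral `1, 2, 3, 4` (degree 3). -/
def squarePyramid : CombType 5 where
  edges := {{0, 1}, {0, 2}, {0, 3}, {0, 4}, {1, 2}, {2, 3}, {3, 4}, {1, 4}}
  faces := {{1, 2, 3, 4}, {0, 1, 2}, {0, 2, 3}, {0, 3, 4}, {0, 1, 4}}

/-- Octahedron: the pairs of opposite vertices are `0, 1` and `2, 3` and `4, 5`. -/
def octahedron : CombType 6 where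
  edges := {{0, 2}, {0, 3}, {0, 4}, {0, 5}, {1, 2}, {1, 3}, {1, 4}, {1, 5},
    {2, 4}, {2, 5}, {3, 4}, {3, 5}}
  faces := {{0, 2, 4}, {0, 2, 5}, {0, 3, 4}, {0, 3, 5}, {1, 2, 4}, {1, 2, 5}, {1, 3, 4}, {1, 3, 5}}

/-- The other type with 6 vertices and 8 triangles: the triangular bipyramid with the new vertex `5`
stacked on its face `0, 2, 3`. The vertices `2, 3` have degree 5, `0, 4` degree 4, `1, 5` degree
3. -/
def stackedBipyramid : CombType 6 where
  edges := {{0, 2}, {0, 3}, {0, 4}, {1, 2}, {1, 3}, {1, 4}, {2, 3}, {2, 4}, {3, 4},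
    {0, 5}, {2, 5}, {3, 5}}
  faces := {{0, 2, 5}, {0, 3, 5}, {2, 3, 5}, {0, 2, 4}, {0, 3, 4}, {1, 2, 3}, {1, 2, 4}, {1, 3, 4}}

/-- Triangular prism with triangles `0, 1, 2` and `3, 4, 5`; all vertices have degree 3. -/
def triangularPrism : CombType 6 where
  edges := {{0, 1}, {0, 2}, {1, 2}, {3, 4}, {3, 5}, {4, 5}, {0, 3}, {1, 4}, {2, 5}}
  faces := {{0, 1, 2}, {3, 4, 5}, {0, 1, 3, 4}, {0, 2, 3, 5}, {1, 2, 4, 5}}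

/-! ### Special shapes -/

/-- Right pyramid over a rectangle: up to congruence, the rectangle has side lengths `2 * a`, `2 * b`
and the apex is at height `h` above its centre. -/
def IsRightRectangularPyramid (P : Set E3) : Prop :=
  ∃ (φ : E3 ≃ᵢ E3) (a b h : ℝ), 0 < a ∧ 0 < b ∧ 0 < h ∧
    P = φ '' convexHull ℝ {!₂[a, b, 0], !₂[a, -b, 0], !₂[-a, b, 0], !₂[-a, -b, 0], !₂[0, 0, h]}

/-- Regular octahedron, up to congruence with vertices at distance `r` from the origin on the
coordinate axes. -/
def IsRegularOctahedron (P : Set E3) : Prop :=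
  ∃ (φ : E3 ≃ᵢ E3) (r : ℝ), 0 < r ∧
    P = φ '' convexHull ℝ {!₂[r, 0, 0], !₂[-r, 0, 0], !₂[0, r, 0], !₂[0, -r, 0],
      !₂[0, 0, r], !₂[0, 0, -r]}

/-- Geometric triangular prism: spanned by a triangle and a translate of it that does not lie in the
plane of the triangle. -/
def IsTriangularPrism (P : Set E3) : Prop :=
  ∃ a b c w : E3, AffineIndependent ℝ ![a, b, c, a + w] ∧
    P = convexHull ℝ {a, b, c, a + w, b + w, c + w}

/-! ### Gluing regular hexagons edge to edge -/

/-- The vertices of the regular hexagon of side length 1, in counterclockwise order. -/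
noncomputable def hexVertex (k : Fin 6) : ℂ :=
  Complex.exp ((k : ℕ) * (Real.pi / 3) * Complex.I)

/-- The (closed, solid) regular hexagon of side length 1. -/
def hexagon : Set ℂ := convexHull ℝ (Set.range hexVertex)

/-- The point with parameter `t` on the `k`-th edge of the hexagon, traversed counterclockwise. -/
noncomputable def edgePoint (k : Fin 6) (t : ℝ) : ℂ :=
  AffineMap.lineMap (hexVertex k) (hexVertex (k + 1)) t

/-- An edge-to-edge gluing rule for `n` copies of the hexagon: every edge (a pair of the number of
the hexagon and the number of the edge in it) is paired with another edge. -/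
structure HexGluing (n : ℕ) where
  partner : Fin n × Fin 6 → Fin n × Fin 6
  partner_partner : ∀ e, partner (partner e) = e
  partner_ne : ∀ e, partner e ≠ e

/-- The point with parameter `t` of an edge is glued to the point with parameter `1 - t` of its
partner (so that the orientations of the hexagons match along the edge). -/
def HexGluing.Step {n : ℕ} (g : HexGluing n) (p q : Fin n × ℂ) : Prop :=
  ∃ (e : Fin n × Fin 6) (t : ℝ), t ∈ Set.Icc (0 : ℝ) 1 ∧
    p = (e.1, edgePoint e.2 t) ∧ q = ((g.partner e).1, edgePoint (g.partner e).2 (1 - t))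

/-- Two points of the disjoint union of the hexagons are identified by the gluing. -/
def HexGluing.Glued {n : ℕ} (g : HexGluing n) : Fin n × ℂ → Fin n × ℂ → Prop :=
  Relation.EqvGen g.Step

/-- `f` folds the paper hexagon into space: the hexagon is cut by straight creases into finitely many
convex polygons, and `f` is distance preserving on each of them. (`f` is then continuous on the
hexagon and preserves the lengths of curves in it.) -/
def IsFolding (f : ℂ → E3) : Prop :=
  ∃ pieces : Set (Set ℂ), pieces.Finite ∧ ⋃₀ pieces = hexagon ∧
    ∀ A ∈ pieces, (∃ s : Set ℂ, s.Finite ∧ A = convexHull ℝ s) ∧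
      ∀ x ∈ A, ∀ y ∈ A, dist (f x) (f y) = dist x y

/-- The gluing `g` folds to the surface of `P`: the hexagons can be folded so that together they cover
exactly the boundary of `P`, and two points of them come to lie on each other precisely when `g`
identifies them. -/
def HexGluing.Yields {n : ℕ} (g : HexGluing n) (P : Set E3) : Prop :=
  ∃ f : Fin n → ℂ → E3, (∀ i, IsFolding (f i)) ∧
    (⋃ i, f i '' hexagon) = frontier P ∧
    ∀ i j, ∀ z ∈ hexagon, ∀ w ∈ hexagon, f i z = f j w ↔ g.Glued (i, z) (j, w)

/-- `P` is a non-flat convex polyhedron obtained by gluing finitely many regular hexagons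
edge to edge. -/
def IsHexGlued (P : Set E3) : Prop :=
  IsConvexPolyhedron P ∧ ∃ (n : ℕ) (g : HexGluing n), g.Yields P

end HexGlue

/-! Each of the six polyhedra is certified by an explicit model over the integers. Squared lengths
are given by a diagonal quadratic form, facets by integral affine functionals, and the plane of
every facet carries a chart from the Eisenstein lattice. A `HexPlan` lists honeycomb hexagons placed
in these charts; a paper hexagon that is folded over several facets has a placement in each of them,
and a placement agrees with its parent along the crease between them. The conditions of
`HexPlan.Valid` are finitely many integer statements with three consequences. Every point of every
hexagon is put on the solid by some placement, and all placements that do so agree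
(`Valid.exists_place_mem`, `Valid.place_eq_place`), so the folding is well defined. Two points
coincide in space exactly when they are glued (`Valid.fold_eq_iff_glued`). Every facet is covered
(`Valid.exists_place_eq`): its interior is connected and is not left by crossing an edge of a placed
hexagon. Together they give `Valid.yields`. `IsPolyhedron` adds certificates for the vertices (a
dissection into tetrahedra) and for the combinatorial type (proper faces are intersections of
facets).

The classification rests on Gale duality (`exists_gale_dual`): for `d + 4` vertices, the complements
of face sets are the supports of positive dependencies among `n` vectors in dimension `d`. For `d =
0` there is no condition. For `d = 1` only the signs of `n = 5` nonzero numbers matter, and every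
vertex being a face forces the distribution two against three. For `d = 2` simpliciality excludes
zero and opposite vectors; after sorting by the slope of the line spanned, a set supports a positive
dependency exactly when its signs change at least twice (`exists_balanced_iff`), and the sign
sequences of length six are enumerated. -/

namespace HexGlue

/-! ### Coordinates on the hexagon -/

/-- The primitive sixth root of unity spanning, together with `1`, the Eisenstein lattice. -/
noncomputable def rho : ℂ := Complex.exp ((Real.pi / 3 : ℝ) * Complex.I)

lemma rho_eq : rho = ⟨1 / 2, √3 / 2⟩ := by
  rw [rho, Complex.exp_mul_I, ← Complex.ofReal_cos, ← Complex.ofReal_sin,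
    Real.cos_pi_div_three, Real.sin_pi_div_three]
  apply Complex.ext <;> simp

lemma sqrt_three_mul_self : √3 * √3 = (3 : ℝ) := Real.mul_self_sqrt (by norm_num)

lemma rho_sq : rho ^ 2 = rho - 1 := by
  rw [rho_eq, pow_two]
  apply Complex.ext
  · simp only [Complex.mul_re, Complex.sub_re, Complex.one_re]
    linarith [sqrt_three_mul_self]
  · simp only [Complex.mul_im, Complex.sub_im, Complex.one_im]
    ring

lemma rho_pow_six : rho ^ 6 = 1 := by
  have h := rho_sq
  have h3 : rho ^ 3 = -1 := by linear_combination (rho + 1) * h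
  linear_combination (rho ^ 3 - 1) * h3

lemma hexVertex_eq_pow (k : Fin 6) : hexVertex k = rho ^ (k : ℕ) := by
  rw [hexVertex, rho, ← Complex.exp_nat_mul]
  congr 1
  push_cast
  ring

lemma hexVertex_add (a b : Fin 6) : hexVertex (a + b) = hexVertex a * hexVertex b := by
  rw [hexVertex_eq_pow, hexVertex_eq_pow, hexVertex_eq_pow, ← pow_add, Fin.val_add,
    ← pow_eq_pow_mod _ rho_pow_six]

lemma hexVertex_zero : hexVertex 0 = 1 := by simp [hexVertex]

lemma hexVertex_ne_zero (a : Fin 6) : hexVertex a ≠ 0 := Complex.exp_ne_zero _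

lemma norm_rho : ‖rho‖ = 1 := Complex.norm_exp_ofReal_mul_I _

lemma norm_hexVertex (a : Fin 6) : ‖hexVertex a‖ = 1 := by
  rw [hexVertex_eq_pow, norm_pow, norm_rho, one_pow]

/-- The coordinate of `1` in the basis `1, rho`. -/
noncomputable def ex : ℂ →ₗ[ℝ] ℝ := Complex.reLm - (√3)⁻¹ • Complex.imLm

/-- The coordinate of `rho` in the basis `1, rho`. -/
noncomputable def ey : ℂ →ₗ[ℝ] ℝ := (2 * (√3)⁻¹) • Complex.imLm

lemma ex_apply (z : ℂ) : ex z = z.re - (√3)⁻¹ * z.im := by simp [ex]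

lemma ey_apply (z : ℂ) : ey z = 2 * (√3)⁻¹ * z.im := by simp [ey]

lemma eq_ex_add_ey (z : ℂ) : z = ex z + ey z * rho := by
  have h3 : √3 ≠ 0 := by positivity
  rw [ex_apply, ey_apply, rho_eq]
  apply Complex.ext
  · simp only [Complex.add_re, Complex.ofReal_re, Complex.re_ofReal_mul]
    ring
  · simp only [Complex.add_im, Complex.ofReal_im, Complex.im_ofReal_mul]
    field_simp
    ring

lemma ex_ey_ext {z w : ℂ} (hx : ex z = ex w) (hy : ey z = ey w) : z = w := by
  rw [eq_ex_add_ey z, eq_ex_add_ey w, hx, hy]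

lemma ex_one : ex 1 = 1 := by simp [ex_apply]

lemma ey_one : ey 1 = 0 := by simp [ey_apply]

lemma ex_rho : ex rho = 0 := by
  have h3 : √3 ≠ 0 := by positivity
  rw [ex_apply, rho_eq]
  field_simp
  ring

lemma ey_rho : ey rho = 1 := by
  have h3 : √3 ≠ 0 := by positivity
  rw [ey_apply, rho_eq]
  field_simp

lemma ex_lattice (x y : ℝ) : ex (x + y * rho) = x := by
  have := ex.map_add (x • 1) (y • rho)
  rw [map_smul, map_smul, ex_one, ex_rho] at this
  simpa using this

lemma ey_lattice (x y : ℝ) : ey (x + y * rho) = y := by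
  have := ey.map_add (x • 1) (y • rho)
  rw [map_smul, map_smul, ey_one, ey_rho] at this
  simpa using this

lemma norm_sq_eq_ex_ey (z : ℂ) : ‖z‖ ^ 2 = ex z ^ 2 + ex z * ey z + ey z ^ 2 := by
  have h3 : √3 ≠ 0 := by positivity
  have hs : (√3)⁻¹ ^ 2 = (1 / 3 : ℝ) := by
    rw [inv_pow, Real.sq_sqrt (by norm_num)]; norm_num
  rw [← Complex.normSq_eq_norm_sq, Complex.normSq_apply, ex_apply, ey_apply]
  linear_combination (- 3 * z.im ^ 2) * hs

/-- The coordinates of the hexagon's vertices. -/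
def corner : Fin 6 → ℤ × ℤ := ![(1, 0), (0, 1), (-1, 1), (-1, 0), (0, -1), (1, -1)]

lemma hexVertex_eq_corner (k : Fin 6) :
    hexVertex k = ((corner k).1 : ℝ) + ((corner k).2 : ℝ) * rho := by
  have h := rho_sq
  rw [hexVertex_eq_pow]
  fin_cases k <;> simp [corner]
  · linear_combination h
  · linear_combination (rho + 1) * h
  · linear_combination (rho ^ 2 + rho) * h
  · linear_combination (rho ^ 3 + rho ^ 2 - 1) * h

lemma ex_hexVertex (k : Fin 6) : ex (hexVertex k) = (corner k).1 := by
  rw [hexVertex_eq_corner, ex_lattice]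

lemma ey_hexVertex (k : Fin 6) : ey (hexVertex k) = (corner k).2 := by
  rw [hexVertex_eq_corner, ey_lattice]

lemma ex_edgePoint (k : Fin 6) (t : ℝ) :
    ex (edgePoint k t) = (1 - t) * (corner k).1 + t * (corner (k + 1)).1 := by
  rw [edgePoint, AffineMap.lineMap_apply_module, map_add, map_smul, map_smul, ex_hexVertex,
    ex_hexVertex]
  rfl

lemma ey_edgePoint (k : Fin 6) (t : ℝ) :
    ey (edgePoint k t) = (1 - t) * (corner k).2 + t * (corner (k + 1)).2 := by
  rw [edgePoint, AffineMap.lineMap_apply_module, map_add, map_smul, map_smul, ey_hexVertex,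
    ey_hexVertex]
  rfl

lemma edgePoint_zero (k : Fin 6) : edgePoint k 0 = hexVertex k := by simp [edgePoint]

lemma edgePoint_one (k : Fin 6) : edgePoint k 1 = hexVertex (k + 1) := by simp [edgePoint]

lemma edgePoint_add (k r : Fin 6) (t : ℝ) :
    edgePoint (k + r) t = hexVertex r * edgePoint k t := by
  rw [edgePoint, edgePoint, AffineMap.lineMap_apply_module, AffineMap.lineMap_apply_module,
    add_right_comm, hexVertex_add, hexVertex_add (k + 1), mul_add, Complex.real_smul,
    Complex.real_smul, Complex.real_smul, Complex.real_smul]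
  ring

lemma convex_hexagon : Convex ℝ hexagon := convex_convexHull ℝ _

lemma hexVertex_mem_hexagon (k : Fin 6) : hexVertex k ∈ hexagon :=
  subset_convexHull ℝ _ ⟨k, rfl⟩

lemma edgePoint_mem_hexagon (k : Fin 6) {t : ℝ} (ht : t ∈ Set.Icc (0 : ℝ) 1) :
    edgePoint k t ∈ hexagon :=
  convex_hexagon.lineMap_mem (hexVertex_mem_hexagon _) (hexVertex_mem_hexagon _) ht

lemma mem_convexHull_range_iff {ι E : Type*} [Fintype ι] [AddCommGroup E] [Module ℝ E] {v : ι → E}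
    {x : E} : x ∈ convexHull ℝ (Set.range v) ↔
      ∃ l : ι → ℝ, (∀ e, 0 ≤ l e) ∧ ∑ e, l e = 1 ∧ ∑ e, l e • v e = x := by
  classical
  constructor
  · intro hw
    rw [convexHull_range_eq_exists_affineCombination] at hw
    obtain ⟨s, l, h0, h1, rfl⟩ := hw
    rw [Finset.affineCombination_eq_linear_combination _ _ _ h1]
    refine ⟨fun e => if e ∈ s then l e else 0, fun e => ?_, ?_, ?_⟩
    · dsimp only
      split_ifs with h
      exacts [h0 e h, le_rfl]
    · simpa using h1
    · simp
  · rintro ⟨l, h0, h1, rfl⟩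
    exact (convex_convexHull ℝ _).sum_mem (fun e _ => h0 e) h1
      fun e _ => subset_convexHull ℝ _ ⟨e, rfl⟩

lemma mem_hexagon_iff_weights {w : ℂ} : w ∈ hexagon ↔
    ∃ l : Fin 6 → ℝ, (∀ e, 0 ≤ l e) ∧ ∑ e, l e = 1 ∧ ∑ e, l e • hexVertex e = w :=
  mem_convexHull_range_iff

lemma AffineMap.map_sum_weights {ι E F : Type*} [Fintype ι] [AddCommGroup E] [Module ℝ E]
    [AddCommGroup F] [Module ℝ F] (φ : E →ᵃ[ℝ] F) (l : ι → ℝ) (h1 : ∑ e, l e = 1) (x : ι → E) :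
    φ (∑ e, l e • x e) = ∑ e, l e • φ (x e) := by
  have := Finset.univ.map_affineCombination x l h1 φ
  rwa [Finset.affineCombination_eq_linear_combination _ _ _ h1,
    Finset.affineCombination_eq_linear_combination _ _ _ h1] at this

lemma nonneg_of_mem_hexagon (φ : ℂ →ᵃ[ℝ] ℝ) (h : ∀ e, 0 ≤ φ (hexVertex e)) {w : ℂ}
    (hw : w ∈ hexagon) : 0 ≤ φ w := by
  obtain ⟨l, h0, h1, rfl⟩ := mem_hexagon_iff_weights.1 hw
  rw [AffineMap.map_sum_weights φ l h1]
  exact Finset.sum_nonneg fun e _ => mul_nonneg (h0 e) (h e)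

/-- The three strips are bounded by the lines of the six sides. For the converse, the hexagon is
dissected into the six triangles spanned by the centre and a side. -/
lemma mem_hexagon_iff {w : ℂ} :
    w ∈ hexagon ↔ |ex w| ≤ 1 ∧ |ey w| ≤ 1 ∧ |ex w + ey w| ≤ 1 := by
  constructor
  · intro hw
    obtain ⟨l, h0, h1, rfl⟩ := mem_hexagon_iff_weights.1 hw
    simp only [map_sum, map_smul, ex_hexVertex, ey_hexVertex, smul_eq_mul]
    simp only [Fin.sum_univ_six, corner] at h1 ⊢
    simp
    have := h0 0; have := h0 1; have := h0 2; have := h0 3; have := h0 4; have := h0 5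
    refine ⟨abs_le.2 ⟨?_, ?_⟩, abs_le.2 ⟨?_, ?_⟩, abs_le.2 ⟨?_, ?_⟩⟩ <;> linarith
  · rintro ⟨hx, hy, hs⟩
    rw [abs_le] at hx hy hs
    have h0 : (0 : ℂ) ∈ hexagon := by
      have h : (0 : ℂ) = (2 : ℝ)⁻¹ • hexVertex 0 + (2 : ℝ)⁻¹ • hexVertex 3 := by
        apply ex_ey_ext <;> rw [map_add, map_smul, map_smul] <;>
          simp [ex_hexVertex, ey_hexVertex, corner]
      rw [h]
      exact convex_hexagon (hexVertex_mem_hexagon _) (hexVertex_mem_hexagon _) (by norm_num)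
        (by norm_num) (by norm_num)
    have key : ∀ (k : Fin 6) (a b : ℝ), 0 ≤ a → 0 ≤ b → a + b ≤ 1 →
        ex w = a * (corner k).1 + b * (corner (k + 1)).1 →
        ey w = a * (corner k).2 + b * (corner (k + 1)).2 → w ∈ hexagon := by
      intro k a b ha hb hab h1 h2
      have h : w = a • hexVertex k + b • hexVertex (k + 1) + (1 - a - b) • (0 : ℂ) := by
        apply ex_ey_ext
        · rw [h1, map_add, map_add, map_smul, map_smul, map_smul]; simp [ex_hexVertex]
        · rw [h2, map_add, map_add, map_smul, map_smul, map_smul]; simp [ey_hexVertex]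
      have h' := convex_hexagon.sum_mem (t := Finset.univ) (w := ![a, b, 1 - a - b])
        (z := ![hexVertex k, hexVertex (k + 1), 0])
        (by intro i _; fin_cases i <;> simp <;> linarith) (by simp [Fin.sum_univ_three])
        (by intro i _; fin_cases i <;> simp [hexVertex_mem_hexagon, h0])
      rw [h]
      simpa [Fin.sum_univ_three] using h'
    -- The signs of the three coordinates select the triangle. Two of the eight patterns are
    -- possible only for `w = 0` and reuse the triangle of a neighbouring pattern.
    rcases le_total 0 (ex w) with h1 | h1 <;> rcases le_total 0 (ey w) with h2 | h2 <;>
      rcases le_total 0 (ex w + ey w) with h3 | h3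
    · exact key 0 (ex w) (ey w) h1 h2 (by linarith) (by simp [corner]) (by simp [corner])
    · exact key 0 (ex w) (ey w) h1 h2 (by linarith) (by simp [corner]) (by simp [corner])
    · exact key 5 (-ey w) (ex w + ey w) (by linarith) h3 (by linarith) (by simp [corner])
        (by simp [corner])
    · exact key 4 (-(ex w + ey w)) (ex w) (by linarith) h1 (by linarith) (by simp [corner])
        (by simp [corner])
    · exact key 1 (ex w + ey w) (-ex w) h3 (by linarith) (by linarith) (by simp [corner])
        (by simp [corner])
    · exact key 2 (ey w) (-(ex w + ey w)) h2 (by linarith) (by linarith) (by simp [corner])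
        (by simp [corner])
    · exact key 3 (-ex w) (-ey w) (by linarith) (by linarith) (by linarith) (by simp [corner])
        (by simp [corner])
    · exact key 3 (-ex w) (-ey w) (by linarith) (by linarith) (by linarith) (by simp [corner])
        (by simp [corner])

lemma hexVertex_mul_mem_hexagon (r : Fin 6) {w : ℂ} (hw : w ∈ hexagon) :
    hexVertex r * w ∈ hexagon := by
  obtain ⟨l, h0, h1, rfl⟩ := mem_hexagon_iff_weights.1 hw
  rw [Finset.mul_sum]
  have h := convex_hexagon.sum_mem (fun e _ => h0 e) h1
    fun e _ => hexVertex_mem_hexagon (r + e)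
  simpa only [hexVertex_add, Complex.real_smul, mul_left_comm] using h

lemma isCompact_hexagon : IsCompact hexagon :=
  (Set.finite_range hexVertex).isCompact_convexHull (𝕜 := ℝ)

/-! ### The honeycomb -/

/-- The translation taking the hexagon to its neighbour across the `d`-th edge. -/
def offset (d : Fin 6) : ℤ × ℤ := corner d + corner (d + 1)

/-- Two hexagons of the honeycomb that meet are equal or share an edge. -/
lemma eq_or_exists_edge_of_sub_eq {a b : ℂ} (ha : a ∈ hexagon) (hb : b ∈ hexagon) {x y : ℤ}
    (hxy : 3 ∣ x - y) (h : a - b = (x : ℝ) + (y : ℝ) * rho) :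
    (x = 0 ∧ y = 0) ∨ ∃ (d : Fin 6) (t : ℝ), t ∈ Set.Icc (0 : ℝ) 1 ∧ a = edgePoint d t ∧
      b = edgePoint (d + 3) (1 - t) ∧ (x, y) = offset d := by
  have hx : ex a - ex b = x := by rw [← map_sub, h, ex_lattice]
  have hy : ey a - ey b = y := by rw [← map_sub, h, ey_lattice]
  obtain ⟨ha1, ha2, ha3⟩ := mem_hexagon_iff.1 ha
  obtain ⟨hb1, hb2, hb3⟩ := mem_hexagon_iff.1 hb
  rw [abs_le] at ha1 ha2 ha3 hb1 hb2 hb3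
  have x1 : x ≤ 2 := by have : (x : ℝ) ≤ 2 := by linarith
                        exact_mod_cast this
  have x2 : -2 ≤ x := by have : (-2 : ℝ) ≤ x := by linarith
                         exact_mod_cast this
  have y1 : y ≤ 2 := by have : (y : ℝ) ≤ 2 := by linarith
                        exact_mod_cast this
  have y2 : -2 ≤ y := by have : (-2 : ℝ) ≤ y := by linarith
                         exact_mod_cast this
  have s1 : x + y ≤ 2 := by have : (x + y : ℝ) ≤ 2 := by linarith
                            exact_mod_cast this
  have s2 : -2 ≤ x + y := by have : (-2 : ℝ) ≤ x + y := by linarith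
                             exact_mod_cast this
  have key : ∀ (d : Fin 6) (t : ℝ), (x, y) = offset d → t ∈ Set.Icc (0 : ℝ) 1 →
      ex a = (1 - t) * (corner d).1 + t * (corner (d + 1)).1 →
      ey a = (1 - t) * (corner d).2 + t * (corner (d + 1)).2 →
      ex b = t * (corner (d + 3)).1 + (1 - t) * (corner (d + 3 + 1)).1 →
      ey b = t * (corner (d + 3)).2 + (1 - t) * (corner (d + 3 + 1)).2 →
      ∃ (d : Fin 6) (t : ℝ), t ∈ Set.Icc (0 : ℝ) 1 ∧ a = edgePoint d t ∧
      b = edgePoint (d + 3) (1 - t) ∧ (x, y) = offset d := by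
    intro d t hd ht h1 h2 h3 h4
    refine ⟨d, t, ht, ex_ey_ext ?_ ?_, ex_ey_ext ?_ ?_, hd⟩
    · rw [h1, ex_edgePoint]
    · rw [h2, ey_edgePoint]
    · rw [h3, ex_edgePoint]; ring
    · rw [h4, ey_edgePoint]; ring
  -- The congruence modulo 3 leaves the zero vector and the six offsets. For an offset one of the
  -- strip inequalities is tight at both points, which puts them on opposite edges; the parameter is
  -- read off from a second coordinate of `a`.
  interval_cases x <;> interval_cases y <;> first
    | (exfalso; omega)
    | (left; exact ⟨rfl, rfl⟩)
    | right
  all_goals push_cast at hx hy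
  · refine key 2 (1 - ey a) (by decide) ⟨by linarith, by linarith⟩ ?_ ?_ ?_ ?_ <;>
      simp [corner] <;> linarith
  · refine key 3 (- ey a) (by decide) ⟨by linarith, by linarith⟩ ?_ ?_ ?_ ?_ <;>
      simp [corner] <;> linarith
  · refine key 1 (- ex a) (by decide) ⟨by linarith, by linarith⟩ ?_ ?_ ?_ ?_ <;>
      simp [corner] <;> linarith
  · refine key 4 (ex a) (by decide) ⟨by linarith, by linarith⟩ ?_ ?_ ?_ ?_ <;>
      simp [corner] <;> linarith
  · refine key 0 (ey a) (by decide) ⟨by linarith, by linarith⟩ ?_ ?_ ?_ ?_ <;>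
      simp [corner] <;> linarith
  · refine key 5 (1 + ey a) (by decide) ⟨by linarith, by linarith⟩ ?_ ?_ ?_ ?_ <;>
      simp [corner] <;> linarith

/-- The honeycomb covers the plane. -/
lemma exists_sub_lattice_mem_hexagon (z : ℂ) :
    ∃ x y : ℤ, 3 ∣ x - y ∧ z - ((x : ℝ) + (y : ℝ) * rho) ∈ hexagon := by
  -- The centres of the honeycomb form the lattice with basis `(1, 1)`, `(2, -1)`; `s` and `t` are
  -- the coordinates with respect to it.
  obtain ⟨s, hs⟩ : ∃ s, s = (ex z + 2 * ey z) / 3 := ⟨_, rfl⟩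
  obtain ⟨t, ht⟩ : ∃ t, t = (ex z - ey z) / 3 := ⟨_, rfl⟩
  have s1 := Int.floor_le s
  have s2 := Int.lt_floor_add_one s
  have t1 := Int.floor_le t
  have t2 := Int.lt_floor_add_one t
  have key : ∀ a b : ℤ, |ex z - (a + 2 * b)| ≤ 1 ∧ |ey z - (a - b)| ≤ 1 ∧
      |ex z + ey z - (2 * a + b)| ≤ 1 → ∃ x y : ℤ, 3 ∣ x - y ∧
        z - ((x : ℝ) + (y : ℝ) * rho) ∈ hexagon := by
    rintro a b ⟨h1, h2, h3⟩
    refine ⟨a + 2 * b, a - b, ⟨b, by ring⟩, mem_hexagon_iff.2 ?_⟩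
    rw [map_sub, map_sub, ex_lattice, ey_lattice]
    push_cast
    refine ⟨h1, h2, ?_⟩
    convert h3 using 2
    ring
  simp only [abs_le] at key
  generalize ⌊s⌋ = a at *
  generalize ⌊t⌋ = b at *
  -- The hexagons around the four corners of a fundamental parallelogram cover it; the cases decide
  -- which corner to take.
  by_cases h1 : (s - a) + (t - b) ≤ 1
  · by_cases h2 : (s - a) + 2 * (t - b) ≤ 1 ∧ 2 * (s - a) + (t - b) ≤ 1
    · refine key a b ⟨⟨?_, ?_⟩, ⟨?_, ?_⟩, ?_, ?_⟩ <;> linarith [h2.1, h2.2]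
    · by_cases h3 : (s - a) ≤ t - b
      · refine key a (b + 1) ?_
        push_cast
        have : 1 < (s - a) + 2 * (t - b) := by
          by_contra h
          exact h2 ⟨by linarith, by linarith⟩
        refine ⟨⟨?_, ?_⟩, ⟨?_, ?_⟩, ?_, ?_⟩ <;> linarith
      · refine key (a + 1) b ?_
        push_cast
        have : 1 < 2 * (s - a) + (t - b) := by
          by_contra h
          exact h2 ⟨by linarith, by linarith⟩
        refine ⟨⟨?_, ?_⟩, ⟨?_, ?_⟩, ?_, ?_⟩ <;> linarith
  · by_cases h2 : 2 ≤ (s - a) + 2 * (t - b) ∧ 2 ≤ 2 * (s - a) + (t - b)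
    · refine key (a + 1) (b + 1) ?_
      push_cast
      refine ⟨⟨?_, ?_⟩, ⟨?_, ?_⟩, ?_, ?_⟩ <;> linarith [h2.1, h2.2]
    · by_cases h3 : (s - a) ≤ t - b
      · refine key a (b + 1) ?_
        push_cast
        have : 2 * (s - a) + (t - b) < 2 := by
          by_contra h
          exact h2 ⟨by linarith, by linarith⟩
        refine ⟨⟨?_, ?_⟩, ⟨?_, ?_⟩, ?_, ?_⟩ <;> linarith
      · refine key (a + 1) b ?_
        push_cast
        have : (s - a) + 2 * (t - b) < 2 := by
          by_contra h
          exact h2 ⟨by linarith, by linarith⟩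
        refine ⟨⟨?_, ?_⟩, ⟨?_, ?_⟩, ?_, ?_⟩ <;> linarith

/-! ### Cutting a polytope by a half-space -/

section Cut

variable {E : Type*} [AddCommGroup E] [Module ℝ E] (φ : E →ᵃ[ℝ] ℝ)

/-- The point where the line through `a` and `b` meets the hyperplane `φ = 0`. -/
noncomputable def crossing (a b : E) : E := (φ a - φ b)⁻¹ • (φ a • b - φ b • a)

lemma map_crossing {a b : E} (h : φ a - φ b ≠ 0) : φ (crossing φ a b) = 0 := by
  have e : crossing φ a b = ((φ a - φ b)⁻¹ * φ a) • b + (-((φ a - φ b)⁻¹ * φ b)) • a := by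
    rw [crossing, smul_sub, smul_smul, smul_smul, neg_smul, sub_eq_add_neg]
  rw [e, Convex.combo_affine_apply (by field_simp; ring)]
  simp only [smul_eq_mul]
  ring

lemma crossing_mem_segment {a b : E} (ha : 0 ≤ φ a) (hb : φ b < 0) :
    crossing φ a b ∈ segment ℝ a b := by
  have h : 0 < φ a - φ b := by linarith
  refine ⟨-((φ a - φ b)⁻¹ * φ b), (φ a - φ b)⁻¹ * φ a, ?_, by positivity, by field_simp; ring, ?_⟩
  · rw [← mul_neg]
    exact mul_nonneg (inv_nonneg.2 h.le) (by linarith)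
  · rw [crossing, smul_sub, smul_smul, smul_smul, neg_smul]
    abel

/-- Central projection from `a` to the hyperplane maps segments to segments: the crossing point of a
convex combination is a convex combination of the crossing points, with weights multiplied by `φ a -
φ b`, `φ a - φ b'` and renormalized. -/
lemma convex_setOf_crossing_right {a : E} (ha : 0 ≤ φ a) {C : Set E} (hC : Convex ℝ C) :
    Convex ℝ {b | φ b < 0 ∧ crossing φ a b ∈ C} := by
  rintro b ⟨hb, hbC⟩ b' ⟨hb', hbC'⟩ u v hu hv huv
  have hφ : φ (u • b + v • b') = u * φ b + v * φ b' := Convex.combo_affine_apply huv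
  have h1 : 0 < φ a - φ b := by linarith
  have h2 : 0 < φ a - φ b' := by linarith
  have e : φ a - (u * φ b + v * φ b') = u * (φ a - φ b) + v * (φ a - φ b') := by
    linear_combination (- φ a) * huv
  have h3 : 0 < u * (φ a - φ b) + v * (φ a - φ b') := by
    rcases hu.eq_or_lt with rfl | hu
    · have : v = 1 := by linarith
      simpa [this] using h2
    · positivity
  refine ⟨by rw [hφ]; exact (convex_Iio (0 : ℝ)) hb hb' hu hv huv, ?_⟩
  have hmem := hC hbC hbC' (a := u * (φ a - φ b) / (u * (φ a - φ b) + v * (φ a - φ b')))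
    (b := v * (φ a - φ b') / (u * (φ a - φ b) + v * (φ a - φ b'))) (by positivity) (by positivity)
    (by field_simp)
  convert hmem using 1
  simp only [crossing]
  rw [hφ, e]
  match_scalars <;> field_simp
  ring

lemma convex_setOf_crossing_left {b : E} (hb : φ b < 0) {C : Set E} (hC : Convex ℝ C) :
    Convex ℝ {a | 0 ≤ φ a ∧ crossing φ a b ∈ C} := by
  rintro a ⟨ha, haC⟩ a' ⟨ha', haC'⟩ u v hu hv huv
  have hφ : φ (u • a + v • a') = u * φ a + v * φ a' := Convex.combo_affine_apply huv
  have h1 : 0 < φ a - φ b := by linarith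
  have h2 : 0 < φ a' - φ b := by linarith
  have e : u * φ a + v * φ a' - φ b = u * (φ a - φ b) + v * (φ a' - φ b) := by
    linear_combination φ b * huv
  have h3 : 0 < u * (φ a - φ b) + v * (φ a' - φ b) := by
    rcases hu.eq_or_lt with rfl | hu
    · have : v = 1 := by linarith
      simpa [this] using h2
    · positivity
  refine ⟨by rw [hφ]; positivity, ?_⟩
  have hmem := hC haC haC' (a := u * (φ a - φ b) / (u * (φ a - φ b) + v * (φ a' - φ b)))
    (b := v * (φ a' - φ b) / (u * (φ a - φ b) + v * (φ a' - φ b))) (by positivity) (by positivity)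
    (by field_simp)
  convert hmem using 1
  simp only [crossing]
  rw [hφ, e]
  match_scalars <;> field_simp

/-- The intersection of a polytope with a half-space is a polytope. -/
lemma exists_finite_convexHull_inter_halfSpace {s : Set E} (hs : s.Finite) :
    ∃ t : Set E, t.Finite ∧ convexHull ℝ s ∩ {x | 0 ≤ φ x} = convexHull ℝ t := by
  set A := {x ∈ s | 0 ≤ φ x} with hA
  set B := {x ∈ s | φ x < 0} with hB
  have hAf : A.Finite := hs.subset fun x hx => hx.1
  have hBf : B.Finite := hs.subset fun x hx => hx.1
  set t := A ∪ Set.image2 (crossing φ) A B with ht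
  have hpos : Convex ℝ {x | 0 ≤ φ x} := (convex_Ici (0 : ℝ)).affine_preimage φ
  have hneg : Convex ℝ {x | φ x < 0} := (convex_Iio (0 : ℝ)).affine_preimage φ
  refine ⟨t, hAf.union (hAf.image2 _ hBf), Set.Subset.antisymm ?_ ?_⟩
  · rintro x ⟨hx, hφx : 0 ≤ φ x⟩
    have hsAB : s = A ∪ B := by
      ext y
      rcases le_or_gt 0 (φ y) with h | h
      · simp [hA, hB, h, h.not_gt]
      · simp [hA, hB, h, h.not_ge]
    have hAt : convexHull ℝ A ⊆ convexHull ℝ t := convexHull_mono Set.subset_union_left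
    rcases A.eq_empty_or_nonempty with hAe | hAn
    · have hB' : convexHull ℝ B ⊆ {x | φ x < 0} := convexHull_min (fun x hx => hx.2) hneg
      rw [hsAB, hAe, Set.empty_union] at hx
      exact absurd (hB' hx) (not_lt.2 hφx)
    rcases B.eq_empty_or_nonempty with hBe | hBn
    · rw [hsAB, hBe, Set.union_empty] at hx
      exact hAt hx
    rw [hsAB, convexHull_union hAn hBn, mem_convexJoin] at hx
    obtain ⟨a, ha, b, hb, hx⟩ := hx
    have hφa : 0 ≤ φ a := convexHull_min (fun x hx => hx.2) hpos ha
    have hφb : φ b < 0 := convexHull_min (fun x hx => hx.2) hneg hb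
    have hc : crossing φ a b ∈ convexHull ℝ t := by
      -- The crossing point is controlled one variable at a time: the admissible `a` for fixed `b`,
      -- and the admissible `b` for fixed `a`, form convex sets that contain the given vertices.
      have h1 : ∀ b ∈ B, ∀ a ∈ convexHull ℝ A, crossing φ a b ∈ convexHull ℝ t := by
        intro b hb a ha
        have := convexHull_min (s := A) (fun a ha => ?_)
          (convex_setOf_crossing_left φ hb.2 (convex_convexHull ℝ t)) ha
        · exact this.2
        · exact ⟨ha.2, subset_convexHull ℝ _ (Or.inr ⟨a, ha, b, hb, rfl⟩)⟩
      have h2 := convexHull_min (s := B) (fun b hb => ?_)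
        (convex_setOf_crossing_right φ hφa (convex_convexHull ℝ t)) hb
      · exact h2.2
      · exact ⟨hb.2, h1 b hb a ha⟩
    obtain ⟨u, v, hu, hv, huv, rfl⟩ := hx
    have hφ : φ (u • a + v • b) = u * φ a + v * φ b := Convex.combo_affine_apply huv
    rw [hφ] at hφx
    have hd : 0 < φ a - φ b := by linarith
    rcases hφa.eq_or_lt with h0 | h0
    · have : v = 0 := by
        by_contra hv0
        have : 0 < v := lt_of_le_of_ne hv (Ne.symm hv0)
        rw [← h0] at hφx
        nlinarith
      rw [this] at huv ⊢
      rw [show u = 1 by linarith]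
      simpa using hAt ha
    -- The point lies between `a` and the crossing point; comparing coefficients of `b` gives the
    -- weight of the latter.
    have hmem := (convex_convexHull ℝ t) (hAt ha) hc (a := 1 - v * (φ a - φ b) / φ a)
      (b := v * (φ a - φ b) / φ a) (by
        rw [sub_nonneg, div_le_one h0]
        have : u = 1 - v := by linarith
        rw [this] at hφx
        linarith) (by positivity) (by ring)
    convert hmem using 1
    rw [crossing]
    have : u = 1 - v := by linarith
    rw [this]
    match_scalars <;> field_simp
    ring
  · refine convexHull_min ?_ ((convex_convexHull ℝ s).inter hpos)
    rintro x (hx | ⟨a, ha, b, hb, rfl⟩)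
    · exact ⟨subset_convexHull ℝ s hx.1, hx.2⟩
    · refine ⟨?_, ?_⟩
      · exact (convex_convexHull ℝ s).segment_subset (subset_convexHull ℝ s ha.1)
          (subset_convexHull ℝ s hb.1) (crossing_mem_segment φ ha.2 hb.2)
      · exact (map_crossing φ (by linarith [ha.2, hb.2])).ge

lemma exists_finite_convexHull_inter_halfSpaces {ι : Type*} (φ : ι → E →ᵃ[ℝ] ℝ)
    {s : Set E} (hs : s.Finite) (I : Finset ι) :
    ∃ t : Set E, t.Finite ∧ convexHull ℝ s ∩ {x | ∀ i ∈ I, 0 ≤ φ i x} = convexHull ℝ t := by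
  classical
  induction I using Finset.induction_on with
  | empty => exact ⟨s, hs, by simp⟩
  | insert i I _ ih =>
    obtain ⟨t, ht, e⟩ := ih
    obtain ⟨t', ht', e'⟩ := exists_finite_convexHull_inter_halfSpace (φ i) ht
    refine ⟨t', ht', ?_⟩
    rw [← e', ← e]
    ext x
    simp only [Finset.forall_mem_insert, Set.mem_inter_iff, Set.mem_ofPred_eq]
    tauto

end Cut

/-! ### Folding plans -/

/-- A hexagon of the honeycomb in the chart of a facet: the number of the facet, the number of the
hexagon, its position (rotation by `rot` sixths of a full turn, then translation by `center`) and the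
placement from which it was reached by crossing an edge of the polyhedron. -/
structure Placement (nf nh np : ℕ) where
  face : Fin nf
  hex : Fin nh
  rot : Fin 6
  center : ℤ × ℤ
  parent : Fin np

/-- Integer data describing how `nh` hexagons are wrapped around a polyhedron with `nf` facets. The
polyhedron lives in integer coordinates with the quadratic form `∑ t, weight t / den * x t ^ 2`; each
facet is given by an affine functional that is nonnegative on the polyhedron and by a chart
`(x, y) ↦ base + x * dirX + y * dirY` from the Eisenstein lattice to its plane. -/
structure HexPlan (nf nh np : ℕ) where
  weight : Fin 3 → ℤ
  den : ℤ
  facet : Fin nf → Fin 4 → ℤ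
  base : Fin nf → Fin 3 → ℤ
  dirX : Fin nf → Fin 3 → ℤ
  dirY : Fin nf → Fin 3 → ℤ
  partner : Fin nh × Fin 6 → Fin nh × Fin 6
  pl : Fin np → Placement nf nh np
  /-- a placement that shows the given corner of the given hexagon on the polyhedron -/
  home : Fin nh → Fin 6 → Fin np
  /-- a point in the interior of the facet: a placement and barycentric weights on its corners -/
  inner : Fin nf → Fin np × (Fin 6 → ℤ)

/-- On the hexagon, an affine function with corner values `b` can only be nonnegative where the one
with corner values `a` is. -/
def Dominates (a b : Fin 6 → ℤ) : Prop :=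
  (∀ e, 0 ≤ a e) ∨ ∃ e₀, 0 ≤ a e₀ * b e₀ ∧ b e₀ ≠ 0 ∧
    ∀ e, a e₀ * b e₀ * b e ≤ a e * (b e₀ * b e₀)

instance (a b : Fin 6 → ℤ) : Decidable (Dominates a b) := by unfold Dominates; infer_instance

/-- An affine function with corner values `b` that is bounded above by a multiple of the one with
corner values `a`, in such a way that both can vanish together only at a corner. -/
def MeetsInCorner (a b : Fin 6 → ℤ) : Prop :=
  ∃ e₀, a e₀ ≠ 0 ∧ (∀ e, b e * (a e₀ * a e₀) ≤ b e₀ * a e₀ * a e) ∧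
    ((∀ e, b e * (a e₀ * a e₀) = b e₀ * a e₀ * a e → 0 ≤ a e) ∨
      ∀ e, b e * (a e₀ * a e₀) = b e₀ * a e₀ * a e → a e ≤ 0) ∧
    ∀ e e', b e * (a e₀ * a e₀) = b e₀ * a e₀ * a e → a e = 0 →
      b e' * (a e₀ * a e₀) = b e₀ * a e₀ * a e' → a e' = 0 → e = e'

instance (a b : Fin 6 → ℤ) : Decidable (MeetsInCorner a b) := by
  unfold MeetsInCorner; infer_instance

/-- In the second case `φ` is at least a nonnegative multiple of `ψ`, namely `a e₀ / b e₀` times it,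
at all corners and hence on the hexagon. Multiplying by `b e₀ * b e₀` keeps the condition integral.
-/
lemma nonneg_of_dominates {a b : Fin 6 → ℤ} (h : Dominates a b) {φ ψ : ℂ →ᵃ[ℝ] ℝ}
    (hφ : ∀ e, φ (hexVertex e) = a e) (hψ : ∀ e, ψ (hexVertex e) = b e) {w : ℂ}
    (hw : w ∈ hexagon) (h0 : 0 ≤ ψ w) : 0 ≤ φ w := by
  rcases h with h | ⟨e₀, h1, h2, h3⟩
  · exact nonneg_of_mem_hexagon φ (fun e => by rw [hφ]; exact_mod_cast h e) hw
  · have h4 := nonneg_of_mem_hexagon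
      (((b e₀ * b e₀ : ℤ) : ℝ) • φ - ((a e₀ * b e₀ : ℤ) : ℝ) • ψ) (fun e => ?_) hw
    · have h5 : (0 : ℝ) < ((b e₀ * b e₀ : ℤ) : ℝ) := by
        exact_mod_cast mul_self_pos.2 h2
      have h6 : (0 : ℝ) ≤ ((a e₀ * b e₀ : ℤ) : ℝ) := by exact_mod_cast h1
      have h7 : 0 ≤ ((b e₀ * b e₀ : ℤ) : ℝ) * φ w - ((a e₀ * b e₀ : ℤ) : ℝ) * ψ w := h4
      have h8 := mul_nonneg h6 h0
      by_contra h9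
      have := mul_neg_of_pos_of_neg h5 (not_le.1 h9)
      linarith
    · show 0 ≤ ((b e₀ * b e₀ : ℤ) : ℝ) * φ (hexVertex e) - ((a e₀ * b e₀ : ℤ) : ℝ) * ψ (hexVertex e)
      rw [hφ, hψ]
      have := h3 e
      have h : (0 : ℝ) ≤ ((b e₀ * b e₀ * a e - a e₀ * b e₀ * b e : ℤ) : ℝ) := by
        exact_mod_cast (by linarith : 0 ≤ b e₀ * b e₀ * a e - a e₀ * b e₀ * b e)
      push_cast at h ⊢
      linarith

/-- Write `w` with weights on the corners. The functional `b e₀ * a e₀ * φ - a e₀ * a e₀ * ψ` is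
nonnegative at the corners and at most zero at `w`, so only corners where it vanishes carry weight.
There `φ` has one sign, so `φ w = 0` forces it to vanish at each of them, and the last condition
leaves a single corner. -/
lemma exists_eq_hexVertex_of_meetsInCorner {a b : Fin 6 → ℤ} (h : MeetsInCorner a b)
    {φ ψ : ℂ →ᵃ[ℝ] ℝ} (hφ : ∀ e, φ (hexVertex e) = a e) (hψ : ∀ e, ψ (hexVertex e) = b e) {w : ℂ}
    (hw : w ∈ hexagon) (hφw : φ w = 0) (hψw : 0 ≤ ψ w) : ∃ e, w = hexVertex e := by
  obtain ⟨e₀, h1, h2, h3, h4⟩ := h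
  obtain ⟨l, l0, l1, rfl⟩ := mem_hexagon_iff_weights.1 hw
  rw [AffineMap.map_sum_weights _ _ l1] at hφw hψw
  simp only [hφ, hψ, smul_eq_mul] at hφw hψw
  have hγ : ∀ e, (0 : ℝ) ≤ (b e₀ * a e₀ * a e - b e * (a e₀ * a e₀) : ℤ) := fun e => by
    exact_mod_cast sub_nonneg.2 (h2 e)
  have hsum : ∑ e, l e * ((b e₀ * a e₀ * a e - b e * (a e₀ * a e₀) : ℤ) : ℝ) ≤ 0 := by
    have : ∑ e, l e * ((b e₀ * a e₀ * a e - b e * (a e₀ * a e₀) : ℤ) : ℝ) =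
        (b e₀ * a e₀ : ℤ) * ∑ e, l e * (a e : ℝ) - (a e₀ * a e₀ : ℤ) * ∑ e, l e * (b e : ℝ) := by
      rw [Finset.mul_sum, Finset.mul_sum, ← Finset.sum_sub_distrib]
      refine Finset.sum_congr rfl fun e _ => ?_
      push_cast
      ring
    rw [this, hφw, mul_zero, zero_sub, neg_nonpos]
    exact mul_nonneg (by exact_mod_cast mul_self_nonneg (a e₀)) hψw
  have hz := (Finset.sum_eq_zero_iff_of_nonneg
    (fun e _ => mul_nonneg (l0 e) (hγ e))).1 (le_antisymm hsum
      (Finset.sum_nonneg fun e _ => mul_nonneg (l0 e) (hγ e)))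
  have heq : ∀ e, l e ≠ 0 → b e * (a e₀ * a e₀) = b e₀ * a e₀ * a e := by
    intro e he
    have := (mul_eq_zero.1 (hz e (Finset.mem_univ e))).resolve_left he
    have : b e₀ * a e₀ * a e - b e * (a e₀ * a e₀) = 0 := by exact_mod_cast this
    linarith
  have ha0 : ∀ e, l e ≠ 0 → a e = 0 := by
    have : ∀ e, l e * (a e : ℝ) = 0 := by
      rcases h3 with h3 | h3
      · have := (Finset.sum_eq_zero_iff_of_nonneg (s := Finset.univ)
          (f := fun e => l e * (a e : ℝ)) (fun e _ => ?_)).1 hφw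
        · exact fun e => this e (Finset.mem_univ e)
        · by_cases he : l e = 0
          · simp [he]
          · exact mul_nonneg (l0 e) (by exact_mod_cast h3 e (heq e he))
      · have := (Finset.sum_eq_zero_iff_of_nonpos (s := Finset.univ)
          (f := fun e => l e * (a e : ℝ)) (fun e _ => ?_)).1 hφw
        · exact fun e => this e (Finset.mem_univ e)
        · by_cases he : l e = 0
          · simp [he]
          · exact mul_nonpos_of_nonneg_of_nonpos (l0 e) (by exact_mod_cast h3 e (heq e he))
    intro e he
    exact_mod_cast (mul_eq_zero.1 (this e)).resolve_left he
  obtain ⟨e, he⟩ : ∃ e, l e ≠ 0 := by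
    by_contra! hall
    simp [hall] at l1
  have hother : ∀ e', e' ≠ e → l e' = 0 := by
    intro e' hne
    by_contra he'
    exact hne (h4 e' e (heq e' he') (ha0 e' he') (heq e he) (ha0 e he))
  refine ⟨e, ?_⟩
  rw [Finset.sum_eq_single e (fun e' _ h => hother e' h) (by simp)] at l1
  rw [Finset.sum_eq_single e (fun e' _ h => by rw [hother e' h, zero_smul]) (by simp), l1, one_smul]

namespace HexPlan

variable {nf nh np : ℕ} (D : HexPlan nf nh np)

/-- The value of the functional `c 0 + c 1 * x 0 + c 2 * x 1 + c 3 * x 2`. -/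
def evalFacet (c : Fin 4 → ℤ) (x : Fin 3 → ℤ) : ℤ := c 0 + c 1 * x 0 + c 2 * x 1 + c 3 * x 2

/-- The quadratic form (up to the factor `1 / den`). -/
def form (x y : Fin 3 → ℤ) : ℤ :=
  D.weight 0 * x 0 * y 0 + D.weight 1 * x 1 * y 1 + D.weight 2 * x 2 * y 2

/-- The position of the `e`-th corner of a placed hexagon. -/
def cornerPt (p : Fin np) (e : Fin 6) (t : Fin 3) : ℤ :=
  D.base (D.pl p).face t +
    ((D.pl p).center.1 + (corner (e + (D.pl p).rot)).1) * D.dirX (D.pl p).face t +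
    ((D.pl p).center.2 + (corner (e + (D.pl p).rot)).2) * D.dirY (D.pl p).face t

/-- The value of the `m`-th facet functional at the `e`-th corner of a placed hexagon. -/
def val (p : Fin np) (m : Fin nf) (e : Fin 6) : ℤ := evalFacet (D.facet m) (D.cornerPt p e)

/-- The corner values of the functional whose sign decides whether a point of the hexagon lies beyond
the crease between a placement and its parent. -/
def crease (q : Fin np) (e : Fin 6) : ℤ := D.val (D.pl q).parent (D.pl q).face e

/-- The placements `p` and `q` agree where `p` meets the plane of the facet `l`. -/
def Linked (p q : Fin np) (l : Fin nf) : Prop :=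
  ∃ e₀, D.val p l e₀ ≠ 0 ∧ ∀ e t, (D.cornerPt q e t - D.cornerPt p e t) * D.val p l e₀ =
    (D.cornerPt q e₀ t - D.cornerPt p e₀ t) * D.val p l e

instance (p q : Fin np) (l : Fin nf) : Decidable (D.Linked p q l) := by
  unfold Linked; infer_instance

/-- The corner reached from a corner by crossing the edge that starts there. -/
def nextCorner (x : Fin nh × Fin 6) : Fin nh × Fin 6 := ((D.partner x).1, (D.partner x).2 + 1)

/-- The combinatorial conditions under which a plan describes a wrapping of a polyhedron. -/
structure Valid : Prop where
  den_pos : 0 < D.den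
  weight_pos : ∀ t, 0 < D.weight t
  normal : ∀ k, D.facet k 1 ≠ 0 ∨ D.facet k 2 ≠ 0 ∨ D.facet k 3 ≠ 0
  isometric : ∀ k, D.form (D.dirX k) (D.dirX k) = D.den ∧ D.form (D.dirY k) (D.dirY k) = D.den ∧
    2 * D.form (D.dirX k) (D.dirY k) = D.den
  planar : ∀ k, evalFacet (D.facet k) (D.base k) = 0 ∧
    D.facet k 1 * D.dirX k 0 + D.facet k 2 * D.dirX k 1 + D.facet k 3 * D.dirX k 2 = 0 ∧
    D.facet k 1 * D.dirY k 0 + D.facet k 2 * D.dirY k 1 + D.facet k 3 * D.dirY k 2 = 0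
  partner_partner : ∀ e, D.partner (D.partner e) = e
  partner_ne : ∀ e, D.partner e ≠ e
  -- All centres in a chart belong to one coset of the lattice of honeycomb centres.
  lattice : ∀ p q, (D.pl p).face = (D.pl q).face →
    3 ∣ ((D.pl p).center.1 - (D.pl q).center.1) - ((D.pl p).center.2 - (D.pl q).center.2)
  key : ∀ p q, (D.pl p).face = (D.pl q).face → (D.pl p).center = (D.pl q).center → p = q
  -- Either the neighbour across the edge is placed in the same facet and is the one prescribed by
  -- the gluing, where `+ 3` passes to the opposite edge, or the edge meets the solid at most in an
  -- endpoint.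
  edge : ∀ p e, (∃ q, (D.pl q).face = (D.pl p).face ∧
      (D.pl q).center = (D.pl p).center + offset (e + (D.pl p).rot) ∧
      D.partner ((D.pl p).hex, e) = ((D.pl q).hex, e + (D.pl p).rot + 3 - (D.pl q).rot)) ∨
    ∃ m, D.val p m e ≤ 0 ∧ D.val p m (e + 1) ≤ 0 ∧ (D.val p m e < 0 ∨ D.val p m (e + 1) < 0)
  -- Where a placed hexagon reaches the plane of another facet within the solid, it continues in
  -- that facet, unless this happens only at a corner.
  transfer : ∀ p l, l ≠ (D.pl p).face →
    (∃ q, (D.pl q).face = l ∧ (D.pl q).hex = (D.pl p).hex ∧ D.Linked p q l) ∨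
    ∃ m, MeetsInCorner (D.val p l) (D.val p m)
  -- What an earlier placement shows on the solid is not strictly beyond the crease of a later one.
  pair : ∀ p q, p < q → (D.pl p).hex = (D.pl q).hex → (D.pl q).parent ≠ q ∧
    ∃ m, Dominates (D.crease q) (D.val p m)
  -- What a placement shows on the solid does not lie strictly on its parent's side of its crease.
  crease_link : ∀ q, (D.pl q).parent ≠ q → (D.pl q).parent < q ∧
    (D.pl (D.pl q).parent).hex = (D.pl q).hex ∧ D.Linked (D.pl q).parent q (D.pl q).face ∧
    ∃ m, Dominates (fun e => - D.crease q e) (D.val q m)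
  root : ∀ i, ∃ p, (D.pl p).hex = i ∧ (D.pl p).parent = p
  -- A part of a placement that violates a facet inequality is either not yet beyond its own crease,
  -- or strictly beyond the crease of one of its children.
  cover : ∀ p m, (∀ e, 0 ≤ D.val p m e) ∨
    ((D.pl p).parent ≠ p ∧ Dominates (D.val p m) (fun e => - D.crease p e)) ∨
    ∃ q, (D.pl q).parent = p ∧ q ≠ p ∧ Dominates (D.val p m) (D.crease q)
  home : ∀ i e, (D.pl (D.home i e)).hex = i ∧ ∀ m, 0 ≤ D.val (D.home i e) m e
  -- At most three corners of hexagons meet in a point, and they are reached from each other by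
  -- walking around it.
  corners : ∀ i e i' e', (∀ t, D.cornerPt (D.home i e) e t = D.cornerPt (D.home i' e') e' t) →
    (i', e') = (i, e) ∨ (i', e') = D.nextCorner (i, e) ∨
      (i', e') = D.nextCorner (D.nextCorner (i, e))
  nextCorner : ∀ x, ∀ t, D.cornerPt (D.home x.1 x.2) x.2 t =
    D.cornerPt (D.home (D.nextCorner x).1 (D.nextCorner x).2) (D.nextCorner x).2 t
  -- The weights need not have sum 1; they are normalized in `Valid.exists_inner`.
  inner : ∀ k, (D.pl (D.inner k).1).face = k ∧ (∀ e, 0 ≤ (D.inner k).2 e) ∧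
    ∀ m, m ≠ k → 0 < ∑ e, (D.inner k).2 e * D.val (D.inner k).1 m e

/-! ### The geometry of a plan -/

/-- The lengths of the coordinate vectors. -/
noncomputable def len (t : Fin 3) : ℝ := √(D.weight t / D.den)

/-- The point of space with given coordinates. -/
noncomputable def pos : (Fin 3 → ℝ) →ₗ[ℝ] E3 where
  toFun x := !₂[D.len 0 * x 0, D.len 1 * x 1, D.len 2 * x 2]
  map_add' x y := by ext t; fin_cases t <;> simp [mul_add]
  map_smul' c x := by ext t; fin_cases t <;> simp [mul_left_comm]

/-- The point of space with given integer coordinates. -/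
noncomputable def ipos (x : Fin 3 → ℤ) : E3 := D.pos fun t => (x t : ℝ)

/-- The linear part of a facet functional. -/
noncomputable def slope (m : Fin nf) : E3 →ₗ[ℝ] ℝ :=
  (D.facet m 1 / D.len 0) • (EuclideanSpace.proj 0 : E3 →L[ℝ] ℝ).toLinearMap +
  (D.facet m 2 / D.len 1) • (EuclideanSpace.proj 1 : E3 →L[ℝ] ℝ).toLinearMap +
  (D.facet m 3 / D.len 2) • (EuclideanSpace.proj 2 : E3 →L[ℝ] ℝ).toLinearMap

/-- The facet functionals, as affine functions on space. -/
noncomputable def height (m : Fin nf) : E3 →ᵃ[ℝ] ℝ :=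
  (D.slope m).toAffineMap + AffineMap.const ℝ E3 (D.facet m 0 : ℝ)

/-- The solid cut out by the facet functionals. -/
def solid : Set E3 := {x | ∀ m, 0 ≤ D.height m x}

/-- The chart of a facet. -/
noncomputable def chart (k : Fin nf) : ℂ →ᵃ[ℝ] E3 :=
  (ex.smulRight (D.ipos (D.dirX k)) + ey.smulRight (D.ipos (D.dirY k))).toAffineMap +
    AffineMap.const ℝ ℂ (D.ipos (D.base k))

/-- The centre of a placed hexagon. -/
noncomputable def ctr (p : Fin np) : ℂ :=
  ((D.pl p).center.1 : ℝ) + ((D.pl p).center.2 : ℝ) * rho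

/-- The motion of the plane that brings the hexagon into its place. -/
noncomputable def motion (p : Fin np) : ℂ →ᵃ[ℝ] ℂ :=
  (LinearMap.mulLeft ℝ (hexVertex (D.pl p).rot)).toAffineMap + AffineMap.const ℝ ℂ (D.ctr p)

/-- The placement as a map of the plane to space. -/
noncomputable def place (p : Fin np) : ℂ →ᵃ[ℝ] E3 := (D.chart (D.pl p).face).comp (D.motion p)

lemma height_apply (m : Fin nf) (x : E3) : D.height m x = D.slope m x + D.facet m 0 := rfl

lemma slope_apply (m : Fin nf) (x : E3) : D.slope m x = D.facet m 1 / D.len 0 * x 0 +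
    D.facet m 2 / D.len 1 * x 1 + D.facet m 3 / D.len 2 * x 2 := rfl

lemma chart_apply (k : Fin nf) (z : ℂ) : D.chart k z =
    ex z • D.ipos (D.dirX k) + ey z • D.ipos (D.dirY k) + D.ipos (D.base k) := rfl

lemma motion_apply (p : Fin np) (w : ℂ) :
    D.motion p w = hexVertex (D.pl p).rot * w + D.ctr p := rfl

lemma place_apply (p : Fin np) (w : ℂ) :
    D.place p w = D.chart (D.pl p).face (D.motion p w) := rfl

end HexPlan

/-! ### The folding of each hexagon is well defined -/

namespace HexPlan

variable {nf nh np : ℕ} {D : HexPlan nf nh np}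

lemma Valid.len_pos (hD : D.Valid) (t : Fin 3) : 0 < D.len t := by
  have h1 : (0 : ℝ) < D.weight t := by exact_mod_cast hD.weight_pos t
  have h2 : (0 : ℝ) < D.den := by exact_mod_cast hD.den_pos
  exact Real.sqrt_pos.2 (div_pos h1 h2)

lemma Valid.len_sq (hD : D.Valid) (t : Fin 3) : D.len t ^ 2 = D.weight t / D.den := by
  have h1 : (0 : ℝ) < D.weight t := by exact_mod_cast hD.weight_pos t
  have h2 : (0 : ℝ) < D.den := by exact_mod_cast hD.den_pos
  exact Real.sq_sqrt (div_pos h1 h2).le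

lemma pos_apply (x : Fin 3 → ℝ) (t : Fin 3) : D.pos x t = D.len t * x t := by
  fin_cases t <;> rfl

lemma Valid.slope_pos (hD : D.Valid) (m : Fin nf) (x : Fin 3 → ℝ) :
    D.slope m (D.pos x) = D.facet m 1 * x 0 + D.facet m 2 * x 1 + D.facet m 3 * x 2 := by
  have h0 := (hD.len_pos 0).ne'
  have h1 := (hD.len_pos 1).ne'
  have h2 := (hD.len_pos 2).ne'
  rw [slope_apply, pos_apply, pos_apply, pos_apply]
  field_simp

lemma Valid.height_ipos (hD : D.Valid) (m : Fin nf) (x : Fin 3 → ℤ) :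
    D.height m (D.ipos x) = evalFacet (D.facet m) x := by
  rw [height_apply, ipos, hD.slope_pos, evalFacet]
  push_cast
  ring

lemma Valid.pos_injective (hD : D.Valid) : Function.Injective D.pos := by
  intro x y h
  ext t
  have := congrArg (fun v : E3 => v t) h
  simp only [pos_apply] at this
  exact mul_left_cancel₀ (hD.len_pos t).ne' this

lemma Valid.ipos_injective (hD : D.Valid) : Function.Injective D.ipos := by
  intro x y h
  ext t
  exact_mod_cast congrFun (hD.pos_injective h) t

lemma Valid.inner_ipos (hD : D.Valid) (x y : Fin 3 → ℤ) :
    Inner.inner ℝ (D.ipos x) (D.ipos y) = (D.form x y : ℝ) / D.den := by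
  have h2 : (D.den : ℝ) ≠ 0 := by exact_mod_cast hD.den_pos.ne'
  have e : Inner.inner ℝ (D.ipos x) (D.ipos y) = D.len 0 ^ 2 * (x 0 * y 0) + D.len 1 ^ 2 * (x 1 * y 1) +
      D.len 2 ^ 2 * (x 2 * y 2) := by
    rw [PiLp.inner_apply, Fin.sum_univ_three]
    simp only [ipos, pos_apply, RCLike.inner_apply, conj_trivial]
    ring
  rw [e, hD.len_sq, hD.len_sq, hD.len_sq, form]
  push_cast
  field_simp

/-- The two direction vectors have the same Gram matrix as `1` and `rho`: unit lengths and inner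
product `1 / 2`. -/
lemma Valid.norm_chart_sub (hD : D.Valid) (k : Fin nf) (z w : ℂ) :
    ‖D.chart k z - D.chart k w‖ = ‖z - w‖ := by
  have h2 : (D.den : ℝ) ≠ 0 := by exact_mod_cast hD.den_pos.ne'
  obtain ⟨i1, i2, i3⟩ := hD.isometric k
  have j1 : Inner.inner ℝ (D.ipos (D.dirX k)) (D.ipos (D.dirX k)) = (1 : ℝ) := by
    rw [hD.inner_ipos, i1, div_self h2]
  have j2 : Inner.inner ℝ (D.ipos (D.dirY k)) (D.ipos (D.dirY k)) = (1 : ℝ) := by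
    rw [hD.inner_ipos, i2, div_self h2]
  have j3 : Inner.inner ℝ (D.ipos (D.dirX k)) (D.ipos (D.dirY k)) = (1 / 2 : ℝ) := by
    rw [hD.inner_ipos, div_eq_div_iff h2 two_ne_zero, mul_comm, one_mul]
    exact_mod_cast i3
  have e : D.chart k z - D.chart k w =
      ex (z - w) • D.ipos (D.dirX k) + ey (z - w) • D.ipos (D.dirY k) := by
    rw [chart_apply, chart_apply, map_sub, map_sub]
    module
  have hsq : ‖D.chart k z - D.chart k w‖ ^ 2 = ‖z - w‖ ^ 2 := by
    rw [norm_sq_eq_ex_ey, e, ← real_inner_self_eq_norm_sq, inner_add_left, inner_add_right,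
      inner_add_right, inner_smul_left, inner_smul_left, inner_smul_left, inner_smul_left,
      inner_smul_right, inner_smul_right, inner_smul_right, inner_smul_right, j1, j2, j3,
      real_inner_comm, j3]
    simp only [conj_trivial]
    ring
  exact (sq_eq_sq₀ (norm_nonneg _) (norm_nonneg _)).1 hsq

lemma Valid.chart_injective (hD : D.Valid) (k : Fin nf) : Function.Injective (D.chart k) := by
  intro z w h
  have := hD.norm_chart_sub k z w
  rw [h, sub_self, norm_zero] at this
  exact sub_eq_zero.1 (norm_eq_zero.1 this.symm)

lemma Valid.dist_place (hD : D.Valid) (p : Fin np) (z w : ℂ) :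
    dist (D.place p z) (D.place p w) = dist z w := by
  rw [dist_eq_norm, place_apply, place_apply, hD.norm_chart_sub, motion_apply, motion_apply,
    add_sub_add_right_eq_sub, ← mul_sub, norm_mul, norm_hexVertex, one_mul, dist_eq_norm]

lemma Valid.height_chart_self (hD : D.Valid) (k : Fin nf) (z : ℂ) :
    D.height k (D.chart k z) = 0 := by
  obtain ⟨h1, h2, h3⟩ := hD.planar k
  have e : D.height k (D.chart k z) = ex z * D.slope k (D.ipos (D.dirX k)) +
      ey z * D.slope k (D.ipos (D.dirY k)) + D.height k (D.ipos (D.base k)) := by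
    rw [chart_apply, height_apply, height_apply, map_add, map_add, map_smul, map_smul]
    simp only [smul_eq_mul]
    ring
  rw [e, hD.height_ipos, h1, ipos, ipos, hD.slope_pos, hD.slope_pos]
  have h2' : (D.facet k 1 * D.dirX k 0 + D.facet k 2 * D.dirX k 1 + D.facet k 3 * D.dirX k 2 : ℝ)
    = 0 := by exact_mod_cast h2
  have h3' : (D.facet k 1 * D.dirY k 0 + D.facet k 2 * D.dirY k 1 + D.facet k 3 * D.dirY k 2 : ℝ)
    = 0 := by exact_mod_cast h3
  rw [h2', h3']
  simp

lemma motion_hexVertex (p : Fin np) (e : Fin 6) : D.motion p (hexVertex e) =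
    (((D.pl p).center.1 + (corner (e + (D.pl p).rot)).1 : ℤ) : ℝ) +
      (((D.pl p).center.2 + (corner (e + (D.pl p).rot)).2 : ℤ) : ℝ) * rho := by
  rw [motion_apply, mul_comm, ← hexVertex_add, hexVertex_eq_corner, ctr]
  push_cast
  ring

lemma place_hexVertex (p : Fin np) (e : Fin 6) :
    D.place p (hexVertex e) = D.ipos (D.cornerPt p e) := by
  rw [place_apply, motion_hexVertex, chart_apply, ex_lattice, ey_lattice]
  simp only [ipos, ← map_smul, ← map_add]
  congr 1
  ext t
  simp only [Pi.add_apply, Pi.smul_apply, smul_eq_mul, cornerPt]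
  push_cast
  ring

lemma Valid.height_place_hexVertex (hD : D.Valid) (p : Fin np) (m : Fin nf) (e : Fin 6) :
    ((D.height m).comp (D.place p)) (hexVertex e) = (D.val p m e : ℝ) := by
  rw [AffineMap.comp_apply, place_hexVertex, hD.height_ipos, val]

lemma Valid.height_place_self (hD : D.Valid) (p : Fin np) (w : ℂ) :
    D.height (D.pl p).face (D.place p w) = 0 := hD.height_chart_self _ _

/-- Being linked means that the difference of the two placements, an affine map, is a fixed vector
times the height over the facet `l`, so it vanishes where this height does. -/
lemma Valid.place_eq_of_linked (hD : D.Valid) {p q : Fin np} {l : Fin nf} (h : D.Linked p q l)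
    {w : ℂ} (hw : w ∈ hexagon) (h0 : D.height l (D.place p w) = 0) :
    D.place q w = D.place p w := by
  obtain ⟨e₀, hne, h⟩ := h
  obtain ⟨c, c0, c1, rfl⟩ := mem_hexagon_iff_weights.1 hw
  have h0' : ((D.height l).comp (D.place p)) (∑ e, c e • hexVertex e) = 0 := h0
  rw [AffineMap.map_sum_weights _ _ c1] at h0'
  simp only [hD.height_place_hexVertex, smul_eq_mul] at h0'
  rw [AffineMap.map_sum_weights _ _ c1, AffineMap.map_sum_weights _ _ c1]
  simp only [place_hexVertex, ipos, ← map_smul, ← map_sum]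
  congr 1
  ext t
  simp only [Finset.sum_apply, Pi.smul_apply, smul_eq_mul]
  rw [← sub_eq_zero, ← Finset.sum_sub_distrib]
  have hne' : (D.val p l e₀ : ℝ) ≠ 0 := by exact_mod_cast hne
  refine (mul_eq_zero.1 ?_).resolve_right hne'
  have : (∑ e, (c e * (D.cornerPt q e t : ℝ) - c e * (D.cornerPt p e t : ℝ))) * D.val p l e₀ =
      (D.cornerPt q e₀ t - D.cornerPt p e₀ t) * ∑ e, c e * (D.val p l e : ℝ) := by
    rw [Finset.sum_mul, Finset.mul_sum]
    refine Finset.sum_congr rfl fun e _ => ?_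
    have := h e t
    have : ((D.cornerPt q e t : ℝ) - D.cornerPt p e t) * D.val p l e₀ =
      (D.cornerPt q e₀ t - D.cornerPt p e₀ t) * D.val p l e := by exact_mod_cast this
    linear_combination c e * this
  rw [this, h0', mul_zero]

lemma Valid.nonneg_of_dominates (hD : D.Valid) {p q : Fin np} {m l : Fin nf}
    (h : Dominates (D.val p m) (D.val q l)) {w : ℂ} (hw : w ∈ hexagon)
    (h0 : 0 ≤ D.height l (D.place q w)) : 0 ≤ D.height m (D.place p w) :=
  HexGlue.nonneg_of_dominates h (hD.height_place_hexVertex p m) (hD.height_place_hexVertex q l) hw h0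

/-- Different placements of a hexagon agree where both lie on the solid. -/
lemma Valid.place_eq_place (hD : D.Valid) {w : ℂ} (hw : w ∈ hexagon) : ∀ (N : ℕ) (p q : Fin np),
    (p : ℕ) + q < N → (D.pl p).hex = (D.pl q).hex → D.place p w ∈ D.solid →
    D.place q w ∈ D.solid → D.place p w = D.place q w := by
  have step : ∀ p q : Fin np, p < q → (D.pl p).hex = (D.pl q).hex → D.place p w ∈ D.solid →
      D.place q w ∈ D.solid → (D.pl q).parent < q ∧ (D.pl p).hex = (D.pl (D.pl q).parent).hex ∧
        D.place q w = D.place (D.pl q).parent w := by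
    intro p q hpq hh hp hq
    obtain ⟨hne, m, hm⟩ := hD.pair p q hpq hh
    obtain ⟨hlt, hhex, hl, m', hm'⟩ := hD.crease_link q hne
    -- Both `p` and `q` show the point on the solid, so it is on neither open side of the crease of
    -- `q`; on the crease, `q` agrees with its parent.
    refine ⟨hlt, hh.trans hhex.symm, hD.place_eq_of_linked hl hw (le_antisymm ?_ ?_)⟩
    · have := HexGlue.nonneg_of_dominates hm'
        (φ := -((D.height (D.pl q).face).comp (D.place (D.pl q).parent)))
        (fun e => by
          have := hD.height_place_hexVertex (D.pl q).parent (D.pl q).face e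
          push_cast
          exact congrArg Neg.neg this) (hD.height_place_hexVertex q m') hw (hq m')
      have h2 : 0 ≤ -(D.height (D.pl q).face (D.place (D.pl q).parent w)) := this
      linarith
    · exact hD.nonneg_of_dominates hm hw (hp m)
  -- Replacing the later placement by its parent lowers the sum of the two numbers until the
  -- placements coincide.
  intro N
  induction N with
  | zero => intro p q h; omega
  | succ N ih =>
    intro p q hN hh hp hq
    rcases lt_trichotomy p q with hlt | rfl | hlt
    · obtain ⟨h1, h2, h3⟩ := step p q hlt hh hp hq
      rw [h3]
      exact ih p _ (by have : ((D.pl q).parent : ℕ) < q := h1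
                       omega) h2 hp (h3 ▸ hq)
    · rfl
    · obtain ⟨h1, h2, h3⟩ := step q p hlt hh.symm hq hp
      rw [h3]
      exact ih _ q (by have : ((D.pl p).parent : ℕ) < p := h1
                       omega) h2.symm (h3 ▸ hp) hq

/-- Every point of every hexagon is placed on the solid. -/
lemma Valid.exists_place_mem (hD : D.Valid) (i : Fin nh) {w : ℂ} (hw : w ∈ hexagon) :
    ∃ p, (D.pl p).hex = i ∧ D.place p w ∈ D.solid := by
  classical
  let G : Finset (Fin np) := {p | (D.pl p).hex = i ∧
    ((D.pl p).parent = p ∨ D.height (D.pl p).face (D.place (D.pl p).parent w) < 0)}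
  have hG : G.Nonempty := by
    obtain ⟨p, h1, h2⟩ := hD.root i
    exact ⟨p, by simp [G, h1, h2]⟩
  -- `G` contains the root and the placements whose crease is strictly crossed at `w`. Children come
  -- after their parent, so at the last member of `G` no crease of a child is crossed, and `cover`
  -- yields all facet inequalities.
  obtain ⟨p, hpG, hmax⟩ := G.exists_max_image id hG
  obtain ⟨hpi, hp⟩ : (D.pl p).hex = i ∧
    ((D.pl p).parent = p ∨ D.height (D.pl p).face (D.place (D.pl p).parent w) < 0) := by
    simpa [G] using hpG
  refine ⟨p, hpi, fun m => ?_⟩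
  rcases hD.cover p m with h | ⟨hne, h⟩ | ⟨q, hq, hqp, h⟩
  · exact nonneg_of_mem_hexagon ((D.height m).comp (D.place p))
      (fun e => by rw [hD.height_place_hexVertex]; exact_mod_cast h e) hw
  · have hneg := hp.resolve_left hne
    refine HexGlue.nonneg_of_dominates h (hD.height_place_hexVertex p m)
      (ψ := -((D.height (D.pl p).face).comp (D.place (D.pl p).parent)))
      (fun e => by
        have := hD.height_place_hexVertex (D.pl p).parent (D.pl p).face e
        push_cast
        exact congrArg Neg.neg this) hw ?_
    show 0 ≤ -(D.height (D.pl p).face (D.place (D.pl p).parent w))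
    linarith
  · subst hq
    obtain ⟨hlt, hhex, -, -⟩ := hD.crease_link q hqp.symm
    have hqG : q ∉ G := fun hq => absurd (hmax q hq) (not_le.2 hlt)
    have : 0 ≤ D.height (D.pl q).face (D.place (D.pl q).parent w) := by
      by_contra hneg
      exact hqG (by simp [G, ← hhex, hpi, not_le.1 hneg])
    exact hD.nonneg_of_dominates h hw this

open Classical in
/-- The folding of the `i`-th hexagon. -/
noncomputable def fold (D : HexPlan nf nh np) (i : Fin nh) (w : ℂ) : E3 :=
  -- For a valid plan the value `0` is taken only outside the hexagon.
  if h : ∃ p, (D.pl p).hex = i ∧ D.place p w ∈ D.solid then D.place h.choose w else 0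

lemma Valid.fold_eq (hD : D.Valid) {w : ℂ} (hw : w ∈ hexagon) {p : Fin np}
    (hp : D.place p w ∈ D.solid) : D.fold (D.pl p).hex w = D.place p w := by
  have h : ∃ q, (D.pl q).hex = (D.pl p).hex ∧ D.place q w ∈ D.solid := ⟨p, rfl, hp⟩
  rw [fold, dif_pos h]
  exact hD.place_eq_place hw _ _ _ (Nat.lt_succ_self _) h.choose_spec.1 h.choose_spec.2 hp

/-- The pieces are the parts of the hexagon that the various placements show on the solid: each is
cut out by half-planes, and the folding coincides on it with an isometric placement. -/
lemma Valid.isFolding (hD : D.Valid) (i : Fin nh) : IsFolding (D.fold i) := by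
  refine ⟨(fun p => {w ∈ hexagon | D.place p w ∈ D.solid}) '' {p | (D.pl p).hex = i},
    (Set.toFinite _).image _, ?_, ?_⟩
  · apply Set.Subset.antisymm
    · rintro w ⟨_, ⟨p, -, rfl⟩, hw⟩
      exact hw.1
    · intro w hw
      obtain ⟨p, hp, hpw⟩ := hD.exists_place_mem i hw
      exact ⟨_, ⟨p, hp, rfl⟩, hw, hpw⟩
  · rintro _ ⟨p, rfl, rfl⟩
    constructor
    · obtain ⟨t, ht, e⟩ := exists_finite_convexHull_inter_halfSpaces
        (fun m => (D.height m).comp (D.place p)) (Set.finite_range hexVertex) Finset.univ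
      refine ⟨t, ht, ?_⟩
      rw [← e]
      ext w
      simp [hexagon, solid]
    · rintro x ⟨hx, hxs⟩ y ⟨hy, hys⟩
      rw [hD.fold_eq hx hxs, hD.fold_eq hy hys, hD.dist_place]

/-! ### Points coincide in space exactly when they are glued -/

/-- The gluing of the hexagons described by a plan. -/
def gluing (D : HexPlan nf nh np) (hD : D.Valid) : HexGluing nh where
  partner := D.partner
  partner_partner := hD.partner_partner
  partner_ne := hD.partner_ne

lemma Valid.glued_nextCorner (hD : D.Valid) (x : Fin nh × Fin 6) :
    (D.gluing hD).Glued (x.1, hexVertex x.2) ((D.nextCorner x).1, hexVertex (D.nextCorner x).2) := by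
  refine Relation.EqvGen.rel _ _ ⟨x, 0, by simp, ?_, ?_⟩
  · rw [edgePoint_zero]
  · rw [sub_zero, edgePoint_one]
    rfl

lemma Valid.fold_hexVertex (hD : D.Valid) (i : Fin nh) (e : Fin 6) :
    D.fold i (hexVertex e) = D.ipos (D.cornerPt (D.home i e) e) := by
  obtain ⟨h1, h2⟩ := hD.home i e
  have hmem : D.place (D.home i e) (hexVertex e) ∈ D.solid := fun m => by
    have h := hD.height_place_hexVertex (D.home i e) m e
    rw [AffineMap.comp_apply] at h
    rw [h]
    exact_mod_cast h2 m
  have := hD.fold_eq (hexVertex_mem_hexagon e) hmem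
  rw [h1] at this
  rw [this, place_hexVertex]

lemma Valid.glued_of_corners (hD : D.Valid) {i i' : Fin nh} {e e' : Fin 6}
    (h : D.fold i (hexVertex e) = D.fold i' (hexVertex e')) :
    (D.gluing hD).Glued (i, hexVertex e) (i', hexVertex e') := by
  rw [hD.fold_hexVertex, hD.fold_hexVertex] at h
  have h' := hD.ipos_injective h
  rcases hD.corners i e i' e' (fun t => congrFun h' t) with h | h | h
  · obtain ⟨rfl, rfl⟩ := Prod.mk.injEq .. ▸ h
    exact Relation.EqvGen.refl _
  · have := hD.glued_nextCorner (i, e)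
    rwa [← h] at this
  · have h1 := hD.glued_nextCorner (i, e)
    have h2 := hD.glued_nextCorner (D.nextCorner (i, e))
    rw [← h] at h2
    exact h1.trans _ _ _ h2

lemma Valid.fold_nextCorner (hD : D.Valid) (x : Fin nh × Fin 6) :
    D.fold x.1 (hexVertex x.2) =
      D.fold (D.nextCorner x).1 (hexVertex (D.nextCorner x).2) := by
  rw [hD.fold_hexVertex, hD.fold_hexVertex]
  congr 1
  ext t
  exact hD.nextCorner x t

lemma motion_edgePoint (p : Fin np) (e : Fin 6) (t : ℝ) :
    D.motion p (edgePoint e t) = edgePoint (e + (D.pl p).rot) t + D.ctr p := by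
  rw [motion_apply, edgePoint_add]

lemma place_edgePoint (p : Fin np) (e : Fin 6) (t : ℝ) : D.place p (edgePoint e t) =
    AffineMap.lineMap (D.place p (hexVertex e)) (D.place p (hexVertex (e + 1))) t := by
  rw [edgePoint, AffineMap.apply_lineMap]

lemma Valid.height_place_edgePoint (hD : D.Valid) (p : Fin np) (m : Fin nf) (e : Fin 6) (t : ℝ) :
    D.height m (D.place p (edgePoint e t)) = (1 - t) * D.val p m e + t * D.val p m (e + 1) := by
  rw [place_edgePoint, AffineMap.apply_lineMap, AffineMap.lineMap_apply_module]
  have h1 := hD.height_place_hexVertex p m e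
  have h2 := hD.height_place_hexVertex p m (e + 1)
  rw [AffineMap.comp_apply] at h1 h2
  rw [h1, h2]
  rfl

lemma edgePoint_opposite (d : Fin 6) (t : ℝ) : edgePoint (d + 3) (1 - t) =
    edgePoint d t - (((offset d).1 : ℝ) + ((offset d).2 : ℝ) * rho) := by
  apply ex_ey_ext
  · rw [map_sub, ex_lattice, ex_edgePoint, ex_edgePoint]
    fin_cases d <;> simp [corner, offset] <;> ring
  · rw [map_sub, ey_lattice, ey_edgePoint, ey_edgePoint]
    fin_cases d <;> simp [corner, offset] <;> ring

lemma ctr_add_offset {p q : Fin np} {d : Fin 6}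
    (h : (D.pl q).center = (D.pl p).center + offset d) :
    D.ctr q = D.ctr p + (((offset d).1 : ℝ) + ((offset d).2 : ℝ) * rho) := by
  rw [ctr, ctr, h]
  push_cast
  simp only [Prod.fst_add, Prod.snd_add]
  push_cast
  ring

/-- The alternatives of the edge condition, for a point of the edge that lies on the solid. -/
lemma Valid.edge_cases (hD : D.Valid) (p : Fin np) (e : Fin 6) {t : ℝ} (ht : t ∈ Set.Icc (0 : ℝ) 1)
    (hs : D.place p (edgePoint e t) ∈ D.solid) :
    (∃ q, (D.pl q).face = (D.pl p).face ∧
      (D.pl q).center = (D.pl p).center + offset (e + (D.pl p).rot) ∧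
      D.partner ((D.pl p).hex, e) = ((D.pl q).hex, e + (D.pl p).rot + 3 - (D.pl q).rot)) ∨
    t = 0 ∨ t = 1 := by
  rcases hD.edge p e with h | ⟨m, h1, h2, h3⟩
  · exact Or.inl h
  · right
    have hm := hs m
    rw [hD.height_place_edgePoint] at hm
    have h1' : (D.val p m e : ℝ) ≤ 0 := by exact_mod_cast h1
    have h2' : (D.val p m (e + 1) : ℝ) ≤ 0 := by exact_mod_cast h2
    have k1 : (1 - t) * (D.val p m e : ℝ) ≤ 0 :=
      mul_nonpos_of_nonneg_of_nonpos (by linarith [ht.2]) h1'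
    have k2 : t * (D.val p m (e + 1) : ℝ) ≤ 0 := mul_nonpos_of_nonneg_of_nonpos ht.1 h2'
    rcases h3 with h3 | h3
    · right
      have h3' : (D.val p m e : ℝ) ≠ 0 := by exact_mod_cast h3.ne
      have : (1 - t) * (D.val p m e : ℝ) = 0 := by linarith
      have := (mul_eq_zero.1 this).resolve_right h3'
      linarith
    · left
      have h3' : (D.val p m (e + 1) : ℝ) ≠ 0 := by exact_mod_cast h3.ne
      have : t * (D.val p m (e + 1) : ℝ) = 0 := by linarith
      exact (mul_eq_zero.1 this).resolve_right h3'

/-- Either the partner is placed as the neighbour in the same chart, so that both edges are the same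
segment there, or the point is an endpoint and the corner table applies. -/
lemma Valid.fold_eq_of_step (hD : D.Valid) {x y : Fin nh × ℂ} (h : (D.gluing hD).Step x y) :
    D.fold x.1 x.2 = D.fold y.1 y.2 := by
  obtain ⟨⟨i, e⟩, t, ht, rfl, rfl⟩ := h
  have ht' : 1 - t ∈ Set.Icc (0 : ℝ) 1 := ⟨by linarith [ht.2], by linarith [ht.1]⟩
  obtain ⟨p, rfl, hp⟩ := hD.exists_place_mem i (edgePoint_mem_hexagon e ht)
  show D.fold _ (edgePoint e t) = D.fold (D.partner ((D.pl p).hex, e)).1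
    (edgePoint (D.partner ((D.pl p).hex, e)).2 (1 - t))
  rcases hD.edge_cases p e ht hp with ⟨q, h1, h2, h3⟩ | rfl | rfl
  · rw [h3]
    have key : D.place q (edgePoint (e + (D.pl p).rot + 3 - (D.pl q).rot) (1 - t)) =
        D.place p (edgePoint e t) := by
      rw [place_apply, place_apply, h1, motion_edgePoint, motion_edgePoint, sub_add_cancel,
        edgePoint_opposite, ctr_add_offset h2]
      congr 1
      ring
    rw [hD.fold_eq (edgePoint_mem_hexagon e ht) hp,
      hD.fold_eq (edgePoint_mem_hexagon _ ht') (key ▸ hp), key]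
  · rw [edgePoint_zero, sub_zero, edgePoint_one]
    exact hD.fold_nextCorner ((D.pl p).hex, e)
  · rw [edgePoint_one, sub_self, edgePoint_zero]
    have := hD.fold_nextCorner (D.partner ((D.pl p).hex, e))
    rw [HexPlan.nextCorner, hD.partner_partner] at this
    exact this.symm

lemma Valid.fold_eq_of_glued (hD : D.Valid) {x y : Fin nh × ℂ} (h : (D.gluing hD).Glued x y) :
    D.fold x.1 x.2 = D.fold y.1 y.2 := by
  induction h with
  | rel _ _ h => exact hD.fold_eq_of_step h
  | refl => rfl
  | symm _ _ _ ih => exact ih.symm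
  | trans _ _ _ _ _ ih1 ih2 => exact ih1.trans ih2

/-- Charts are injective, so the two honeycomb hexagons meet: they are equal or share an edge. In
the latter case the edge is glued according to `edge`, or the point is a corner and `corners`
decides. -/
lemma Valid.glued_of_same_face (hD : D.Valid) {p q : Fin np} (hf : (D.pl p).face = (D.pl q).face)
    {w w' : ℂ} (hw : w ∈ hexagon) (hw' : w' ∈ hexagon) (hp : D.place p w ∈ D.solid)
    (h : D.place p w = D.place q w') :
    (D.gluing hD).Glued ((D.pl p).hex, w) ((D.pl q).hex, w') := by
  have hm : D.motion p w = D.motion q w' := by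
    rw [place_apply, place_apply, ← hf] at h
    exact hD.chart_injective _ h
  rw [motion_apply, motion_apply] at hm
  have hsub : hexVertex (D.pl p).rot * w - hexVertex (D.pl q).rot * w' =
      (((D.pl q).center.1 - (D.pl p).center.1 : ℤ) : ℝ) +
        (((D.pl q).center.2 - (D.pl p).center.2 : ℤ) : ℝ) * rho := by
    rw [ctr, ctr] at hm
    push_cast
    linear_combination hm
  rcases eq_or_exists_edge_of_sub_eq (hexVertex_mul_mem_hexagon _ hw)
    (hexVertex_mul_mem_hexagon _ hw') (hD.lattice q p hf.symm) hsub with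
    ⟨h1, h2⟩ | ⟨d, t, ht, h1, h2, h3⟩
  · have hpq : p = q := hD.key p q hf (Prod.ext (by linarith) (by linarith))
    subst hpq
    have : w = w' := mul_left_cancel₀ (hexVertex_ne_zero (D.pl p).rot) (add_right_cancel hm)
    rw [this]
    exact Relation.EqvGen.refl _
  · have hw1 : w = edgePoint (d - (D.pl p).rot) t := by
      apply mul_left_cancel₀ (hexVertex_ne_zero (D.pl p).rot)
      rw [h1, ← edgePoint_add, sub_add_cancel]
    have hw2 : w' = edgePoint (d + 3 - (D.pl q).rot) (1 - t) := by
      apply mul_left_cancel₀ (hexVertex_ne_zero (D.pl q).rot)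
      rw [h2, ← edgePoint_add, sub_add_cancel]
    have hcenter : (D.pl q).center = (D.pl p).center + offset d := by
      rw [← h3]
      ext <;> simp
    have hq : D.place q w' ∈ D.solid := h ▸ hp
    have hfold : D.fold (D.pl p).hex w = D.fold (D.pl q).hex w' := by
      rw [hD.fold_eq hw hp, hD.fold_eq hw' hq, h]
    rcases hD.edge_cases p (d - (D.pl p).rot) ht (hw1 ▸ hp) with ⟨q', k1, k2, k3⟩ | rfl | rfl
    · rw [sub_add_cancel] at k2 k3
      obtain rfl : q' = q := hD.key q' q (k1.trans hf) (k2.trans hcenter.symm)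
      refine Relation.EqvGen.rel _ _ ⟨((D.pl p).hex, d - (D.pl p).rot), t, ht, ?_, ?_⟩
      · rw [hw1]
      · show _ = ((D.partner _).1, edgePoint (D.partner _).2 (1 - t))
        rw [k3, hw2]
    · rw [edgePoint_zero] at hw1
      rw [sub_zero, edgePoint_one] at hw2
      rw [hw1, hw2] at hfold ⊢
      exact hD.glued_of_corners hfold
    · rw [edgePoint_one] at hw1
      rw [sub_self, edgePoint_zero] at hw2
      rw [hw1, hw2] at hfold ⊢
      exact hD.glued_of_corners hfold

lemma Valid.exists_transfer_or_corner (hD : D.Valid) {p : Fin np} {l : Fin nf}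
    (hl : l ≠ (D.pl p).face) {w : ℂ} (hw : w ∈ hexagon) (hp : D.place p w ∈ D.solid)
    (h0 : D.height l (D.place p w) = 0) :
    (∃ q, (D.pl q).face = l ∧ (D.pl q).hex = (D.pl p).hex ∧ D.place q w = D.place p w) ∨
      ∃ e, w = hexVertex e := by
  rcases hD.transfer p l hl with ⟨q, h1, h2, h3⟩ | ⟨m, hm⟩
  · exact Or.inl ⟨q, h1, h2, hD.place_eq_of_linked h3 hw h0⟩
  · exact Or.inr (exists_eq_hexVertex_of_meetsInCorner hm (hD.height_place_hexVertex p l)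
      (hD.height_place_hexVertex p m) hw h0 (hp m))

/-- A point shown in two facets lies on both planes. Transferring one of the hexagons to the facet
of the other reduces to a single facet; if neither can be transferred, both points are corners. -/
lemma Valid.glued_of_place_eq (hD : D.Valid) {p q : Fin np} {w w' : ℂ} (hw : w ∈ hexagon)
    (hw' : w' ∈ hexagon) (hp : D.place p w ∈ D.solid) (h : D.place p w = D.place q w') :
    (D.gluing hD).Glued ((D.pl p).hex, w) ((D.pl q).hex, w') := by
  by_cases hf : (D.pl p).face = (D.pl q).face
  · exact hD.glued_of_same_face hf hw hw' hp h
  have hq : D.place q w' ∈ D.solid := h ▸ hp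
  rcases hD.exists_transfer_or_corner (Ne.symm hf) hw hp
    (by rw [h]; exact hD.height_place_self q w') with ⟨p', h1, h2, h3⟩ | ⟨e, he⟩
  · have := hD.glued_of_same_face h1 hw hw' (h3 ▸ hp) (h3.trans h)
    rwa [h2] at this
  rcases hD.exists_transfer_or_corner hf hw' hq
    (by rw [← h]; exact hD.height_place_self p w) with ⟨q', h1, h2, h3⟩ | ⟨e', he'⟩
  · have := hD.glued_of_same_face h1.symm hw hw' hp (h.trans h3.symm)
    rwa [h2] at this
  have hfold : D.fold (D.pl p).hex w = D.fold (D.pl q).hex w' := by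
    rw [hD.fold_eq hw hp, hD.fold_eq hw' hq, h]
  rw [he, he'] at hfold ⊢
  exact hD.glued_of_corners hfold

lemma Valid.fold_eq_iff_glued (hD : D.Valid) {i j : Fin nh} {w w' : ℂ} (hw : w ∈ hexagon)
    (hw' : w' ∈ hexagon) : D.fold i w = D.fold j w' ↔ (D.gluing hD).Glued (i, w) (j, w') := by
  refine ⟨fun h => ?_, fun h => hD.fold_eq_of_glued h⟩
  obtain ⟨p, rfl, hp⟩ := hD.exists_place_mem i hw
  obtain ⟨q, rfl, hq⟩ := hD.exists_place_mem j hw'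
  rw [hD.fold_eq hw hp, hD.fold_eq hw' hq] at h
  exact hD.glued_of_place_eq hw hw' hp h

end HexPlan

/-! ### The placed hexagons cover the boundary -/

namespace HexPlan

variable {nf nh np : ℕ} {D : HexPlan nf nh np}

lemma continuous_height (m : Fin nf) : Continuous (D.height m) :=
  AffineMap.continuous_of_finiteDimensional _

lemma isClosed_solid : IsClosed D.solid := by
  have : D.solid = ⋂ m, {x | 0 ≤ D.height m x} := by ext; simp [solid]
  rw [this]
  exact isClosed_iInter fun m => isClosed_le continuous_const (continuous_height m)

lemma Valid.slope_ne_zero (hD : D.Valid) (m : Fin nf) : D.slope m ≠ 0 := by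
  intro h
  have key : ∀ x : Fin 3 → ℝ, (D.facet m 1 * x 0 + D.facet m 2 * x 1 + D.facet m 3 * x 2 : ℝ) = 0 := by
    intro x
    rw [← hD.slope_pos, h, LinearMap.zero_apply]
  have h1 := key ![1, 0, 0]
  have h2 := key ![0, 1, 0]
  have h3 := key ![0, 0, 1]
  simp at h1 h2 h3
  rcases hD.normal m with h | h | h <;> contradiction

lemma Valid.frontier_solid (hD : D.Valid) :
    frontier D.solid = {x ∈ D.solid | ∃ k, D.height k x = 0} := by
  have hinterior : interior D.solid = {x | ∀ m, 0 < D.height m x} := by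
    apply Set.Subset.antisymm
    · intro x hx m
      refine lt_of_le_of_ne (interior_subset hx m) fun h0 => ?_
      -- At a point of height zero the height changes sign along `v`, so points on one side leave
      -- the solid.
      obtain ⟨v, hv⟩ : ∃ v, D.slope m v ≠ 0 := by
        by_contra! h
        exact hD.slope_ne_zero m (LinearMap.ext h)
      have hcont : Filter.Tendsto (fun ε : ℝ => x + ε • v) (nhds 0) (nhds x) := by
        have : Continuous fun ε : ℝ => x + ε • v := by fun_prop
        simpa using this.tendsto 0
      have hev := hcont.eventually (isOpen_interior.mem_nhds hx)
      rw [Metric.eventually_nhds_iff] at hev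
      obtain ⟨δ, hδ, hev⟩ := hev
      have hh : ∀ ε : ℝ, D.height m (x + ε • v) = ε * D.slope m v := fun ε => by
        rw [height_apply, map_add, map_smul, smul_eq_mul]
        rw [height_apply] at h0
        linarith
      have h1 := interior_subset (hev (y := δ / 2) (by simp [abs_of_pos hδ]; linarith)) m
      have h2 := interior_subset (hev (y := -(δ / 2)) (by simp [abs_of_pos hδ]; linarith)) m
      rw [hh] at h1 h2
      have : δ / 2 * D.slope m v = 0 := by linarith
      rcases mul_eq_zero.1 this with h | h
      · linarith
      · exact hv h
    · refine interior_maximal (fun x hx m => (hx m).le) ?_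
      have : {x | ∀ m, 0 < D.height m x} = ⋂ m, {x | 0 < D.height m x} := by ext; simp
      rw [this]
      exact isOpen_iInter_of_finite fun m => isOpen_lt continuous_const (continuous_height m)
  rw [isClosed_solid.frontier_eq, hinterior]
  ext x
  simp only [Set.mem_sdiff, Set.mem_ofPred_eq, not_forall, not_lt]
  refine and_congr_right fun hx => exists_congr fun k => ⟨fun h => le_antisymm h (hx k), fun h => h.le⟩

/-- The linear part of the chart has two-dimensional range inside the kernel of the slope, which is
also two-dimensional. -/
lemma Valid.exists_chart_eq (hD : D.Valid) (k : Fin nf) {x : E3} (hx : D.height k x = 0) :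
    ∃ z, D.chart k z = x := by
  have hinj : Function.Injective (D.chart k).linear :=
    (AffineMap.linear_injective_iff _).2 (hD.chart_injective k)
  have hle : LinearMap.range (D.chart k).linear ≤ LinearMap.ker (D.slope k) := by
    rintro _ ⟨z, rfl⟩
    have h1 := hD.height_chart_self k z
    have h2 := hD.height_chart_self k 0
    have h3 : D.chart k z = (D.chart k).linear z + D.chart k 0 := by
      simpa using (D.chart k).map_vadd 0 z
    rw [h3] at h1
    rw [height_apply] at h1 h2
    rw [map_add] at h1
    rw [LinearMap.mem_ker]
    linarith
  have hr : Module.finrank ℝ (LinearMap.range (D.chart k).linear) = 2 := by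
    rw [LinearMap.finrank_range_of_inj hinj, Complex.finrank_real_complex]
  have hk : Module.finrank ℝ (LinearMap.ker (D.slope k)) = 2 := by
    have h1 := (D.slope k).finrank_range_add_finrank_ker
    have h2 : LinearMap.range (D.slope k) = ⊤ :=
      LinearMap.range_eq_top.2 (LinearMap.surjective (hD.slope_ne_zero k))
    rw [h2, finrank_top, Module.finrank_self, finrank_euclideanSpace_fin] at h1
    omega
  have heq := Submodule.eq_of_le_of_finrank_eq hle (hr.trans hk.symm)
  have hmem : x - D.chart k 0 ∈ LinearMap.ker (D.slope k) := by
    have h2 := hD.height_chart_self k 0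
    rw [height_apply] at hx h2
    rw [LinearMap.mem_ker, map_sub]
    linarith
  rw [← heq] at hmem
  obtain ⟨z, hz⟩ := hmem
  refine ⟨z, ?_⟩
  have h3 : D.chart k z = (D.chart k).linear z + D.chart k 0 := by
    simpa using (D.chart k).map_vadd 0 z
  rw [h3, hz, sub_add_cancel]

/-- The interior of a facet, in its chart. -/
def openFacet (D : HexPlan nf nh np) (k : Fin nf) : Set ℂ :=
  {z | ∀ m, m ≠ k → 0 < D.height m (D.chart k z)}

lemma convex_openFacet (k : Fin nf) : Convex ℝ (D.openFacet k) := by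
  have : D.openFacet k = ⋂ (m) (_ : m ≠ k), ((D.height m).comp (D.chart k)) ⁻¹' Set.Ioi 0 := by
    ext z; simp [openFacet]
  rw [this]
  exact convex_iInter₂ fun m _ => (convex_Ioi (0 : ℝ)).affine_preimage _

lemma Valid.openFacet_subset (hD : D.Valid) (k : Fin nf) :
    D.openFacet k ⊆ D.chart k ⁻¹' D.solid := by
  intro z hz m
  by_cases h : m = k
  · subst h
    exact (hD.height_chart_self m z).ge
  · exact (hz m h).le

/-- The part of a chart covered by the placed hexagons. -/
def covered (D : HexPlan nf nh np) (k : Fin nf) : Set ℂ :=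
  ⋃ p ∈ {p : Fin np | (D.pl p).face = k}, (fun z => z - D.ctr p) ⁻¹' hexagon

lemma isClosed_covered (k : Fin nf) : IsClosed (D.covered k) :=
  (Set.toFinite _).isClosed_biUnion fun _ _ =>
    isCompact_hexagon.isClosed.preimage (continuous_id.sub continuous_const)

lemma Valid.exists_inner (hD : D.Valid) (k : Fin nf) (hk : ∃ m : Fin nf, m ≠ k) :
    (D.openFacet k ∩ D.covered k).Nonempty := by
  obtain ⟨hf, h0, hpos⟩ := hD.inner k
  set p := (D.inner k).1
  set c := (D.inner k).2
  have hc0 : ∀ e, (0 : ℝ) ≤ c e := fun e => by exact_mod_cast h0 e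
  have hS : 0 < ∑ e, (c e : ℝ) := by
    refine lt_of_le_of_ne (Finset.sum_nonneg fun e _ => hc0 e) fun h => ?_
    have hz := (Finset.sum_eq_zero_iff_of_nonneg (fun e _ => hc0 e)).1 h.symm
    obtain ⟨m, hm⟩ := hk
    have := hpos m hm
    rw [Finset.sum_eq_zero fun e he => by
      rw [show c e = 0 by exact_mod_cast hz e he, zero_mul]] at this
    exact lt_irrefl _ this
  set S := ∑ e, (c e : ℝ)
  have h1 : ∑ e, (c e / S : ℝ) = 1 := by rw [← Finset.sum_div, div_self hS.ne']
  have hw : ∑ e, (c e / S : ℝ) • hexVertex e ∈ hexagon :=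
    mem_hexagon_iff_weights.2 ⟨_, fun e => div_nonneg (hc0 e) hS.le, h1, rfl⟩
  refine ⟨D.motion p (∑ e, (c e / S : ℝ) • hexVertex e), fun m hm => ?_, ?_⟩
  · have e1 : D.height m (D.chart k (D.motion p (∑ e, (c e / S : ℝ) • hexVertex e))) =
      ((D.height m).comp (D.place p)) (∑ e, (c e / S : ℝ) • hexVertex e) := by rw [← hf]; rfl
    rw [e1, AffineMap.map_sum_weights _ _ h1]
    simp only [hD.height_place_hexVertex, smul_eq_mul]
    have : ∑ e, (c e / S : ℝ) * (D.val p m e : ℝ) = (∑ e, c e * D.val p m e : ℤ) / S := by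
      push_cast
      rw [Finset.sum_div]
      exact Finset.sum_congr rfl fun e _ => by ring
    rw [this]
    exact div_pos (by exact_mod_cast hpos m hm) hS
  · refine Set.mem_biUnion (x := p) hf ?_
    rw [Set.mem_preimage, motion_apply, add_sub_cancel_right]
    exact hexVertex_mul_mem_hexagon _ hw

/-- A placed hexagon and a hexagon of the honeycomb that is not placed do not meet in the interior of
a facet. -/
lemma Valid.exists_center_eq (hD : D.Valid) {k : Fin nf} {z : ℂ} (hz : z ∈ D.openFacet k)
    {p : Fin np} (hp : (D.pl p).face = k) (hzp : z - D.ctr p ∈ hexagon) {c : ℤ × ℤ}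
    (hc : 3 ∣ (c.1 - (D.pl p).center.1) - (c.2 - (D.pl p).center.2))
    (hzc : z - ((c.1 : ℝ) + (c.2 : ℝ) * rho) ∈ hexagon) :
    ∃ q, (D.pl q).face = k ∧ (D.pl q).center = c := by
  have hsub : (z - D.ctr p) - (z - ((c.1 : ℝ) + (c.2 : ℝ) * rho)) =
      ((c.1 - (D.pl p).center.1 : ℤ) : ℝ) + ((c.2 - (D.pl p).center.2 : ℤ) : ℝ) * rho := by
    rw [ctr]
    push_cast
    ring
  rcases eq_or_exists_edge_of_sub_eq hzp hzc hc hsub with ⟨h1, h2⟩ | ⟨d, t, ht, h1, -, h3⟩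
  · exact ⟨p, hp, Prod.ext (by linarith) (by linarith)⟩
  · rcases hD.edge p (d - (D.pl p).rot) with ⟨q, k1, k2, -⟩ | ⟨m, k1, k2, k3⟩
    · refine ⟨q, k1.trans hp, ?_⟩
      rw [k2, sub_add_cancel, ← h3]
      ext <;> simp
    · exfalso
      have hplace : D.place p (edgePoint (d - (D.pl p).rot) t) = D.chart k z := by
        rw [place_apply, motion_edgePoint, sub_add_cancel, ← h1, sub_add_cancel, hp]
      -- The functional of the facet itself vanishes on its placed hexagons, whereas the obstructing
      -- one is negative at an endpoint of the edge.
      have hm : m ≠ k := by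
        rintro rfl
        have hv : ∀ e, D.val p m e = 0 := fun e => by
          have := hD.height_place_hexVertex p m e
          rw [AffineMap.comp_apply, ← hp, hD.height_place_self] at this
          rw [← hp]
          exact_mod_cast this.symm
        rw [hv, hv] at k3
        simp at k3
      have h0 := hz m hm
      rw [← hplace, hD.height_place_edgePoint] at h0
      have h1' : (D.val p m (d - (D.pl p).rot) : ℝ) ≤ 0 := by exact_mod_cast k1
      have h2' : (D.val p m (d - (D.pl p).rot + 1) : ℝ) ≤ 0 := by exact_mod_cast k2
      have j1 := mul_nonpos_of_nonneg_of_nonpos (show 0 ≤ 1 - t by linarith [ht.2]) h1'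
      have j2 := mul_nonpos_of_nonneg_of_nonpos ht.1 h2'
      linarith

/-- The open facet is convex, hence connected, and lies in the union of two closed sets: the placed
hexagons and the other honeycomb hexagons near it, finitely many by boundedness. The two sets do not
meet inside the open facet by `Valid.exists_center_eq`, and the first one is hit by
`Valid.exists_inner`. -/
lemma Valid.openFacet_subset_covered (hD : D.Valid) (hb : Bornology.IsBounded D.solid) (k : Fin nf)
    (hk : ∃ m : Fin nf, m ≠ k) : D.openFacet k ⊆ D.covered k := by
  have hU : Bornology.IsBounded (D.openFacet k) := by
    have hiso : Isometry (D.chart k) := Isometry.of_dist_eq fun z w => by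
      rw [dist_eq_norm, dist_eq_norm, hD.norm_chart_sub]
    exact (hiso.antilipschitz.isBounded_preimage hb).subset (hD.openFacet_subset k)
  obtain ⟨M, hM⟩ : ∃ M : ℝ, ∀ z ∈ D.openFacet k, |ex z| ≤ M ∧ |ey z| ≤ M := by
    obtain ⟨M₁, h₁⟩ := (Metric.isBounded_iff_subset_closedBall 0).1
      ((LinearMap.toContinuousLinearMap ex).lipschitz.isBounded_image hU)
    obtain ⟨M₂, h₂⟩ := (Metric.isBounded_iff_subset_closedBall 0).1
      ((LinearMap.toContinuousLinearMap ey).lipschitz.isBounded_image hU)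
    refine ⟨max M₁ M₂, fun z hz => ⟨?_, ?_⟩⟩
    · have := h₁ ⟨z, hz, rfl⟩
      rw [mem_closedBall_zero_iff] at this
      exact this.trans (le_max_left _ _)
    · have := h₂ ⟨z, hz, rfl⟩
      rw [mem_closedBall_zero_iff] at this
      exact this.trans (le_max_right _ _)
  obtain ⟨z₀, hz₀, hz₀'⟩ := hD.exists_inner k hk
  obtain ⟨p₀, hp₀, hzp₀⟩ := Set.mem_iUnion₂.1 hz₀'
  have hp₀' : (D.pl p₀).face = k := hp₀
  -- The coordinates of a point of a hexagon differ by at most 1 from those of the centre.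
  obtain ⟨N, hN⟩ := exists_nat_ge (M + 1)
  let S : Set (ℤ × ℤ) := {c | c ∈ Set.Icc (-(N : ℤ)) N ×ˢ Set.Icc (-(N : ℤ)) N ∧
    3 ∣ (c.1 - (D.pl p₀).center.1) - (c.2 - (D.pl p₀).center.2) ∧
    ∀ q, (D.pl q).face = k → (D.pl q).center ≠ c}
  have hSfin : S.Finite :=
    ((Set.finite_Icc _ _).prod (Set.finite_Icc _ _)).subset fun c hc => hc.1
  let K : Set ℂ := ⋃ c ∈ S, (fun z => z - (((c : ℤ × ℤ).1 : ℝ) + (c.2 : ℝ) * rho)) ⁻¹' hexagon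
  have hKc : IsClosed K := hSfin.isClosed_biUnion fun c _ =>
    isCompact_hexagon.isClosed.preimage (continuous_id.sub continuous_const)
  have hcov : D.openFacet k ⊆ D.covered k ∪ K := by
    intro z hz
    obtain ⟨x, y, hxy, hh⟩ := exists_sub_lattice_mem_hexagon (z - D.ctr p₀)
    set c : ℤ × ℤ := ((D.pl p₀).center.1 + x, (D.pl p₀).center.2 + y) with hc
    have hmem : z - ((c.1 : ℝ) + (c.2 : ℝ) * rho) ∈ hexagon := by
      convert hh using 1
      rw [ctr, hc]
      push_cast
      ring
    by_cases hq : ∃ q, (D.pl q).face = k ∧ (D.pl q).center = c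
    · obtain ⟨q, h1, h2⟩ := hq
      left
      refine Set.mem_biUnion (x := q) h1 ?_
      rw [Set.mem_preimage, ctr, h2]
      exact hmem
    · right
      refine Set.mem_biUnion (x := c) ⟨?_, ?_, fun q h1 h2 => hq ⟨q, h1, h2⟩⟩ hmem
      · obtain ⟨b1, b2, -⟩ := mem_hexagon_iff.1 hmem
        rw [map_sub, ex_lattice, abs_le] at b1
        rw [map_sub, ey_lattice, abs_le] at b2
        obtain ⟨a1, a2⟩ := hM z hz
        rw [abs_le] at a1 a2
        refine ⟨⟨?_, ?_⟩, ?_, ?_⟩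
        · have : (-(N : ℝ)) ≤ c.1 := by linarith
          exact_mod_cast this
        · have : (c.1 : ℝ) ≤ N := by linarith
          exact_mod_cast this
        · have : (-(N : ℝ)) ≤ c.2 := by linarith
          exact_mod_cast this
        · have : (c.2 : ℝ) ≤ N := by linarith
          exact_mod_cast this
      · rw [hc]
        simpa using hxy
  intro z hz
  by_contra hzc
  have hzK : z ∈ K := (hcov hz).resolve_left hzc
  obtain ⟨y, hyU, hyC, hyK⟩ := isPreconnected_closed_iff.1 (convex_openFacet k).isPreconnected
    _ _ (isClosed_covered k) hKc hcov ⟨z₀, hz₀, hz₀'⟩ ⟨z, hz, hzK⟩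
  obtain ⟨p, hp, hyp⟩ := Set.mem_iUnion₂.1 hyC
  obtain ⟨c, ⟨-, hc, hcq⟩, hyc⟩ := Set.mem_iUnion₂.1 hyK
  have hp' : (D.pl p).face = k := hp
  have h3 := hD.lattice p₀ p (hp₀'.trans hp'.symm)
  obtain ⟨q, h1, h2⟩ := hD.exists_center_eq hyU hp hyp (c := c) (by omega) hyc
  exact hcq q h1 h2

/-- A point of the closed facet is the limit of points on the segment to an interior point; these
are covered, and the covered part is closed. -/
lemma Valid.exists_place_eq (hD : D.Valid) (hb : Bornology.IsBounded D.solid) {k : Fin nf}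
    (hk : ∃ m : Fin nf, m ≠ k) {x : E3} (hx : x ∈ D.solid) (h0 : D.height k x = 0) :
    ∃ p, ∃ w ∈ hexagon, D.place p w = x := by
  obtain ⟨z, rfl⟩ := hD.exists_chart_eq k h0
  obtain ⟨z₀, hz₀, -⟩ := hD.exists_inner k hk
  have hz : z ∈ D.covered k := by
    have hlim : Filter.Tendsto (fun n : ℕ => AffineMap.lineMap z z₀ (1 / ((n : ℝ) + 1)))
        Filter.atTop (nhds (AffineMap.lineMap z z₀ (0 : ℝ))) :=
      (AffineMap.lineMap_continuous.tendsto 0).comp tendsto_one_div_add_atTop_nhds_zero_nat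
    rw [AffineMap.lineMap_apply_zero] at hlim
    refine (isClosed_covered k).mem_of_tendsto hlim (Filter.Eventually.of_forall fun n => ?_)
    refine hD.openFacet_subset_covered hb k hk fun m hm => ?_
    rw [AffineMap.apply_lineMap, AffineMap.apply_lineMap, AffineMap.lineMap_apply_module]
    have h1 := hx m
    have h2 := hz₀ m hm
    have h3 : 0 < 1 / ((n : ℝ) + 1) := by positivity
    have h4 : 1 / ((n : ℝ) + 1) ≤ 1 := by
      rw [div_le_one (by positivity)]
      linarith [n.cast_nonneg (α := ℝ)]
    have := mul_nonneg (sub_nonneg.2 h4) h1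
    have := mul_pos h3 h2
    simp only [smul_eq_mul]
    linarith
  obtain ⟨p, hp, hzp⟩ := Set.mem_iUnion₂.1 hz
  have hface : (D.pl p).face = k := hp
  refine ⟨p, hexVertex (-(D.pl p).rot) * (z - D.ctr p), hexVertex_mul_mem_hexagon _ hzp, ?_⟩
  rw [place_apply, motion_apply, ← mul_assoc, ← hexVertex_add, add_neg_cancel, hexVertex_zero,
    one_mul, sub_add_cancel, hface]

/-- A valid plan wraps the hexagons around its solid. -/
theorem Valid.yields (hD : D.Valid) (hb : Bornology.IsBounded D.solid)
    (hk : ∀ k : Fin nf, ∃ m : Fin nf, m ≠ k) : (D.gluing hD).Yields D.solid := by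
  refine ⟨D.fold, hD.isFolding, ?_, fun i j z hz w hw => hD.fold_eq_iff_glued hz hw⟩
  rw [hD.frontier_solid]
  apply Set.Subset.antisymm
  · intro x hx
    obtain ⟨i, w, hw, rfl⟩ := Set.mem_iUnion.1 hx
    obtain ⟨p, rfl, hp⟩ := hD.exists_place_mem i hw
    rw [hD.fold_eq hw hp]
    exact ⟨hp, _, hD.height_place_self p w⟩
  · rintro x ⟨hx, k, h0⟩
    obtain ⟨p, w, hw, rfl⟩ := hD.exists_place_eq hb (hk k) hx h0
    exact Set.mem_iUnion.2 ⟨(D.pl p).hex, w, hw, hD.fold_eq hw hx⟩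

end HexPlan

/-! ### Faces of a polytope with given vertices -/

section Faces

variable {n : ℕ} {v : Fin n → E3}

/-- Some linear functional attains its maximum on the points `v i` exactly for `i ∈ S`. -/
def IsFaceSet (v : Fin n → E3) (S : Finset (Fin n)) : Prop :=
  ∃ (l : E3 →ₗ[ℝ] ℝ) (c : ℝ), (∀ i ∈ S, l (v i) = c) ∧ ∀ i ∉ S, l (v i) < c

lemma image_subset_hull (v : Fin n → E3) (S : Finset (Fin n)) :
    convexHull ℝ (v '' S) ⊆ convexHull ℝ (Set.range v) :=
  convexHull_mono (Set.image_subset_range _ _)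

lemma IsFaceSet.isExposed {S : Finset (Fin n)} (h : IsFaceSet v S) :
    IsExposed ℝ (convexHull ℝ (Set.range v)) (convexHull ℝ (v '' S)) := by
  obtain ⟨l, c, h1, h2⟩ := h
  have hle : ∀ i, l (v i) ≤ c := fun i => by
    by_cases hi : i ∈ S
    exacts [(h1 i hi).le, (h2 i hi).le]
  intro hne
  refine ⟨LinearMap.toContinuousLinearMap l, ?_⟩
  have hmax : ∀ y ∈ convexHull ℝ (Set.range v), l y ≤ c := by
    intro y hy
    refine convexHull_min (s := Set.range v) (t := {y | l y ≤ c}) ?_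
      (convex_halfSpace_le l.isLinear c) hy
    rintro _ ⟨i, rfl⟩
    exact hle i
  have heq : ∀ y ∈ convexHull ℝ (v '' S), l y = c := by
    intro y hy
    refine convexHull_min (s := v '' S) (t := {y | l y = c}) ?_
      (convex_hyperplane l.isLinear c) hy
    rintro _ ⟨i, hi, rfl⟩
    exact h1 i hi
  apply Set.Subset.antisymm
  · intro x hx
    refine ⟨image_subset_hull v S hx, fun y hy => ?_⟩
    show l y ≤ l x
    rw [heq x hx]
    exact hmax y hy
  · rintro x ⟨hx, hxmax⟩
    obtain ⟨y, hy⟩ := hne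
    have hxc : l x = c := by
      refine le_antisymm (hmax x hx) ?_
      rw [← heq y hy]
      exact hxmax y (image_subset_hull v S hy)
    obtain ⟨w, w0, w1, rfl⟩ := mem_convexHull_range_iff.1 hx
    -- A point where the maximum is attained can carry no weight on vertices with a smaller value.
    have hz : ∀ i, w i * (c - l (v i)) = 0 := by
      have hs : ∑ i, w i * (c - l (v i)) = 0 := by
        simp only [mul_sub, Finset.sum_sub_distrib, ← Finset.sum_mul, w1, one_mul]
        rw [map_sum] at hxc
        simp only [map_smul, smul_eq_mul] at hxc
        linarith
      exact fun i => (Finset.sum_eq_zero_iff_of_nonneg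
        (fun i _ => mul_nonneg (w0 i) (sub_nonneg.2 (hle i)))).1 hs i (Finset.mem_univ i)
    have hw : ∀ i ∉ S, w i = 0 := fun i hi =>
      (mul_eq_zero.1 (hz i)).resolve_right (sub_pos.2 (h2 i hi)).ne'
    rw [← Finset.sum_subset (Finset.subset_univ S) (fun i _ hi => by rw [hw i hi, zero_smul])]
    refine (convex_convexHull ℝ _).sum_mem (fun i _ => w0 i) ?_
      fun i hi => subset_convexHull ℝ _ ⟨i, hi, rfl⟩
    rw [← w1]
    exact Finset.sum_subset (Finset.subset_univ S) (fun i _ hi => hw i hi)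

/-- The points `v i` are pairwise distinct and each is a vertex of the convex hull of all of them. -/
structure ConvexPosition (v : Fin n → E3) : Prop where
  injective : Function.Injective v
  mem_extremePoints : ∀ i, v i ∈ (convexHull ℝ (Set.range v)).extremePoints ℝ

lemma ConvexPosition.extremePoints_eq (hv : ConvexPosition v) :
    (convexHull ℝ (Set.range v)).extremePoints ℝ = Set.range v :=
  Set.Subset.antisymm extremePoints_convexHull_subset
    (by rintro _ ⟨i, rfl⟩; exact hv.mem_extremePoints i)

lemma ConvexPosition.extremePoints_image (hv : ConvexPosition v) (S : Finset (Fin n)) :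
    (convexHull ℝ (v '' S)).extremePoints ℝ = v '' S := by
  refine Set.Subset.antisymm extremePoints_convexHull_subset ?_
  rintro _ ⟨i, hi, rfl⟩
  exact inter_extremePoints_subset_extremePoints_of_subset (image_subset_hull v S)
    ⟨subset_convexHull ℝ _ ⟨i, hi, rfl⟩, hv.mem_extremePoints i⟩

lemma ConvexPosition.mem_of_mem_convexHull (hv : ConvexPosition v) {S : Finset (Fin n)} {i : Fin n}
    (h : v i ∈ convexHull ℝ (v '' S)) : i ∈ S := by
  have : v i ∈ (convexHull ℝ (v '' S)).extremePoints ℝ :=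
    inter_extremePoints_subset_extremePoints_of_subset (image_subset_hull v S)
      ⟨h, hv.mem_extremePoints i⟩
  rw [hv.extremePoints_image] at this
  obtain ⟨j, hj, e⟩ := this
  exact hv.injective e ▸ hj

lemma ConvexPosition.isFaceSet (hv : ConvexPosition v) {S : Finset (Fin n)} (hS : S.Nonempty)
    (h : IsExposed ℝ (convexHull ℝ (Set.range v)) (convexHull ℝ (v '' S))) : IsFaceSet v S := by
  obtain ⟨i₀, hi₀⟩ := hS
  have hmem : ∀ i ∈ S, v i ∈ convexHull ℝ (v '' S) := fun i hi => subset_convexHull ℝ _ ⟨i, hi, rfl⟩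
  have hP : ∀ i, v i ∈ convexHull ℝ (Set.range v) := fun i => subset_convexHull ℝ _ ⟨i, rfl⟩
  obtain ⟨l, hl⟩ := h ⟨_, hmem i₀ hi₀⟩
  have hmax : ∀ i ∈ S, ∀ y ∈ convexHull ℝ (Set.range v), l y ≤ l (v i) := fun i hi => by
    have := hmem i hi
    rw [hl] at this
    exact this.2
  refine ⟨l.toLinearMap, l (v i₀), fun i hi => ?_, fun i hi => ?_⟩
  · exact le_antisymm (hmax i₀ hi₀ _ (hP i)) (hmax i hi _ (hP i₀))
  · refine lt_of_le_of_ne (hmax i₀ hi₀ _ (hP i)) fun he => hi (hv.mem_of_mem_convexHull ?_)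
    rw [hl]
    refine ⟨hP i, fun y hy => ?_⟩
    have he' : l (v i) = l (v i₀) := he
    rw [he']
    exact hmax i₀ hi₀ y hy

lemma vectorSpan_convexHull (s : Set E3) : vectorSpan ℝ (convexHull ℝ s) = vectorSpan ℝ s := by
  rw [← direction_affineSpan, affineSpan_convexHull, direction_affineSpan]

/-- Of three distinct collinear points one lies strictly between the other two and cannot be
extreme. -/
lemma ConvexPosition.not_collinear (hv : ConvexPosition v) {i j k : Fin n} (hij : i ≠ j) (hik : i ≠ k)
    (hjk : j ≠ k) : ¬ Collinear ℝ {v i, v j, v k} := by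
  have key : ∀ i j k, i ≠ j → j ≠ k → ¬ Wbtw ℝ (v i) (v j) (v k) := by
    intro i j k hij hjk h
    have hs : Sbtw ℝ (v i) (v j) (v k) := ⟨h, hv.injective.ne hij.symm, hv.injective.ne hjk⟩
    have hP : ∀ i, v i ∈ convexHull ℝ (Set.range v) := fun i => subset_convexHull ℝ _ ⟨i, rfl⟩
    have := (_root_.mem_extremePoints.1 (hv.mem_extremePoints j)).2 _ (hP i) _ (hP k)
      (by rw [openSegment_eq_image_lineMap]; exact hs.mem_image_Ioo)
    exact hij (hv.injective this.1)
  intro h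
  rcases h.wbtw_or_wbtw_or_wbtw with h | h | h
  · exact key i j k hij hjk h
  · exact key j k i hjk hik.symm h
  · exact key k i j hik.symm hij h

lemma ConvexPosition.two_le_finrank (hv : ConvexPosition v) {S : Finset (Fin n)} (hS : 3 ≤ S.card) :
    2 ≤ Module.finrank ℝ (vectorSpan ℝ (v '' S)) := by
  obtain ⟨T, hTS, hT⟩ := Finset.exists_subset_card_eq hS
  obtain ⟨i, j, k, hij, hik, hjk, rfl⟩ := Finset.card_eq_three.1 hT
  by_contra h
  have hc : Collinear ℝ (v '' (S : Set (Fin n))) := collinear_iff_finrank_le_one.2 (by omega)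
  refine hv.not_collinear hij hik hjk (hc.subset ?_)
  rintro x (rfl | rfl | rfl)
  · exact ⟨i, hTS (by simp), rfl⟩
  · exact ⟨j, hTS (by simp), rfl⟩
  · exact ⟨k, hTS (by simp), rfl⟩

lemma finrank_vectorSpan_image_le (v : Fin n → E3) {S : Finset (Fin n)} {d : ℕ} (hS : S.card ≤ d + 1) :
    Module.finrank ℝ (vectorSpan ℝ (v '' S)) ≤ d := by
  rcases S.eq_empty_or_nonempty with rfl | hne
  · rw [Finset.coe_empty, Set.image_empty, vectorSpan_empty, finrank_bot]
    exact Nat.zero_le d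
  · obtain ⟨m, hm⟩ := Nat.exists_eq_succ_of_ne_zero hne.card_ne_zero
    have := finrank_vectorSpan_image_finset_le ℝ v S hm
    rw [Finset.coe_image] at this
    omega

lemma ConvexPosition.finrank_eq_one_iff (hv : ConvexPosition v) {S : Finset (Fin n)} :
    Module.finrank ℝ (vectorSpan ℝ (v '' S)) = 1 ↔ S.card = 2 := by
  constructor
  · intro h
    have h1 : ¬ 3 ≤ S.card := fun hS => by
      have := hv.two_le_finrank hS
      omega
    have h2 : ¬ S.card ≤ 1 := fun hS => by
      have := finrank_vectorSpan_image_le v (d := 0) hS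
      omega
    omega
  · intro h
    obtain ⟨i, j, hij, rfl⟩ := Finset.card_eq_two.1 h
    have : v '' ({i, j} : Finset (Fin n)) = {v i, v j} := by simp [Set.image_pair]
    rw [this, vectorSpan_pair, finrank_span_singleton]
    exact vsub_ne_zero.2 (hv.injective.ne hij)

lemma IsFaceSet.finrank_le_two {S : Finset (Fin n)} (h : IsFaceSet v S) (hS : S ≠ Finset.univ)
    (hne : S.Nonempty) : Module.finrank ℝ (vectorSpan ℝ (v '' S)) ≤ 2 := by
  obtain ⟨l, c, h1, h2⟩ := h
  obtain ⟨i₀, hi₀⟩ := hne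
  obtain ⟨i, hi⟩ : ∃ i, i ∉ S := by
    by_contra! hall
    exact hS (Finset.eq_univ_of_forall hall)
  have hl : l ≠ 0 := by
    rintro rfl
    have := h2 i hi
    have := h1 i₀ hi₀
    simp_all
  have hle : vectorSpan ℝ (v '' S) ≤ LinearMap.ker l := by
    rw [vectorSpan, Submodule.span_le]
    rintro _ ⟨_, ⟨a, ha, rfl⟩, _, ⟨b, hb, rfl⟩, rfl⟩
    show l (v a - v b) = 0
    rw [map_sub, h1 a ha, h1 b hb, sub_self]
  have hk : Module.finrank ℝ (LinearMap.ker l) = 2 := by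
    have e1 := l.finrank_range_add_finrank_ker
    have e2 : LinearMap.range l = ⊤ := LinearMap.range_eq_top.2 (LinearMap.surjective hl)
    rw [e2, finrank_top, Module.finrank_self, finrank_euclideanSpace_fin] at e1
    omega
  exact (Submodule.finrank_mono hle).trans hk.le

lemma ConvexPosition.isFaceOfDim_one_iff (hv : ConvexPosition v) {S : Finset (Fin n)} :
    IsFaceOfDim (convexHull ℝ (Set.range v)) 1 (convexHull ℝ (v '' S)) ↔
      S.card = 2 ∧ IsFaceSet v S := by
  rw [IsFaceOfDim, vectorSpan_convexHull, hv.finrank_eq_one_iff]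
  constructor
  · rintro ⟨-, h1, h2⟩
    exact ⟨h2, hv.isFaceSet (Finset.card_pos.1 (by omega)) h1⟩
  · rintro ⟨h1, h2⟩
    refine ⟨?_, h2.isExposed, h1⟩
    obtain ⟨i, hi⟩ := Finset.card_pos.1 (by omega : 0 < S.card)
    exact ⟨v i, subset_convexHull ℝ _ ⟨i, hi, rfl⟩⟩

/-- Three vertices span at least a plane, and a proper face lies in a level set of a nonzero
functional. So the dimension can be read off from the number of vertices, with the full vertex set
excluded because it spans space. -/
lemma ConvexPosition.isFaceOfDim_two_iff (hv : ConvexPosition v)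
    (hspan : affineSpan ℝ (Set.range v) = ⊤) {S : Finset (Fin n)} :
    IsFaceOfDim (convexHull ℝ (Set.range v)) 2 (convexHull ℝ (v '' S)) ↔
      3 ≤ S.card ∧ S ≠ Finset.univ ∧ IsFaceSet v S := by
  rw [IsFaceOfDim, vectorSpan_convexHull]
  constructor
  · rintro ⟨h0, h1, h2⟩
    have hS : S.Nonempty := by
      rw [convexHull_nonempty_iff, Set.image_nonempty] at h0
      exact h0
    refine ⟨?_, ?_, hv.isFaceSet hS h1⟩
    · by_contra hc
      have := finrank_vectorSpan_image_le v (S := S) (d := 1) (by omega)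
      omega
    · rintro rfl
      rw [Finset.coe_univ, Set.image_univ, ← direction_affineSpan, hspan,
        AffineSubspace.direction_top, finrank_top, finrank_euclideanSpace_fin] at h2
      omega
  · rintro ⟨h1, h2, h3⟩
    have hS : S.Nonempty := Finset.card_pos.1 (by omega)
    refine ⟨?_, h3.isExposed, le_antisymm (h3.finrank_le_two h2 hS) (hv.two_le_finrank h1)⟩
    obtain ⟨i, hi⟩ := hS
    exact ⟨v i, subset_convexHull ℝ _ ⟨i, hi, rfl⟩⟩

lemma IsFaceSet.mem_extremePoints {i : Fin n} (h : IsFaceSet v {i}) :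
    v i ∈ (convexHull ℝ (Set.range v)).extremePoints ℝ := by
  have := h.isExposed
  simp only [Finset.coe_singleton, Set.image_singleton, convexHull_singleton] at this
  exact isExtreme_singleton.1 this.isExtreme

/-- The combinatorial type of a polytope, read off from its face sets. -/
lemma hasType_of_isFaceSet (hv : ConvexPosition v)
    (hspan : affineSpan ℝ (Set.range v) = ⊤) {T : CombType n}
    (hedges : ∀ S, S ∈ T.edges ↔ S.card = 2 ∧ IsFaceSet v S)
    (hfaces : ∀ S, S ∈ T.faces ↔ 3 ≤ S.card ∧ S ≠ Finset.univ ∧ IsFaceSet v S) :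
    HasType (convexHull ℝ (Set.range v)) T :=
  ⟨v, hv.injective, hv.extremePoints_eq.symm,
    fun S => (hedges S).trans hv.isFaceOfDim_one_iff.symm,
    fun S => (hfaces S).trans (hv.isFaceOfDim_two_iff hspan).symm⟩

end Faces

/-! ### Polyhedra with given facets and vertices -/

/-- A triangulation of a polyhedron by successive cuts along planes. The facets of each tetrahedron
are chosen (by their position `src` in the list of all facets and cuts so far) and scaled (by `κ`) so
that the functionals take the value `C` at the opposite vertex. -/
inductive CutTree (n : ℕ)
  | leaf (t : Fin 4 → Fin n) (C : ℤ) (κ : Fin 4 → ℤ) (src : Fin 4 → ℕ)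
  | cut (g : Fin 4 → ℤ) (a b : CutTree n)

/-- The region where the functionals `F` are nonnegative is filled by the tetrahedra of the tree. -/
def CutTree.fills {n : ℕ} (vert : Fin n → Fin 3 → ℤ) : CutTree n → List (Fin 4 → ℤ) → Bool
  | leaf t C κ src, F => decide (0 < C ∧ (∀ j, 0 ≤ κ j) ∧
      (∀ a : Fin 4, ∑ j, κ j * F.getD (src j) 0 a = if a = 0 then C else 0) ∧
      ∀ (s : Fin 3) (a : Fin 4), ∑ j, κ j * F.getD (src j) 0 a * vert (t j) s =
        if a = s.succ then C else 0)
  | cut g a b, F => a.fills vert (F ++ [g]) && b.fills vert (F ++ [-g])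

/-- The value of an integral affine functional at a real point. -/
def realEval (c : Fin 4 → ℤ) (x : Fin 3 → ℝ) : ℝ := c 0 + c 1 * x 0 + c 2 * x 1 + c 3 * x 2

/-- At a leaf the scaled functionals divided by `C` are the barycentric coordinates of the
tetrahedron: the checked identities between coefficients say that they sum to 1 and reproduce the
point. At a cut, the point lies on one of the two sides. -/
lemma CutTree.mem_convexHull_of_fills {n : ℕ} {vert : Fin n → Fin 3 → ℤ} {x : Fin 3 → ℝ} :
    ∀ {T : CutTree n} {F : List (Fin 4 → ℤ)}, T.fills vert F = true →
      (∀ c ∈ F, 0 ≤ realEval c x) →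
      x ∈ convexHull ℝ (Set.range fun i t => (vert i t : ℝ)) := by
  intro T
  induction T with
  | leaf t C κ src =>
    intro F h hF
    obtain ⟨hC, hκ, h1, h2⟩ := of_decide_eq_true h
    have hC' : (0 : ℝ) < C := by exact_mod_cast hC
    -- A position outside the list yields the zero functional, which is harmless.
    have hnn : ∀ j, 0 ≤ realEval (F.getD (src j) 0) x := fun j => by
      rw [List.getD_eq_getElem?_getD]
      rcases hj : F[src j]? with _ | c
      · simp [realEval]
      · exact hF c (List.mem_of_getElem? hj)
    have hκ' : ∀ j, (0 : ℝ) ≤ κ j := fun j => by exact_mod_cast hκ j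
    have s1 : ∀ a : Fin 4, ∑ j, (κ j : ℝ) * (F.getD (src j) 0 a : ℝ) =
        if a = 0 then (C : ℝ) else 0 := fun a => by exact_mod_cast h1 a
    have s2 : ∀ (s : Fin 3) (a : Fin 4), ∑ j, (κ j : ℝ) * (F.getD (src j) 0 a : ℝ) *
        (vert (t j) s : ℝ) = if a = s.succ then (C : ℝ) else 0 := fun s a => by
      exact_mod_cast h2 s a
    have hsum := (convex_convexHull ℝ (Set.range fun i t => (vert i t : ℝ))).sum_mem
      (t := Finset.univ) (w := fun j => (κ j : ℝ) * realEval (F.getD (src j) 0) x / C)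
      (z := fun j t' => (vert (t j) t' : ℝ))
      (fun j _ => div_nonneg (mul_nonneg (hκ' j) (hnn j)) hC'.le) ?_
      (fun j _ => subset_convexHull ℝ _ ⟨t j, rfl⟩)
    · convert hsum using 1
      ext s
      rw [Finset.sum_apply]
      simp only [Pi.smul_apply, smul_eq_mul, realEval]
      have e : ∀ j, (κ j : ℝ) * ((F.getD (src j) 0 0 : ℝ) + (F.getD (src j) 0 1 : ℝ) * x 0 +
          (F.getD (src j) 0 2 : ℝ) * x 1 + (F.getD (src j) 0 3 : ℝ) * x 2) / C * (vert (t j) s : ℝ) =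
          ((κ j : ℝ) * (F.getD (src j) 0 0 : ℝ) * (vert (t j) s : ℝ) +
            (κ j : ℝ) * (F.getD (src j) 0 1 : ℝ) * (vert (t j) s : ℝ) * x 0 +
            (κ j : ℝ) * (F.getD (src j) 0 2 : ℝ) * (vert (t j) s : ℝ) * x 1 +
            (κ j : ℝ) * (F.getD (src j) 0 3 : ℝ) * (vert (t j) s : ℝ) * x 2) / C := fun j => by ring
      rw [Finset.sum_congr rfl fun j _ => e j, ← Finset.sum_div, Finset.sum_add_distrib,
        Finset.sum_add_distrib, Finset.sum_add_distrib, ← Finset.sum_mul, ← Finset.sum_mul,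
        ← Finset.sum_mul, s2, s2, s2, s2]
      fin_cases s <;> simp [Fin.ext_iff, hC'.ne']
    · simp only [realEval]
      have e : ∀ j, (κ j : ℝ) * ((F.getD (src j) 0 0 : ℝ) + (F.getD (src j) 0 1 : ℝ) * x 0 +
          (F.getD (src j) 0 2 : ℝ) * x 1 + (F.getD (src j) 0 3 : ℝ) * x 2) / C =
          ((κ j : ℝ) * (F.getD (src j) 0 0 : ℝ) +
            (κ j : ℝ) * (F.getD (src j) 0 1 : ℝ) * x 0 +
            (κ j : ℝ) * (F.getD (src j) 0 2 : ℝ) * x 1 +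
            (κ j : ℝ) * (F.getD (src j) 0 3 : ℝ) * x 2) / C := fun j => by ring
      rw [Finset.sum_congr rfl fun j _ => e j, ← Finset.sum_div, Finset.sum_add_distrib,
        Finset.sum_add_distrib, Finset.sum_add_distrib, ← Finset.sum_mul, ← Finset.sum_mul,
        ← Finset.sum_mul, s1, s1, s1, s1]
      simp [hC'.ne']
  | cut g a b iha ihb =>
    intro F h hF
    rw [CutTree.fills, Bool.and_eq_true] at h
    rcases le_total 0 (realEval g x) with hg | hg
    · refine iha h.1 fun c hc => ?_
      rcases List.mem_append.1 hc with hc | hc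
      · exact hF c hc
      · rw [List.mem_singleton.1 hc]; exact hg
    · refine ihb h.2 fun c hc => ?_
      rcases List.mem_append.1 hc with hc | hc
      · exact hF c hc
      · rw [List.mem_singleton.1 hc]
        have : realEval (-g) x = - realEval g x := by
          simp only [realEval, Pi.neg_apply]; push_cast; ring
        linarith

/-! ### Vertices and faces of the solid of a plan -/

namespace HexPlan

variable {nf nh np n : ℕ} {D : HexPlan nf nh np} {vert : Fin n → Fin 3 → ℤ}

lemma Valid.solid_eq (hD : D.Valid) (hvert : ∀ m i, 0 ≤ evalFacet (D.facet m) (vert i))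
    {T : CutTree n} (hT : T.fills vert (List.ofFn D.facet) = true) :
    D.solid = convexHull ℝ (Set.range fun i => D.ipos (vert i)) := by
  apply Set.Subset.antisymm
  · intro y hy
    obtain ⟨x, rfl⟩ : ∃ x, D.pos x = y := by
      refine ⟨fun t => y t / D.len t, ?_⟩
      ext t
      rw [pos_apply, mul_div_cancel₀ _ (hD.len_pos t).ne']
    have hx : x ∈ convexHull ℝ (Set.range fun i t => (vert i t : ℝ)) := by
      refine CutTree.mem_convexHull_of_fills hT fun c hc => ?_
      obtain ⟨m, rfl⟩ := (List.mem_ofFn' _ _).1 hc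
      have := hy m
      rw [height_apply, hD.slope_pos] at this
      rw [realEval]
      linarith
    have := Set.mem_image_of_mem D.pos hx
    rw [LinearMap.image_convexHull, ← Set.range_comp] at this
    exact this
  · refine convexHull_min ?_ ?_
    · rintro _ ⟨i, rfl⟩ m
      rw [hD.height_ipos]
      exact_mod_cast hvert m i
    · have : D.solid = ⋂ m, (D.height m) ⁻¹' Set.Ici 0 := by ext; simp [solid]
      rw [this]
      exact convex_iInter fun m => (convex_Ici (0 : ℝ)).affine_preimage _

/-- The set of vertices is the intersection of the facets that contain it. -/
def FaceClosed (D : HexPlan nf nh np) (vert : Fin n → Fin 3 → ℤ) (S : Finset (Fin n)) : Prop :=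
  ∀ i, (∀ m, (∀ j ∈ S, evalFacet (D.facet m) (vert j) = 0) → evalFacet (D.facet m) (vert i) = 0) →
    i ∈ S

instance (D : HexPlan nf nh np) (vert : Fin n → Fin 3 → ℤ) (S : Finset (Fin n)) :
    Decidable (D.FaceClosed vert S) := by unfold FaceClosed; infer_instance

/-- The sum of the functionals of the facets containing `S` is nonnegative on the vertices and
vanishes exactly at those in `S`; its negative is maximal there. -/
lemma Valid.isFaceSet_of_faceClosed (hD : D.Valid)
    (hvert : ∀ m i, 0 ≤ evalFacet (D.facet m) (vert i)) {S : Finset (Fin n)}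
    (h : D.FaceClosed vert S) : IsFaceSet (fun i => D.ipos (vert i)) S := by
  classical
  let M : Finset (Fin nf) := {m | ∀ j ∈ S, evalFacet (D.facet m) (vert j) = 0}
  have key : ∀ i, (- ∑ m ∈ M, D.slope m) (D.ipos (vert i)) = (∑ m ∈ M, (D.facet m 0 : ℝ)) -
      ∑ m ∈ M, (evalFacet (D.facet m) (vert i) : ℝ) := fun i => by
    rw [LinearMap.neg_apply, LinearMap.sum_apply, ← Finset.sum_sub_distrib, ← Finset.sum_neg_distrib]
    refine Finset.sum_congr rfl fun m _ => ?_
    have := hD.height_ipos m (vert i)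
    rw [height_apply] at this
    linarith
  refine ⟨- ∑ m ∈ M, D.slope m, ∑ m ∈ M, (D.facet m 0 : ℝ), fun i hi => ?_, fun i hi => ?_⟩
  · rw [key, sub_eq_self]
    refine Finset.sum_eq_zero fun m hm => ?_
    rw [(Finset.mem_filter.1 hm).2 i hi, Int.cast_zero]
  · rw [key, sub_lt_self_iff]
    have : ∃ m ∈ M, evalFacet (D.facet m) (vert i) ≠ 0 := by
      by_contra! hall
      exact hi (h i fun m hm => hall m (Finset.mem_filter.2 ⟨Finset.mem_univ m, hm⟩))
    obtain ⟨m, hm, hne⟩ := this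
    refine Finset.sum_pos' (fun m _ => by exact_mod_cast hvert m i) ⟨m, hm, ?_⟩
    exact_mod_cast lt_of_le_of_ne (hvert m i) (Ne.symm hne)

/-- Suppose a vertex outside `S` lies on all facets through `S`. From the barycentre of `S` one can
move a little directly away from that vertex without leaving the solid: facets through `S` stay at
height zero, and the others have positive height at the barycentre. But this motion increases the
functional that is maximal on `S`. -/
lemma Valid.faceClosed_of_isFaceSet (hD : D.Valid)
    (hvert : ∀ m i, 0 ≤ evalFacet (D.facet m) (vert i))
    (hsolid : D.solid = convexHull ℝ (Set.range fun i => D.ipos (vert i))) {S : Finset (Fin n)}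
    (hS : S.Nonempty) (h : IsFaceSet (fun i => D.ipos (vert i)) S) : D.FaceClosed vert S := by
  obtain ⟨l, c, h1, h2⟩ := h
  intro i hi
  by_contra hiS
  have hcard : (0 : ℝ) < S.card := by exact_mod_cast hS.card_pos
  set b : E3 := (S.card : ℝ)⁻¹ • ∑ j ∈ S, D.ipos (vert j) with hb
  have hlb : l b = c := by
    rw [hb, map_smul, map_sum, Finset.sum_congr rfl h1, Finset.sum_const, nsmul_eq_mul,
      smul_eq_mul, inv_mul_cancel_left₀ hcard.ne']
  have hhb : ∀ m, D.height m b =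
      (S.card : ℝ)⁻¹ * ∑ j ∈ S, (evalFacet (D.facet m) (vert j) : ℝ) := fun m => by
    have e : ∀ j ∈ S, (evalFacet (D.facet m) (vert j) : ℝ) =
        D.slope m (D.ipos (vert j)) + D.facet m 0 := fun j _ => by
      rw [← hD.height_ipos, height_apply]
    rw [Finset.sum_congr rfl e, Finset.sum_add_distrib, Finset.sum_const, nsmul_eq_mul, height_apply,
      hb, map_smul, map_sum, smul_eq_mul, mul_add, inv_mul_cancel_left₀ hcard.ne']
  have hcont : ∀ m, ∀ᶠ ε : ℝ in nhdsWithin 0 (Set.Ioi 0),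
      0 ≤ D.height m (AffineMap.lineMap b (D.ipos (vert i)) (-ε)) := by
    intro m
    have hlin : ∀ ε : ℝ, D.height m (AffineMap.lineMap b (D.ipos (vert i)) (-ε)) =
        (1 + ε) * D.height m b - ε * D.height m (D.ipos (vert i)) := fun ε => by
      rw [AffineMap.apply_lineMap, AffineMap.lineMap_apply_module]
      simp only [smul_eq_mul]
      ring
    by_cases hm : ∀ j ∈ S, evalFacet (D.facet m) (vert j) = 0
    · refine Filter.Eventually.of_forall fun ε => ?_
      have e1 : D.height m b = 0 := by
        rw [hhb, Finset.sum_eq_zero (fun j hj => by rw [hm j hj, Int.cast_zero]), mul_zero]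
      rw [hlin, e1, hD.height_ipos, hi m hm]
      simp
    · push Not at hm
      obtain ⟨j, hj, hne⟩ := hm
      have e1 : 0 < D.height m b := by
        rw [hhb]
        refine mul_pos (inv_pos.2 hcard) (Finset.sum_pos' (fun j _ => by exact_mod_cast hvert m j)
          ⟨j, hj, ?_⟩)
        exact_mod_cast lt_of_le_of_ne (hvert m j) (Ne.symm hne)
      have ht : Filter.Tendsto
          (fun ε : ℝ => (1 + ε) * D.height m b - ε * D.height m (D.ipos (vert i)))
          (nhdsWithin 0 (Set.Ioi 0)) (nhds (D.height m b)) := by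
        have : Continuous fun ε : ℝ => (1 + ε) * D.height m b - ε * D.height m (D.ipos (vert i)) := by
          fun_prop
        have h0 := (this.tendsto 0).mono_left (nhdsWithin_le_nhds (s := Set.Ioi (0 : ℝ)))
        simpa using h0
      filter_upwards [ht.eventually (lt_mem_nhds e1)] with ε hε
      rw [hlin]
      exact hε.le
  obtain ⟨ε, hε, hε0⟩ := ((Filter.eventually_all.2 hcont).and self_mem_nhdsWithin).exists
  have hε0' : 0 < ε := hε0
  have hmem : AffineMap.lineMap b (D.ipos (vert i)) (-ε) ∈ D.solid := hε
  rw [hsolid] at hmem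
  have hle : l (AffineMap.lineMap b (D.ipos (vert i)) (-ε)) ≤ c := by
    refine convexHull_min (s := Set.range fun i => D.ipos (vert i)) (t := {y | l y ≤ c}) ?_
      (convex_halfSpace_le l.isLinear c) hmem
    rintro _ ⟨j, rfl⟩
    by_cases hj : j ∈ S
    exacts [(h1 j hj).le, (h2 j hj).le]
  clear_value b
  -- The value is `(1 + ε) * c - ε * l (D.ipos (vert i))`, which exceeds `c`.
  rw [AffineMap.lineMap_apply_module, map_add, map_smul, map_smul, hlb] at hle
  simp only [smul_eq_mul] at hle
  have := mul_lt_mul_of_pos_left (h2 i hiS) hε0'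
  linarith

/-- The combinatorial and arithmetical conditions under which the solid of a plan is a polyhedron with
the given vertices and the given combinatorial type. -/
structure IsPolyhedron (D : HexPlan nf nh np) (vert : Fin n → Fin 3 → ℤ) (tree : CutTree n)
    (T : CombType n) : Prop where
  vert_nonneg : ∀ m i, 0 ≤ evalFacet (D.facet m) (vert i)
  exists_pos : ∀ m, ∃ i, 0 < evalFacet (D.facet m) (vert i)
  exists_ne : ∀ k : Fin nf, ∃ m : Fin nf, m ≠ k
  fills : tree.fills vert (List.ofFn D.facet) = true
  vert_injective : ∀ i j, (∀ t, vert i t = vert j t) → i = j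
  faceClosed_singleton : ∀ i, D.FaceClosed vert {i}
  edges : ∀ S, S ∈ T.edges ↔ S.card = 2 ∧ D.FaceClosed vert S
  faces : ∀ S, S ∈ T.faces ↔ 3 ≤ S.card ∧ S ≠ Finset.univ ∧ D.FaceClosed vert S

theorem Valid.isHexGlued_and_hasType (hD : D.Valid) {tree : CutTree n} {T : CombType n}
    (hP : D.IsPolyhedron vert tree T) :
    IsHexGlued (convexHull ℝ (Set.range fun i => D.ipos (vert i))) ∧
      HasType (convexHull ℝ (Set.range fun i => D.ipos (vert i))) T := by
  have hsolid := hD.solid_eq hP.vert_nonneg hP.fills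
  have hinterior : (interior (convexHull ℝ (Set.range fun i => D.ipos (vert i)))).Nonempty := by
    classical
    rw [← hsolid]
    have hsub : {x | ∀ m, 0 < D.height m x} ⊆ interior D.solid := by
      refine interior_maximal (fun x hx m => (hx m).le) ?_
      have : {x | ∀ m, 0 < D.height m x} = ⋂ m, {x | 0 < D.height m x} := by ext; simp
      rw [this]
      exact isOpen_iInter_of_finite fun m => isOpen_lt continuous_const (continuous_height m)
    rcases isEmpty_or_nonempty (Fin nf) with hnf | ⟨⟨m₀⟩⟩
    · exact ⟨0, hsub fun m => (hnf.false m).elim⟩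
    obtain ⟨i₀, -⟩ := hP.exists_pos m₀
    have hn : (0 : ℝ) < n := by exact_mod_cast i₀.pos
    have h1 : ∑ _i : Fin n, (n : ℝ)⁻¹ = 1 := by simp [hn.ne']
    -- The barycentre of the vertices is interior, since some vertex lies off each facet.
    refine ⟨∑ i, (n : ℝ)⁻¹ • D.ipos (vert i), hsub fun m => ?_⟩
    rw [AffineMap.map_sum_weights (D.height m) _ h1]
    simp only [hD.height_ipos, smul_eq_mul]
    obtain ⟨i, hi⟩ := hP.exists_pos m
    refine Finset.sum_pos' (fun i _ => ?_) ⟨i, Finset.mem_univ i, ?_⟩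
    · exact mul_nonneg (inv_nonneg.2 hn.le) (by exact_mod_cast hP.vert_nonneg m i)
    · exact mul_pos (inv_pos.2 hn) (by exact_mod_cast hi)
  have hbdd : Bornology.IsBounded D.solid := by
    rw [hsolid]
    exact ((Set.finite_range _).isCompact_convexHull (𝕜 := ℝ)).isBounded
  have hy := hD.yields hbdd hP.exists_ne
  rw [hsolid] at hy
  have hface : ∀ S : Finset (Fin n), S.Nonempty →
      (D.FaceClosed vert S ↔ IsFaceSet (fun i => D.ipos (vert i)) S) := fun S hS =>
    ⟨hD.isFaceSet_of_faceClosed hP.vert_nonneg,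
      hD.faceClosed_of_isFaceSet hP.vert_nonneg hsolid hS⟩
  have hcp : ConvexPosition fun i => D.ipos (vert i) :=
    ⟨fun i j h => hP.vert_injective i j fun t => congrFun (hD.ipos_injective h) t,
      fun i => IsFaceSet.mem_extremePoints (v := fun i => D.ipos (vert i))
        ((hface {i} (Finset.singleton_nonempty i)).1 (hP.faceClosed_singleton i))⟩
  refine ⟨⟨⟨⟨_, Set.finite_range _, rfl⟩, hinterior⟩, nh, D.gluing hD, hy⟩,
    hasType_of_isFaceSet hcp (affineSpan_eq_top_of_nonempty_interior hinterior) (fun S => ?_) fun S => ?_⟩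
  · rw [hP.edges]
    refine and_congr_right fun h => hface S (Finset.card_pos.1 (by omega))
  · rw [hP.faces]
    exact and_congr_right fun h => and_congr_right fun _ => hface S (Finset.card_pos.1 (by omega))

end HexPlan

/-! ### Six plans -/

/-- Two hexagons folded to a tetrahedron. -/
def tetrahedronPlan : HexPlan 4 2 10 where
  -- The consecutive edges of the path `0, 1, 2, 3` are pairwise orthogonal, of lengths √3, 1, √3.
  -- The surface area is 3√3, that of two hexagons.
  weight := ![3, 1, 3]
  den := 16
  facet := ![![0, 0, 0, 1], ![0, 0, 1, -1], ![0, 1, -1, 0], ![4, -1, 0, 0]]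
  base := ![![2, 2, 0], ![2, -1, -1], ![2, 2, 0], ![4, 2, -2]]
  dirX := ![![0, 4, 0], ![0, -2, -2], ![1, 1, 2], ![0, 4, 0]]
  dirY := ![![2, 2, 0], ![2, -1, -1], ![2, 2, 0], ![0, 2, 2]]
  partner x :=
    (![![(1, 1), (1, 0), (1, 5), (0, 4), (0, 3), (1, 4)], ![(0, 1), (0, 0), (1, 3), (1, 2), (0,
    5), (0, 2)]] : Fin 2 → Fin 6 → Fin 2 × Fin 6) x.1 x.2
  pl :=
    ![⟨0, 0, 0, (0, 0), 0⟩, ⟨3, 0, 0, (0, 0), 0⟩, ⟨1, 0, 0, (0, 0), 0⟩, ⟨2, 0, 0, (0, 0), 0⟩, ⟨1,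
    0, 2, (-1, -1), 3⟩, ⟨1, 1, 0, (-2, 1), 5⟩, ⟨3, 1, 4, (-1, 2), 5⟩, ⟨2, 1, 4, (2, -1), 5⟩, ⟨0,
    1, 4, (-1, 2), 6⟩, ⟨2, 1, 2, (1, 1), 6⟩]
  home := ![![3, 0, 0, 2, 0, 4], ![5, 6, 9, 5, 7, 5]]
  inner :=
    ![(0, ![0, 1, 0, 1, 0, 0]), (4, ![0, 0, 0, 0, 0, 1]), (7, ![0, 0, 0, 0, 1, 0]), (6, ![1, 0,
    1, 0, 0, 0])]

/-- The vertices of the solid of `tetrahedronPlan`. -/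
def tetrahedronVertex : Fin 4 → Fin 3 → ℤ :=
  ![![0, 0, 0], ![4, 0, 0], ![4, 4, 0], ![4, 4, 4]]

/-- A triangulation of the solid of `tetrahedronPlan`. -/
def tetrahedronCuts : CutTree 4 :=
  .leaf ![0, 1, 2, 3] 4 ![1, 1, 1, 1] ![3, 2, 1, 0]

/-- All conditions are finite statements about integers, settled by evaluation. -/
theorem tetrahedronPlan_valid : tetrahedronPlan.Valid := by constructor <;> decide +kernel

theorem tetrahedronPlan_isPolyhedron :
    tetrahedronPlan.IsPolyhedron tetrahedronVertex tetrahedronCuts tetrahedron := by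
  constructor <;> decide +kernel

/-- Three hexagons folded to a triangular bipyramid. -/
def bipyramidPlan : HexPlan 6 3 18 where
  -- The equator has sides 3, 2, 2, and each apex is at distances √7, 1, √3 from the vertices `2`,
  -- `3`, `4`.
  weight := ![7, 1, 20]
  den := 448
  facet :=
    ![![0, 0, 1, -1], ![168, -7, -3, -32], ![0, 7, -3, -4], ![0, 0, 1, 1], ![168, -7, -3, 32],
    ![0, 7, -3, 4]]
  base := ![![8, 0, 0], ![10, -10, 4], ![-2, -10, 4], ![8, 0, 0], ![10, -10, -4], ![-2, -10, -4]]
  dirX := ![![-8, 0, 0], ![-7, -5, 2], ![2, 10, -4], ![-8, 0, 0], ![-7, -5, -2], ![2, 10, 4]]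
  dirY := ![![-4, -4, -4], ![-1, -19, 2], ![-4, -4, -4], ![-4, 4, -4], ![-6, 14, 0], ![6, 14, 0]]
  partner x :=
    (![![(1, 3), (0, 2), (0, 1), (1, 2), (2, 3), (2, 2)], ![(2, 5), (2, 4), (0, 3), (0, 0), (2,
    1), (2, 0)], ![(1, 5), (1, 4), (0, 5), (0, 4), (1, 1), (1, 0)]] : Fin 3 → Fin 6 → Fin 3 × Fin
    6) x.1 x.2
  pl :=
    ![⟨0, 0, 0, (-1, -1), 0⟩, ⟨3, 0, 0, (-1, -1), 0⟩, ⟨1, 0, 0, (-1, -1), 0⟩, ⟨4, 0, 2, (-2, 1),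
    2⟩, ⟨3, 0, 2, (-2, 1), 3⟩, ⟨0, 0, 2, (-2, 1), 4⟩, ⟨0, 1, 0, (0, 0), 6⟩, ⟨3, 1, 0, (0, 0), 6⟩,
    ⟨1, 1, 0, (0, 0), 6⟩, ⟨2, 1, 0, (0, 0), 6⟩, ⟨4, 1, 0, (0, 0), 7⟩, ⟨5, 1, 0, (0, 0), 7⟩, ⟨1,
    2, 0, (1, -2), 12⟩, ⟨2, 2, 2, (2, -1), 12⟩, ⟨5, 2, 4, (1, 1), 13⟩, ⟨0, 2, 2, (2, -1), 13⟩,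
    ⟨3, 2, 4, (1, 1), 14⟩, ⟨4, 2, 0, (-1, 2), 14⟩]
  home := ![![2, 0, 0, 4, 3, 2], ![6, 7, 10, 6, 8, 6], ![13, 12, 12, 12, 17, 14]]
  inner :=
    ![(6, ![0, 0, 0, 1, 0, 1]), (8, ![0, 0, 0, 0, 1, 0]), (13, ![1, 0, 1, 0, 0, 0]), (7, ![0, 1,
    0, 1, 0, 0]), (3, ![0, 0, 0, 0, 1, 0]), (14, ![1, 0, 0, 0, 1, 0])]

/-- The vertices of the solid of `bipyramidPlan`. -/
def bipyramidVertex : Fin 5 → Fin 3 → ℤ :=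
  ![![4, 4, 4], ![4, 4, -4], ![24, 0, 0], ![0, 0, 0], ![12, 28, 0]]

/-- A triangulation of the solid of `bipyramidPlan`. -/
def bipyramidCuts : CutTree 5 :=
  .cut ![0, 0, 0, 1]
    (.leaf ![0, 2, 3, 4] 168 ![42, 1, 1, 6] ![6, 2, 1, 0])
    (.leaf ![1, 2, 3, 4] 168 ![42, 1, 1, 6] ![6, 5, 4, 3])

theorem bipyramidPlan_valid : bipyramidPlan.Valid := by constructor <;> decide +kernel

theorem bipyramidPlan_isPolyhedron :
    bipyramidPlan.IsPolyhedron bipyramidVertex bipyramidCuts triangularBipyramid := by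
  constructor <;> decide +kernel

/-- Ten hexagons folded to a right pyramid over a rectangle. -/
def pyramidPlan : HexPlan 5 10 30 where
  -- The base has sides √3 and 3, and the height is 3√2, so the surface area is 15√3.
  weight := ![1, 3, 24]
  den := 2700
  facet := ![![0, 0, 0, 1], ![45, 0, -1, -1], ![45, 1, 0, -1], ![45, 0, 1, -1], ![45, -1, 0, -1]]
  base := ![![0, -30, 0], ![0, 70, -25], ![-54, -30, -9], ![0, -50, -5], ![54, -30, -9]]
  dirX := ![![45, -15, 0], ![45, 5, -5], ![-9, -15, -9], ![45, 5, 5], ![-9, -15, 9]]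
  dirY := ![![0, -30, 0], ![0, 10, -10], ![0, -30, 0], ![0, 10, 10], ![0, -30, 0]]
  partner x :=
    (![![(2, 3), (8, 4), (4, 1), (1, 2), (1, 1), (3, 2)], ![(3, 3), (0, 4), (0, 3), (4, 0), (6,
    1), (3, 4)], ![(9, 3), (8, 0), (8, 5), (0, 0), (3, 1), (9, 4)], ![(9, 5), (2, 4), (0, 5), (1,
    0), (1, 5), (6, 0)], ![(1, 3), (0, 2), (8, 3), (7, 4), (5, 1), (6, 2)], ![(6, 3), (4, 4), (7,
    3), (5, 4), (5, 3), (7, 2)], ![(3, 5), (1, 4), (4, 5), (5, 0), (7, 1), (9, 0)], ![(9, 1), (6,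
    4), (5, 5), (5, 2), (4, 3), (8, 2)], ![(2, 1), (9, 2), (7, 5), (4, 2), (0, 1), (2, 2)], ![(6,
    5), (7, 0), (8, 1), (2, 0), (2, 5), (3, 0)]] : Fin 10 → Fin 6 → Fin 10 × Fin 6) x.1 x.2
  pl :=
    ![⟨0, 0, 0, (-1, -1), 0⟩, ⟨2, 0, 0, (-1, -1), 0⟩, ⟨0, 1, 0, (0, -3), 2⟩, ⟨1, 1, 0, (0, -3),
    2⟩, ⟨4, 1, 2, (2, -4), 3⟩, ⟨2, 1, 4, (-2, -2), 3⟩, ⟨0, 2, 0, (0, 0), 6⟩, ⟨3, 2, 0, (0, 0),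
    6⟩, ⟨2, 2, 0, (0, 0), 6⟩, ⟨4, 2, 0, (0, 0), 6⟩, ⟨0, 3, 0, (1, -2), 10⟩, ⟨4, 3, 0, (1, -2),
    10⟩, ⟨1, 4, 0, (-1, -4), 12⟩, ⟨2, 4, 4, (-3, 0), 12⟩, ⟨1, 5, 0, (0, -6), 14⟩, ⟨4, 5, 2, (5,
    -4), 14⟩, ⟨2, 5, 4, (-5, 1), 14⟩, ⟨3, 5, 4, (1, 4), 15⟩, ⟨3, 5, 2, (-1, 5), 16⟩, ⟨1, 6, 0,
    (1, -5), 19⟩, ⟨4, 6, 2, (3, -3), 19⟩, ⟨2, 7, 0, (-4, 2), 21⟩, ⟨3, 7, 4, (0, 3), 21⟩, ⟨4, 7,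
    2, (4, -2), 22⟩, ⟨2, 8, 0, (-2, 1), 24⟩, ⟨0, 8, 0, (-2, 1), 24⟩, ⟨3, 8, 4, (-1, 2), 24⟩, ⟨3,
    9, 0, (1, 1), 27⟩, ⟨4, 9, 4, (2, -1), 27⟩, ⟨0, 9, 4, (2, -1), 28⟩]
  home :=
    ![![0, 0, 1, 1, 0, 0], ![2, 2, 2, 5, 3, 4], ![6, 7, 6, 6, 6, 6], ![11, 10, 10, 10, 10, 11],
    ![12, 13, 13, 13, 13, 12], ![15, 14, 16, 18, 14, 17], ![20, 20, 19, 19, 20, 20], ![22, 23,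
    23, 22, 21, 21], ![24, 26, 26, 24, 24, 24], ![28, 28, 27, 27, 27, 28]]
  inner :=
    ![(0, ![0, 0, 0, 0, 0, 1]), (12, ![0, 0, 0, 0, 0, 1]), (21, ![0, 0, 0, 0, 0, 1]), (17, ![0,
    0, 0, 0, 0, 1]), (4, ![0, 0, 0, 0, 0, 1])]

/-- The vertices of the solid of `pyramidPlan`. -/
def pyramidVertex : Fin 5 → Fin 3 → ℤ :=
  ![![0, 0, 45], ![45, 45, 0], ![-45, 45, 0], ![-45, -45, 0], ![45, -45, 0]]

/-- A triangulation of the solid of `pyramidPlan`. -/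
def pyramidCuts : CutTree 5 :=
  .cut ![0, -1, 1, 0]
    (.leaf ![0, 1, 2, 3] 90 ![2, 1, 1, 1] ![0, 2, 5, 1])
    (.leaf ![0, 1, 3, 4] 90 ![2, 1, 1, 1] ![0, 3, 4, 5])

theorem pyramidPlan_valid : pyramidPlan.Valid := by constructor <;> decide +kernel

theorem pyramidPlan_isPolyhedron :
    pyramidPlan.IsPolyhedron pyramidVertex pyramidCuts squarePyramid := by
  constructor <;> decide +kernel

/-- Four hexagons folded to a regular octahedron. -/
def octahedronPlan : HexPlan 8 4 16 where
  -- The edge length is √3, so the surface area is 6√3, that of four hexagons.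
  weight := ![1, 1, 1]
  den := 6
  facet :=
    ![![3, -1, -1, -1], ![3, -1, -1, 1], ![3, -1, 1, -1], ![3, -1, 1, 1], ![3, 1, -1, -1], ![3,
    1, -1, 1], ![3, 1, 1, -1], ![3, 1, 1, 1]]
  base :=
    ![![1, 1, 1], ![2, 2, 1], ![2, 1, 2], ![4, 2, -1], ![1, 2, 2], ![2, 4, -1], ![-1, 2, 4],
    ![-2, 4, -5]]
  dirX :=
    ![![2, -1, -1], ![1, -2, -1], ![1, -1, -2], ![-1, -2, 1], ![2, 1, 1], ![1, -1, -2], ![1, 1,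
    2], ![2, -1, -1]]
  dirY :=
    ![![1, 1, -2], ![-1, -1, -2], ![2, 1, -1], ![-2, -1, -1], ![1, 2, -1], ![-1, -2, -1], ![-1,
    2, 1], ![1, -2, 1]]
  partner x :=
    (![![(2, 3), (1, 4), (1, 3), (3, 2), (3, 1), (2, 4)], ![(2, 1), (3, 4), (3, 3), (0, 2), (0,
    1), (2, 2)], ![(3, 5), (1, 0), (1, 5), (0, 0), (0, 5), (3, 0)], ![(2, 5), (0, 4), (0, 3), (1,
    2), (1, 1), (2, 0)]] : Fin 4 → Fin 6 → Fin 4 × Fin 6) x.1 x.2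
  pl :=
    ![⟨0, 0, 0, (0, 0), 0⟩, ⟨1, 0, 0, (0, 0), 0⟩, ⟨4, 0, 0, (0, 0), 0⟩, ⟨2, 0, 0, (0, 0), 0⟩, ⟨1,
    1, 0, (-1, 2), 4⟩, ⟨5, 1, 0, (-1, 2), 4⟩, ⟨4, 1, 2, (-2, 1), 5⟩, ⟨7, 1, 0, (-1, 2), 5⟩, ⟨1,
    2, 0, (1, 1), 8⟩, ⟨3, 2, 0, (1, 1), 8⟩, ⟨2, 2, 4, (2, -1), 9⟩, ⟨7, 2, 2, (0, 3), 9⟩, ⟨2, 3,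
    0, (1, -2), 12⟩, ⟨6, 3, 4, (-1, -1), 12⟩, ⟨7, 3, 0, (-2, 4), 13⟩, ⟨4, 3, 4, (-1, -1), 13⟩]
  home :=
    ![![0, 1, 0, 2, 0, 3], ![4, 7, 5, 6, 4, 4], ![9, 11, 8, 8, 8, 10], ![12, 12, 12, 15, 13, 14]]
  inner :=
    ![(0, ![0, 0, 0, 1, 0, 1]), (4, ![0, 0, 0, 0, 0, 1]), (3, ![0, 0, 0, 0, 0, 1]), (9, ![0, 0,
    0, 1, 0, 1]), (2, ![0, 0, 0, 1, 0, 0]), (5, ![0, 0, 0, 1, 0, 1]), (13, ![0, 0, 0, 1, 0, 1]),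
    (14, ![0, 0, 0, 0, 0, 1])]

/-- The vertices of the solid of `octahedronPlan`. -/
def octahedronVertex : Fin 6 → Fin 3 → ℤ :=
  ![![3, 0, 0], ![-3, 0, 0], ![0, 3, 0], ![0, -3, 0], ![0, 0, 3], ![0, 0, -3]]

/-- A triangulation of the solid of `octahedronPlan`. -/
def octahedronCuts : CutTree 6 :=
  .cut ![0, 0, 1, 0]
    (.cut ![0, 0, 0, 1]
      (.leaf ![0, 1, 2, 4] 6 ![1, 1, 2, 2] ![4, 0, 8, 9])
      (.leaf ![0, 1, 2, 5] 6 ![1, 1, 2, 2] ![5, 1, 8, 9]))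
    (.cut ![0, 0, 0, 1]
      (.leaf ![0, 1, 3, 4] 6 ![1, 1, 2, 2] ![6, 2, 8, 9])
      (.leaf ![0, 1, 3, 5] 6 ![1, 1, 2, 2] ![7, 3, 8, 9]))

theorem octahedronPlan_valid : octahedronPlan.Valid := by constructor <;> decide +kernel

theorem octahedronPlan_isPolyhedron :
    octahedronPlan.IsPolyhedron octahedronVertex octahedronCuts octahedron := by
  constructor <;> decide +kernel

/-- Eleven hexagons folded to a triangular bipyramid with a further stacked vertex. -/
def stackedPlan : HexPlan 8 11 38 where
  -- The faces are two equilateral triangles of side 2√3, two of side 3, and four right triangles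
  -- with legs √3 and 3.
  weight := ![1, 1, 507]
  den := 8112
  facet :=
    ![![3042, -12, -5, -507], ![3042, -12, -5, 507], ![0, -5, 12, 0], ![234, 0, -1, -39], ![234,
    0, -1, 39], ![0, 5, 12, 0], ![3042, 12, -5, -507], ![3042, 12, -5, 507]]
  base :=
    ![![150, 147, 1], ![222, 177, 1], ![216, 90, 4], ![156, 156, 2], ![156, 312, 2], ![216, -90,
    4], ![126, 201, 7], ![-378, 411, 7]]
  dirX :=
    ![![6, 87, -1], ![-66, 57, -1], ![72, 30, 2], ![0, 78, -2], ![0, -78, -2], ![72, -30, 2],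
    ![-6, 87, -1], ![66, 57, -1]]
  dirY :=
    ![![-66, 57, 1], ![6, 87, 1], ![0, 0, 4], ![-78, 39, -1], ![-78, -39, -1], ![0, 0, 4], ![-72,
    30, -2], ![72, -30, -2]]
  partner x :=
    (![![(8, 3), (6, 4), (6, 3), (5, 0), (2, 3), (1, 2)], ![(3, 1), (8, 4), (0, 5), (2, 2), (2,
    1), (3, 2)], ![(3, 3), (1, 4), (1, 3), (0, 4), (5, 5), (4, 2)], ![(8, 5), (1, 0), (1, 5), (2,
    0), (4, 1), (9, 4)], ![(9, 5), (3, 4), (2, 5), (5, 4), (5, 3), (10, 4)], ![(0, 3), (6, 2),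
    (10, 5), (4, 4), (4, 3), (2, 4)], ![(7, 3), (10, 0), (5, 1), (0, 2), (0, 1), (8, 2)], ![(9,
    1), (10, 2), (10, 1), (6, 0), (8, 1), (9, 2)], ![(9, 3), (7, 4), (6, 5), (0, 0), (1, 1), (3,
    0)], ![(10, 3), (7, 0), (7, 5), (8, 0), (3, 5), (4, 0)], ![(6, 1), (7, 2), (7, 1), (9, 0),
    (4, 5), (5, 2)]] : Fin 11 → Fin 6 → Fin 11 × Fin 6) x.1 x.2
  pl :=
    ![⟨0, 0, 0, (-2, 1), 0⟩, ⟨3, 0, 0, (-2, 1), 0⟩, ⟨2, 0, 0, (-2, 1), 0⟩, ⟨5, 0, 0, (-2, 1), 2⟩,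
    ⟨0, 1, 0, (0, 0), 4⟩, ⟨3, 1, 0, (0, 0), 4⟩, ⟨2, 1, 0, (0, 0), 4⟩, ⟨1, 1, 0, (0, 0), 4⟩, ⟨1,
    2, 0, (1, -2), 8⟩, ⟨2, 2, 4, (-1, -1), 8⟩, ⟨0, 2, 4, (-1, -1), 9⟩, ⟨1, 3, 0, (2, -1), 11⟩,
    ⟨4, 3, 2, (1, 1), 11⟩, ⟨3, 3, 2, (1, 1), 12⟩, ⟨1, 4, 0, (3, -3), 14⟩, ⟨2, 4, 4, (-2, -2),
    14⟩, ⟨4, 4, 2, (2, 2), 14⟩, ⟨7, 4, 4, (-2, 7), 16⟩, ⟨5, 4, 2, (-4, -1), 17⟩, ⟨2, 5, 0, (-3,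
    0), 19⟩, ⟨5, 5, 0, (-3, 0), 19⟩, ⟨1, 5, 2, (2, -4), 19⟩, ⟨7, 5, 2, (-4, 8), 20⟩, ⟨3, 6, 0,
    (-3, 3), 23⟩, ⟨6, 6, 0, (-3, 3), 23⟩, ⟨5, 6, 2, (-4, 2), 24⟩, ⟨2, 6, 2, (-4, 2), 25⟩, ⟨3, 7,
    0, (-2, 4), 27⟩, ⟨6, 7, 0, (-2, 4), 27⟩, ⟨5, 7, 2, (-6, 3), 28⟩, ⟨7, 7, 0, (-2, 4), 28⟩, ⟨3,
    8, 0, (-1, 2), 31⟩, ⟨3, 9, 0, (0, 3), 32⟩, ⟨4, 9, 0, (0, 3), 32⟩, ⟨7, 9, 2, (-1, 5), 33⟩, ⟨5,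
    10, 0, (-5, 1), 35⟩, ⟨6, 10, 4, (-4, 5), 35⟩, ⟨7, 10, 2, (-3, 6), 35⟩]
  home :=
    ![![0, 1, 0, 2, 2, 0], ![4, 5, 4, 4, 4, 7], ![8, 8, 8, 9, 9, 8], ![12, 13, 11, 11, 11, 12],
    ![16, 16, 14, 14, 14, 17], ![19, 19, 20, 20, 19, 19], ![23, 24, 25, 25, 23, 23], ![27, 30,
    28, 28, 27, 27], ![31, 31, 31, 31, 31, 31], ![33, 34, 32, 32, 32, 33], ![35, 35, 35, 37, 37,
    35]]
  inner :=
    ![(4, ![0, 0, 0, 1, 0, 1]), (7, ![0, 0, 0, 0, 0, 1]), (2, ![0, 0, 0, 0, 1, 0]), (23, ![0, 0,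
    0, 0, 0, 1]), (12, ![0, 0, 0, 0, 0, 1]), (20, ![0, 0, 1, 0, 0, 0]), (28, ![0, 0, 0, 1, 0,
    1]), (37, ![0, 0, 0, 1, 0, 0])]

/-- The vertices of the solid of `stackedPlan`. -/
def stackedVertex : Fin 6 → Fin 3 → ℤ :=
  ![![156, 234, 0], ![-216, 90, 0], ![0, 0, 6], ![0, 0, -6], ![-156, 234, 0], ![216, 90, 0]]

/-- A triangulation of the solid of `stackedPlan`. -/
def stackedCuts : CutTree 6 :=
  .cut ![0, 3, -2, 0]
    (.leaf ![5, 0, 2, 3] 6084 ![13, 3, 1, 1] ![8, 2, 1, 0])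
    (.cut ![0, 3, 2, 0]
      (.leaf ![0, 2, 3, 4] 936 ![1, 2, 2, 1] ![9, 4, 3, 8])
      (.leaf ![1, 2, 3, 4] 6084 ![13, 1, 1, 3] ![9, 7, 6, 5]))

theorem stackedPlan_valid : stackedPlan.Valid := by constructor <;> decide +kernel

theorem stackedPlan_isPolyhedron :
    stackedPlan.IsPolyhedron stackedVertex stackedCuts stackedBipyramid := by
  constructor <;> decide +kernel

/-- Three hexagons folded to a triangular prism. -/
def prismPlan : HexPlan 5 3 15 where
  -- This is the right prism of height 1 over an equilateral triangle of side √3.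
  weight := ![3, 9, 4]
  den := 144
  facet := ![![0, 0, 0, 1], ![6, 0, 0, -1], ![0, 0, 1, 0], ![0, 1, -1, 0], ![12, -1, -1, 0]]
  base := ![![0, 4, 0], ![18, 10, 6], ![0, 0, -6], ![3, 3, 3], ![6, 6, -6]]
  dirX := ![![0, 4, 0], ![-6, 2, 0], ![0, 0, -6], ![3, 3, 3], ![-3, 3, 3]]
  dirY := ![![6, 2, 0], ![-6, -2, 0], ![6, 0, -3], ![3, 3, -3], ![0, 0, 6]]
  partner x :=
    (![![(1, 3), (1, 2), (1, 1), (2, 4), (2, 3), (2, 2)], ![(2, 5), (0, 2), (0, 1), (0, 0), (2,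
    1), (2, 0)], ![(1, 5), (1, 4), (0, 5), (0, 4), (0, 3), (1, 0)]] : Fin 3 → Fin 6 → Fin 3 × Fin
    6) x.1 x.2
  pl :=
    ![⟨0, 0, 0, (-2, 1), 0⟩, ⟨2, 0, 0, (-2, 1), 0⟩, ⟨4, 0, 4, (-3, 3), 1⟩, ⟨1, 0, 2, (-2, 4), 1⟩,
    ⟨3, 0, 2, (-1, -1), 1⟩, ⟨0, 1, 0, (-1, 2), 5⟩, ⟨4, 1, 0, (-1, 2), 5⟩, ⟨3, 1, 4, (1, 1), 6⟩,
    ⟨1, 1, 0, (-1, 2), 6⟩, ⟨2, 1, 2, (-3, 3), 6⟩, ⟨0, 2, 0, (0, 0), 10⟩, ⟨3, 2, 0, (0, 0), 10⟩,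
    ⟨1, 2, 4, (0, 3), 11⟩, ⟨4, 2, 2, (1, 1), 11⟩, ⟨2, 2, 4, (-1, -1), 11⟩]
  home := ![![0, 0, 1, 3, 1, 0], ![6, 8, 6, 5, 5, 5], ![11, 10, 10, 10, 11, 12]]
  inner :=
    ![(5, ![0, 0, 0, 0, 1, 0]), (12, ![0, 0, 0, 0, 0, 1]), (1, ![0, 0, 0, 1, 0, 1]), (11, ![0, 0,
    0, 1, 0, 1]), (6, ![0, 0, 1, 0, 0, 1])]

/-- The vertices of the solid of `prismPlan`. -/
def prismVertex : Fin 6 → Fin 3 → ℤ :=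
  ![![0, 0, 0], ![12, 0, 0], ![6, 6, 0], ![0, 0, 6], ![12, 0, 6], ![6, 6, 6]]

/-- A triangulation of the solid of `prismPlan`. -/
def prismCuts : CutTree 6 :=
  .cut ![0, 0, 1, -1]
    (.leaf ![0, 1, 2, 5] 12 ![1, 1, 2, 2] ![4, 3, 5, 0])
    (.cut ![0, 1, 1, -2]
      (.leaf ![0, 1, 4, 5] 12 ![1, 1, 2, 2] ![4, 6, 5, 2])
      (.leaf ![0, 3, 4, 5] 12 ![2, 1, 1, 2] ![1, 6, 3, 2]))

theorem prismPlan_valid : prismPlan.Valid := by constructor <;> decide +kernel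

theorem prismPlan_isPolyhedron :
    prismPlan.IsPolyhedron prismVertex prismCuts triangularPrism := by
  constructor <;> decide +kernel

/-! ### Special shapes -/

lemma HexPlan.ipos_eq {nf nh np : ℕ} (D : HexPlan nf nh np) (x : Fin 3 → ℤ) :
    D.ipos x = !₂[D.len 0 * x 0, D.len 1 * x 1, D.len 2 * x 2] := rfl

lemma isRightRectangularPyramid_pyramidPlan :
    IsRightRectangularPyramid
      (convexHull ℝ (Set.range fun i => pyramidPlan.ipos (pyramidVertex i))) := by
  have h := pyramidPlan_valid.len_pos
  refine ⟨IsometryEquiv.refl _, pyramidPlan.len 0 * 45, pyramidPlan.len 1 * 45,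
    pyramidPlan.len 2 * 45, mul_pos (h 0) (by norm_num), mul_pos (h 1) (by norm_num),
    mul_pos (h 2) (by norm_num), ?_⟩
  rw [show ⇑(IsometryEquiv.refl E3) = id from rfl, Set.image_id]
  congr 1
  ext x
  simp only [Set.mem_range, Fin.exists_fin_succ, HexPlan.ipos_eq, pyramidVertex]
  simp
  grind

lemma isRegularOctahedron_octahedronPlan :
    IsRegularOctahedron
      (convexHull ℝ (Set.range fun i => octahedronPlan.ipos (octahedronVertex i))) := by
  have h1 : octahedronPlan.len 1 = octahedronPlan.len 0 := by
    simp [HexPlan.len, octahedronPlan]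
  have h2 : octahedronPlan.len 2 = octahedronPlan.len 0 := by
    simp [HexPlan.len, octahedronPlan]
  refine ⟨IsometryEquiv.refl _, octahedronPlan.len 0 * 3,
    mul_pos (octahedronPlan_valid.len_pos 0) (by norm_num), ?_⟩
  rw [show ⇑(IsometryEquiv.refl E3) = id from rfl, Set.image_id]
  congr 1
  ext x
  simp only [Set.mem_range, Fin.exists_fin_succ, HexPlan.ipos_eq, octahedronVertex, h1, h2]
  simp
  grind

lemma isTriangularPrism_prismPlan :
    IsTriangularPrism (convexHull ℝ (Set.range fun i => prismPlan.ipos (prismVertex i))) := by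
  have h := prismPlan_valid.len_pos
  refine ⟨prismPlan.ipos (prismVertex 0), prismPlan.ipos (prismVertex 1),
    prismPlan.ipos (prismVertex 2), prismPlan.ipos (prismVertex 3), ?_, ?_⟩
  · have h0 : prismPlan.ipos (prismVertex 0) = 0 := by
      ext t; fin_cases t <;> simp [HexPlan.ipos_eq, prismVertex]
    rw [affineIndependent_iff_linearIndependent_vsub ℝ _ (0 : Fin 4),
      ← linearIndependent_equiv (finSuccAboveEquiv (0 : Fin 4))]
    rw [Fintype.linearIndependent_iff]
    intro g hg
    rw [Fin.sum_univ_three] at hg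
    have c0 := congrArg (fun x : E3 => x 0) hg
    have c1 := congrArg (fun x : E3 => x 1) hg
    have c2 := congrArg (fun x : E3 => x 2) hg
    simp [h0, finSuccAboveEquiv_apply] at c0 c1 c2
    simp [HexPlan.ipos_eq, prismVertex, (h 1).ne', (h 2).ne'] at c0 c1 c2
    simp [c1] at c0
    have := (h 0).ne'
    intro i
    fin_cases i
    · simpa [this] using c0
    · exact c1
    · exact c2
  · have hadd : ∀ i : Fin 3, prismPlan.ipos (prismVertex (i.castLE (by omega))) +
        prismPlan.ipos (prismVertex 3) = prismPlan.ipos (prismVertex (Fin.natAdd 3 i)) := fun i => by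
      ext t
      fin_cases i <;> fin_cases t <;> simp [HexPlan.ipos_eq, prismVertex]
    have a0 := hadd 0
    have a1 := hadd 1
    have a2 := hadd 2
    simp only [Fin.isValue, Fin.castLE_zero, Fin.reduceCastLE, Fin.reduceNatAdd] at a0 a1 a2
    rw [a0, a1, a2]
    congr 1
    ext x
    simp only [Set.mem_range, Fin.exists_fin_succ]
    simp
    grind

/-! ### Simplicial polyhedra with at most six vertices -/

section Gale

variable {n : ℕ} {v : Fin n → E3}

/-- Gale duality: the face sets of a full-dimensional polytope in 3-space with `d + 4` vertices are
determined by `d` affine dependencies between the vertices. -/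
lemma exists_gale_dual {d : ℕ} (hn : n = d + 4) (hspan : affineSpan ℝ (Set.range v) = ⊤) :
    ∃ b : Fin d → Fin n → ℝ, ∀ S : Finset (Fin n), IsFaceSet v S ↔
      ∃ w : Fin n → ℝ, (∀ i ∈ S, w i = 0) ∧ (∀ i ∉ S, 0 < w i) ∧ ∀ j, ∑ i, w i * b j i = 0 := by
  -- `A` sends a functional and a level to the gaps at the vertices; face sets are the zero sets of
  -- nonnegative vectors in its range. As the vertices span space, `A` is injective, so the range
  -- has dimension 4, and membership is tested against a basis of its orthogonal complement.
  let A : (Module.Dual ℝ E3 × ℝ) →ₗ[ℝ] EuclideanSpace ℝ (Fin n) :=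
    { toFun := fun p => WithLp.toLp 2 fun i => p.2 - p.1 (v i)
      map_add' := fun p q => by ext i; simp; ring
      map_smul' := fun r p => by ext i; simp; ring }
  have hA : ∀ p i, A p i = p.2 - p.1 (v i) := fun _ _ => rfl
  have hinj : Function.Injective A := by
    rw [← LinearMap.ker_eq_bot, LinearMap.ker_eq_bot']
    rintro ⟨l, κ⟩ h
    have h1 : ∀ i, l (v i) = κ := fun i => by
      have := congrArg (fun x : EuclideanSpace ℝ (Fin n) => x i) h
      simp only [hA] at this
      exact (sub_eq_zero.1 this).symm
    have h2 : l.toAffineMap = AffineMap.const ℝ E3 κ := by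
      refine AffineMap.ext_on hspan ?_
      rintro _ ⟨i, rfl⟩
      exact h1 i
    have h3 : ∀ x, l x = κ := fun x => congrArg (fun f : E3 →ᵃ[ℝ] ℝ => f x) h2
    have h0 : κ = 0 := by rw [← h3 0, map_zero]
    ext1
    · ext1 x
      rw [h3, h0]; rfl
    · exact h0
  have hrank : Module.finrank ℝ (LinearMap.range A) = 4 := by
    rw [LinearMap.finrank_range_of_inj hinj, Module.finrank_prod, Subspace.dual_finrank_eq]
    simp
  have hd : Module.finrank ℝ (LinearMap.range A)ᗮ = d := by
    have := Submodule.finrank_add_finrank_orthogonal (LinearMap.range A)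
    rw [hrank, finrank_euclideanSpace, Fintype.card_fin] at this
    omega
  let b := Module.finBasisOfFinrankEq ℝ _ hd
  have hmem : ∀ w : EuclideanSpace ℝ (Fin n), w ∈ LinearMap.range A ↔
      ∀ j, ∑ i, w i * (b j : EuclideanSpace ℝ (Fin n)) i = 0 := by
    intro w
    have hi : ∀ y : EuclideanSpace ℝ (Fin n), Inner.inner ℝ y w = ∑ i, w i * y i := fun y => by
      rw [PiLp.inner_apply]
      rfl
    refine Iff.trans (b := ∀ y ∈ (LinearMap.range A)ᗮ, Inner.inner ℝ y w = 0) ?_ ?_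
    · rw [← Submodule.mem_orthogonal, Submodule.orthogonal_orthogonal]
    constructor
    · intro h j
      rw [← hi]
      exact h _ (b j).2
    · intro h y hy
      have hy' := congrArg Subtype.val (b.sum_repr ⟨y, hy⟩)
      simp only [Submodule.coe_sum, Submodule.coe_smul] at hy'
      rw [← hy', sum_inner]
      refine Finset.sum_eq_zero fun j _ => ?_
      rw [real_inner_smul_left, hi, h j, mul_zero]
  refine ⟨fun j i => (b j : EuclideanSpace ℝ (Fin n)) i, fun S => ?_⟩
  constructor
  · rintro ⟨l, c, h1, h2⟩
    refine ⟨fun i => c - l (v i), fun i hi => sub_eq_zero.2 (h1 i hi).symm,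
      fun i hi => sub_pos.2 (h2 i hi), (hmem (A (l, c))).1 ⟨_, rfl⟩⟩
  · rintro ⟨w, h1, h2, h3⟩
    obtain ⟨⟨l, c⟩, hlc⟩ := (hmem (WithLp.toLp 2 w)).2 h3
    have e : ∀ i, c - l (v i) = w i := fun i =>
      congrArg (fun x : EuclideanSpace ℝ (Fin n) => x i) hlc
    refine ⟨l, c, fun i hi => ?_, fun i hi => ?_⟩
    · have := e i
      rw [h1 i hi] at this
      linarith
    · have := e i
      have := h2 i hi
      linarith

lemma isFaceSet_comp {S : Finset (Fin n)} (σ : Equiv.Perm (Fin n)) :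
    IsFaceSet (v ∘ σ) S ↔ IsFaceSet v (S.image σ) := by
  refine exists_congr fun l => exists_congr fun c => and_congr ?_ ?_
  · simp
  · constructor
    · intro h i hi
      have := h (σ.symm i) fun hs => hi (Finset.mem_image.2 ⟨_, hs, by simp⟩)
      simpa using this
    · intro h i hi
      exact h (σ i) fun hs => by
        obtain ⟨j, hj, e⟩ := Finset.mem_image.1 hs
        exact hi (σ.injective e ▸ hj)

lemma image_perm_eq_univ_iff (σ : Equiv.Perm (Fin n)) {S : Finset (Fin n)} :
    S.image σ = Finset.univ ↔ S = Finset.univ := by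
  conv_lhs => rw [← Finset.image_univ_equiv σ]
  exact (Finset.image_injective σ.injective).eq_iff

lemma ConvexPosition.comp (hv : ConvexPosition v) (σ : Equiv.Perm (Fin n)) :
    ConvexPosition (v ∘ σ) :=
  ⟨hv.injective.comp σ.injective, fun i => by
    rw [σ.surjective.range_comp]
    exact hv.mem_extremePoints (σ i)⟩

/-- The points `v` are the vertices of a full-dimensional polytope all of whose proper faces are
simplices. -/
structure IsSimplicialPosition (v : Fin n → E3) : Prop where
  convexPosition : ConvexPosition v
  span : affineSpan ℝ (Set.range v) = ⊤
  card_le : ∀ S : Finset (Fin n), IsFaceSet v S → S ≠ Finset.univ → S.card ≤ 3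
  singleton : ∀ i, IsFaceSet v {i}

lemma IsSimplicialPosition.comp (hv : IsSimplicialPosition v) (σ : Equiv.Perm (Fin n)) :
    IsSimplicialPosition (v ∘ σ) where
  convexPosition := hv.convexPosition.comp σ
  span := by rw [σ.surjective.range_comp]; exact hv.span
  card_le S hS hne := by
    rw [← Finset.card_image_of_injective S σ.injective]
    exact hv.card_le _ ((isFaceSet_comp σ).1 hS) fun h => hne ((image_perm_eq_univ_iff σ).1 h)
  singleton i := by
    rw [isFaceSet_comp, Finset.image_singleton]
    exact hv.singleton _

lemma IsSimplicialPosition.hasType (hv : IsSimplicialPosition v) {T : CombType n}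
    (hedges : ∀ S, S ∈ T.edges ↔ S.card = 2 ∧ IsFaceSet v S)
    (hfaces : ∀ S, S ∈ T.faces ↔ S.card = 3 ∧ S ≠ Finset.univ ∧ IsFaceSet v S) :
    HasType (convexHull ℝ (Set.range v)) T := by
  refine hasType_of_isFaceSet hv.convexPosition hv.span hedges fun S => (hfaces S).trans ?_
  refine ⟨fun h => ⟨h.1.ge, h.2⟩, fun h => ⟨le_antisymm (hv.card_le S h.2.2 h.2.1) h.1, h.2⟩⟩

/-- A vertex is separated strictly from the compact hull of the others. -/
lemma ConvexPosition.isFaceSet_singleton (hv : ConvexPosition v) (i : Fin n) : IsFaceSet v {i} := by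
  have hnot : v i ∉ convexHull ℝ (v '' ((Finset.univ.erase i : Finset (Fin n)) : Set (Fin n))) :=
    fun h => by simpa using hv.mem_of_mem_convexHull h
  obtain ⟨f, u, h1, h2⟩ := geometric_hahn_banach_point_closed (convex_convexHull ℝ _)
    (((Finset.finite_toSet _).image v).isCompact_convexHull (𝕜 := ℝ)).isClosed hnot
  refine ⟨-f.toLinearMap, - f (v i), fun j hj => ?_, fun j hj => ?_⟩
  · rw [Finset.mem_singleton.1 hj]
    rfl
  · have := h2 (v j) (subset_convexHull ℝ _ ⟨j, by simpa using hj, rfl⟩)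
    show - f (v j) < - f (v i)
    linarith

lemma exists_isSimplicialPosition {P : Set E3} (hP : IsConvexPolyhedron P) (hs : IsSimplicial P) :
    ∃ v : Fin ((P.extremePoints ℝ).ncard) → E3,
      IsSimplicialPosition v ∧ P = convexHull ℝ (Set.range v) := by
  obtain ⟨⟨s, hsf, hPs⟩, hinterior⟩ := hP
  have hcpt : IsCompact P := by rw [hPs]; exact hsf.isCompact_convexHull (𝕜 := ℝ)
  have hcvx : Convex ℝ P := by rw [hPs]; exact convex_convexHull ℝ s
  have hfin : (P.extremePoints ℝ).Finite :=
    hsf.subset (by rw [hPs]; exact extremePoints_convexHull_subset)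
  have hhull : P = convexHull ℝ (P.extremePoints ℝ) := by
    conv_lhs => rw [← closure_convexHull_extremePoints hcpt hcvx]
    exact (hfin.isCompact_convexHull (𝕜 := ℝ)).isClosed.closure_eq
  have := hfin.to_subtype
  let e := Finite.equivFinOfCardEq (Nat.card_coe_set_eq (P.extremePoints ℝ))
  let v : Fin ((P.extremePoints ℝ).ncard) → E3 := fun i => e.symm i
  have hrange : Set.range v = P.extremePoints ℝ := by
    have : v = Subtype.val ∘ e.symm := rfl
    rw [this, e.symm.surjective.range_comp, Subtype.range_coe]
  have hPv : P = convexHull ℝ (Set.range v) := by rw [hrange, ← hhull]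
  have hcp : ConvexPosition v :=
    ⟨Subtype.val_injective.comp e.symm.injective, fun i => by rw [← hPv]; exact (e.symm i).2⟩
  have hspan : affineSpan ℝ (Set.range v) = ⊤ := by
    have := affineSpan_eq_top_of_nonempty_interior (s := Set.range v) (by rwa [← hPv])
    exact this
  refine ⟨v, ⟨hcp, hspan, fun S hS hne => ?_, hcp.isFaceSet_singleton⟩, hPv⟩
  -- A proper face set with more than three vertices would span a 2-face that is not a triangle.
  by_contra! h
  have h1 := (hcp.isFaceOfDim_two_iff hspan).2 ⟨h.le, hne, hS⟩
  rw [← hPv] at h1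
  have h2 := hs _ h1
  rw [hcp.extremePoints_image, Set.ncard_image_of_injective _ hcp.injective,
    Set.ncard_coe_finset] at h2
  omega

lemma four_le_of_affineSpan (hspan : affineSpan ℝ (Set.range v) = ⊤) : 4 ≤ n := by
  by_contra! h
  have h1 := finrank_vectorSpan_image_le v (S := Finset.univ) (d := 2) (by simp; omega)
  rw [Finset.coe_univ, Set.image_univ, ← direction_affineSpan, hspan, AffineSubspace.direction_top,
    finrank_top] at h1
  simp at h1

end Gale

/-! ### Simplicial polyhedra with four or five vertices -/

section Classification

/-- There are no dependencies to respect, so every set of vertices is a face set. -/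
lemma IsSimplicialPosition.hasType_tetrahedron {v : Fin 4 → E3} (hv : IsSimplicialPosition v) :
    HasType (convexHull ℝ (Set.range v)) tetrahedron := by
  obtain ⟨b, hb⟩ := exists_gale_dual (d := 0) rfl hv.span
  have hall : ∀ S, IsFaceSet v S := fun S => (hb S).2
    ⟨fun i => if i ∈ S then 0 else 1, fun i hi => by simp [hi], fun i hi => by simp [hi], nofun⟩
  refine hv.hasType (fun S => ?_) fun S => ?_
  · rw [and_iff_left (hall S)]
    revert S
    decide
  · rw [and_iff_left (hall S)]
    revert S
    decide

/-- The set contains elements of both signs. -/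
def BothSigns {n : ℕ} (ε : Fin n → Bool) (T : Finset (Fin n)) : Prop :=
  (∃ i ∈ T, ε i = true) ∧ ∃ i ∈ T, ε i = false

instance {n : ℕ} (ε : Fin n → Bool) (T : Finset (Fin n)) : Decidable (BothSigns ε T) := by
  unfold BothSigns; infer_instance

lemma exists_positive_relation_iff {n : ℕ} {c : Fin n → ℝ} (hc : ∀ i, c i ≠ 0) (S : Finset (Fin n)) :
    (∃ w : Fin n → ℝ, (∀ i ∈ S, w i = 0) ∧ (∀ i ∉ S, 0 < w i) ∧ ∑ i, w i * c i = 0) ↔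
      S = Finset.univ ∨ BothSigns (fun i => decide (0 < c i)) Sᶜ := by
  constructor
  · rintro ⟨w, h1, h2, h3⟩
    rw [or_iff_not_imp_left]
    intro hS
    obtain ⟨i₀, hi₀⟩ : ∃ i, i ∉ S := by
      by_contra! hall
      exact hS (Finset.eq_univ_of_forall hall)
    have hw : ∀ i, 0 ≤ w i := fun i => by
      by_cases hi : i ∈ S
      exacts [(h1 i hi).ge, (h2 i hi).le]
    constructor
    · by_contra! h
      have hneg : ∀ i ∉ S, c i < 0 := fun i hi => by
        have := h i (Finset.mem_compl.2 hi)
        simp only [ne_eq, decide_eq_true_eq, not_lt] at this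
        exact lt_of_le_of_ne this (hc i)
      refine absurd h3 (ne_of_lt (Finset.sum_neg' (fun i _ => ?_) ⟨i₀, Finset.mem_univ _,
        mul_neg_of_pos_of_neg (h2 i₀ hi₀) (hneg i₀ hi₀)⟩))
      by_cases hi : i ∈ S
      · rw [h1 i hi, zero_mul]
      · exact mul_nonpos_of_nonneg_of_nonpos (hw i) (hneg i hi).le
    · by_contra! h
      have hpos : ∀ i ∉ S, 0 < c i := fun i hi => by
        simpa using h i (Finset.mem_compl.2 hi)
      refine absurd h3 (ne_of_gt (Finset.sum_pos' (fun i _ => ?_) ⟨i₀, Finset.mem_univ _,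
        mul_pos (h2 i₀ hi₀) (hpos i₀ hi₀)⟩))
      by_cases hi : i ∈ S
      · rw [h1 i hi, zero_mul]
      · exact mul_nonneg (hw i) (hpos i hi).le
  · rintro (rfl | ⟨⟨i, hi, hic⟩, j, hj, hjc⟩)
    · exact ⟨0, by simp, by simp, by simp⟩
    set p : ℝ := ∑ i ∈ Sᶜ, max (c i) 0 with hp
    set q : ℝ := ∑ i ∈ Sᶜ, max (-c i) 0 with hq
    have hp0 : 0 < p := Finset.sum_pos' (fun _ _ => le_max_right _ _)
      ⟨i, hi, lt_max_of_lt_left (by simpa using hic)⟩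
    have hq0 : 0 < q := Finset.sum_pos' (fun _ _ => le_max_right _ _)
      ⟨j, hj, lt_max_of_lt_left (neg_pos.2 (lt_of_le_of_ne (by simpa using hjc) (hc j)))⟩
    -- Positive coefficients get as weight the total of the negative ones and vice versa, so the two
    -- contributions are `q * p` and `p * q`.
    refine ⟨fun i => if i ∈ S then 0 else if 0 < c i then q else p, fun i hi => by simp [hi],
      fun i hi => ?_, ?_⟩
    · simp only [hi, if_false]
      split_ifs <;> assumption
    · have e : ∀ i ∈ Sᶜ, (if i ∈ S then 0 else if 0 < c i then q else p) * c i =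
          q * max (c i) 0 - p * max (-c i) 0 := fun i hi => by
        rw [if_neg (Finset.mem_compl.1 hi)]
        split_ifs with h
        · rw [max_eq_left h.le, max_eq_right (by linarith)]; ring
        · rw [max_eq_right (by linarith), max_eq_left (by linarith)]; ring
      rw [← Finset.sum_subset (Finset.subset_univ Sᶜ), Finset.sum_congr rfl e,
        Finset.sum_sub_distrib, ← Finset.mul_sum, ← Finset.mul_sum, ← hp, ← hq]
      · ring
      · intro i _ hi
        simp only [show i ∈ S by simpa using hi, if_true, zero_mul]

lemma bothSigns_compl_image {n : ℕ} (ε : Fin n → Bool) (σ : Equiv.Perm (Fin n))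
    (S : Finset (Fin n)) : BothSigns ε (S.image σ)ᶜ ↔ BothSigns (ε ∘ σ) Sᶜ := by
  have h : (S.image σ)ᶜ = Sᶜ.image σ := by
    ext i
    obtain ⟨j, rfl⟩ := σ.surjective i
    simp
  simp [h, BothSigns]

/-- Both signs survive the removal of any vertex, so each occurs at least twice: two vertices, the
apices, stand against three. The boolean `b` accounts for which sign is in the minority. -/
lemma exists_bipyramid_labelling : ∀ ε : Fin 5 → Bool, (∀ i, BothSigns ε {i}ᶜ) →
    ∃ b : Bool, ∃ σ : Equiv.Perm (Fin 5), ∀ i, ε (σ i) = xor b (decide (i < 2)) := by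
  decide +kernel

lemma IsSimplicialPosition.hasType_triangularBipyramid {v : Fin 5 → E3}
    (hv : IsSimplicialPosition v) : HasType (convexHull ℝ (Set.range v)) triangularBipyramid := by
  obtain ⟨b, hb⟩ := exists_gale_dual (d := 1) rfl hv.span
  simp only [Fin.forall_fin_one] at hb
  -- A zero coefficient would make the other four vertices a face set.
  have hc : ∀ i, b 0 i ≠ 0 := fun i hi => by
    have := hv.card_le {i}ᶜ ((hb _).2 ⟨Pi.single i 1, fun j hj => Pi.single_eq_of_ne (by simpa using hj) _,
      fun j hj => by
        obtain rfl : j = i := by simpa using hj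
        simp, by simp [Pi.single_apply, hi]⟩)
      (by simp)
    simp [Finset.card_compl] at this
  have hface : ∀ S, IsFaceSet v S ↔ S = Finset.univ ∨
      BothSigns (fun i => decide (0 < b 0 i)) Sᶜ := fun S =>
    (hb S).trans (exists_positive_relation_iff hc S)
  obtain ⟨p, σ, hσ⟩ := exists_bipyramid_labelling _ fun i =>
    ((hface {i}).1 (hv.singleton i)).resolve_left (by revert i; decide)
  have key : ∀ S, IsFaceSet (v ∘ σ) S ↔ S = Finset.univ ∨
      BothSigns (fun i => xor p (decide (i < 2))) Sᶜ := fun S => by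
    rw [isFaceSet_comp, hface, bothSigns_compl_image, image_perm_eq_univ_iff]
    exact or_congr_right (by rw [← funext hσ]; rfl)
  rw [← σ.surjective.range_comp]
  refine (hv.comp σ).hasType (fun S => ?_) fun S => ?_
  · rw [key]
    clear key hσ
    revert S p
    decide +kernel
  · rw [key]
    clear key hσ
    revert S p
    decide +kernel

end Classification

/-! ### Positive dependencies of planar vectors in terms of sign changes -/

section Classification

/-- The signs along the set change at least twice. -/
def Alternates {n : ℕ} (ε : Fin n → Bool) (T : Finset (Fin n)) : Prop :=
  ∃ j ∈ T, ∃ i ∈ T, i < j ∧ ε i ≠ ε j ∧ ∃ k ∈ T, j < k ∧ ε j ≠ ε k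

instance {n : ℕ} (ε : Fin n → Bool) (T : Finset (Fin n)) : Decidable (Alternates ε T) := by
  unfold Alternates; infer_instance

/-- A given element replaces the middle or an end of an alternating triple, according to its
position and sign. Thus such triples cover the set, which lets the sum of their dependencies have
full support. -/
lemma Alternates.exists_triple {n : ℕ} {ε : Fin n → Bool} {T : Finset (Fin n)}
    (h : Alternates ε T) {l : Fin n} (hl : l ∈ T) :
    ∃ i ∈ T, ∃ j ∈ T, ∃ k ∈ T, i < j ∧ j < k ∧ ε i ≠ ε j ∧ ε j ≠ ε k ∧
      (l = i ∨ l = j ∨ l = k) := by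
  obtain ⟨j, hj, i, hi, hij, hεij, k, hk, hjk, hεjk⟩ := h
  rcases lt_trichotomy l j with h1 | rfl | h1
  · by_cases h2 : ε l = ε j
    · rcases lt_trichotomy l i with h3 | rfl | h3
      · exact ⟨l, hl, i, hi, j, hj, h3, hij, by rw [h2]; exact hεij.symm, hεij, .inl rfl⟩
      · exact absurd h2 hεij
      · exact ⟨i, hi, l, hl, k, hk, h3, h1.trans hjk, by rwa [h2], by rwa [h2], .inr (.inl rfl)⟩
    · exact ⟨l, hl, j, hj, k, hk, h1, hjk, h2, hεjk, .inl rfl⟩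
  · exact ⟨i, hi, l, hl, k, hk, hij, hjk, hεij, hεjk, .inr (.inl rfl)⟩
  · by_cases h2 : ε l = ε j
    · rcases lt_trichotomy l k with h3 | rfl | h3
      · exact ⟨i, hi, l, hl, k, hk, hij.trans h1, h3, by rwa [h2], by rwa [h2], .inr (.inl rfl)⟩
      · exact absurd h2.symm hεjk
      · exact ⟨j, hj, k, hk, l, hl, hjk, h3, hεjk, by rw [h2]; exact hεjk.symm, .inr (.inr rfl)⟩
    · exact ⟨i, hi, j, hj, l, hl, hij, h1, hεij, Ne.symm h2, .inr (.inr rfl)⟩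

lemma exists_triple_relation {n : ℕ} {β s : Fin n → ℝ} (hβ : ∀ i, β i ≠ 0) {i j k : Fin n}
    (hij : i < j) (hjk : j < k) (sij : s i < s j) (sjk : s j < s k)
    (h1 : decide (0 < β i) ≠ decide (0 < β j)) (h2 : decide (0 < β j) ≠ decide (0 < β k)) :
    ∃ w : Fin n → ℝ, (∀ l, 0 ≤ w l) ∧ (∀ l, l ≠ i → l ≠ j → l ≠ k → w l = 0) ∧
      0 < w i ∧ 0 < w j ∧ 0 < w k ∧ ∑ l, w l * β l = 0 ∧ ∑ l, w l * (β l * s l) = 0 := by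
  have hpos : ∀ l, 0 < |β l| := fun l => abs_pos.2 (hβ l)
  obtain ⟨a, b, c, ha, hb, hc, e1, e2⟩ : ∃ a b c : ℝ, 0 < a ∧ 0 < b ∧ 0 < c ∧
      a * β i + b * β j + c * β k = 0 ∧ a * (β i * s i) + b * (β j * s j) + c * (β k * s k) = 0 := by
    -- By the alternation of signs the first relation reduces to `(s k - s j) - (s k - s i) + (s j -
    -- s i) = 0`, up to sign, and the second to the same with factors `s i`, `s j`, `s k`.
    refine ⟨(s k - s j) / |β i|, (s k - s i) / |β j|, (s j - s i) / |β k|,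
      div_pos (by linarith) (hpos _), div_pos (by linarith) (hpos _),
      div_pos (by linarith) (hpos _), ?_⟩
    have hi := hβ i
    have hj := hβ j
    have hk := hβ k
    rcases lt_or_gt_of_ne (hβ j) with hj' | hj'
    · have hi' : 0 < β i := by simpa [hj'.not_gt] using h1
      have hk' : 0 < β k := by simpa [hj'.not_gt] using h2
      rw [abs_of_pos hi', abs_of_neg hj', abs_of_pos hk']
      constructor <;> field_simp <;> ring
    · have hi' : β i < 0 := lt_of_le_of_ne (by simpa [hj'] using h1) hi
      have hk' : β k < 0 := lt_of_le_of_ne (by simpa [hj'] using h2) hk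
      rw [abs_of_neg hi', abs_of_pos hj', abs_of_neg hk']
      constructor <;> field_simp <;> ring
  have hik := (hij.trans hjk).ne
  refine ⟨Pi.single i a + Pi.single j b + Pi.single k c, fun l => ?_, fun l li lj lk => ?_, ?_, ?_, ?_,
    ?_, ?_⟩
  · have : ∀ (x : Fin n) (r : ℝ), 0 < r → 0 ≤ (Pi.single x r : Fin n → ℝ) l := fun x r hr => by
      rw [Pi.single_apply]
      split_ifs
      exacts [hr.le, le_rfl]
    exact add_nonneg (add_nonneg (this _ _ ha) (this _ _ hb)) (this _ _ hc)
  · simp [li, lj, lk]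
  · simpa [Pi.single_apply, hij.ne, hik] using ha
  · simpa [Pi.single_apply, hij.ne', hjk.ne] using hb
  · simpa [Pi.single_apply, hik.symm, hjk.ne'] using hc
  · simpa [Pi.single_apply, add_mul, Finset.sum_add_distrib] using e1
  · simpa [Pi.single_apply, add_mul, Finset.sum_add_distrib] using e2

/-- Measure slopes from the largest slope `s p` of a positive element. Then every term `w l * (β l *
(s l - s p))` is at most zero, and those of negative elements of `T` are strictly negative because
equal slopes carry equal signs. -/
lemma not_balanced_of_separated {n : ℕ} {β s w : Fin n → ℝ} (hs : Monotone s)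
    (hpar : ∀ i j, s i = s j → (0 < β i ↔ 0 < β j)) (hβ : ∀ i, β i ≠ 0) {T : Finset (Fin n)}
    (hw0 : ∀ i ∉ T, w i = 0) (hw : ∀ i ∈ T, 0 < w i)
    (hsep : ∀ p ∈ T, ∀ q ∈ T, 0 < β p → β q < 0 → p < q) (hp : ∃ p ∈ T, 0 < β p)
    (hq : ∃ q ∈ T, β q < 0) (h1 : ∑ l, w l * β l = 0) (h2 : ∑ l, w l * (β l * s l) = 0) : False := by
  obtain ⟨p, hp', hmax⟩ := (T.filter fun p => 0 < β p).exists_max_image s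
    (by obtain ⟨p, h⟩ := hp; exact ⟨p, Finset.mem_filter.2 h⟩)
  obtain ⟨hpT, hp0⟩ := Finset.mem_filter.1 hp'
  have hlt : ∀ q ∈ T, β q < 0 → s p < s q := fun q hqT hq0 =>
    lt_of_le_of_ne (hs (hsep p hpT q hqT hp0 hq0).le) fun h =>
      (lt_asymm hq0) ((hpar p q h).1 hp0)
  have hsum : ∑ l, w l * (β l * (s l - s p)) = 0 := by
    have : ∀ l, w l * (β l * (s l - s p)) = w l * (β l * s l) - s p * (w l * β l) := fun l => by ring
    rw [Finset.sum_congr rfl fun l _ => this l, Finset.sum_sub_distrib, ← Finset.mul_sum, h1, h2]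
    ring
  obtain ⟨q, hqT, hq0⟩ := hq
  refine absurd hsum (ne_of_lt (Finset.sum_neg' (fun l _ => ?_) ⟨q, Finset.mem_univ q, ?_⟩))
  · by_cases hl : l ∈ T
    · refine mul_nonpos_of_nonneg_of_nonpos (hw l hl).le ?_
      rcases lt_or_gt_of_ne (hβ l) with h | h
      · exact mul_nonpos_of_nonpos_of_nonneg h.le (sub_nonneg.2 (hlt l hl h).le)
      · exact mul_nonpos_of_nonneg_of_nonpos h.le
          (sub_nonpos.2 (hmax l (Finset.mem_filter.2 ⟨hl, h⟩)))
    · rw [hw0 l hl, zero_mul]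
  · exact mul_neg_of_pos_of_neg (hw q hqT) (mul_neg_of_neg_of_pos hq0 (sub_pos.2 (hlt q hqT hq0)))

/-- With fewer than two sign changes the signs are separated, so the previous lemma applies to `β`
or `-β`. Conversely the dependencies of alternating triples, one through each element of the
complement of `S`, are added up. -/
lemma exists_balanced_iff {n : ℕ} {β s : Fin n → ℝ} (hs : Monotone s)
    (hpar : ∀ i j, s i = s j → (0 < β i ↔ 0 < β j)) (hβ : ∀ i, β i ≠ 0) (S : Finset (Fin n)) :
    (∃ w : Fin n → ℝ, (∀ i ∈ S, w i = 0) ∧ (∀ i ∉ S, 0 < w i) ∧ ∑ i, w i * β i = 0 ∧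
      ∑ i, w i * (β i * s i) = 0) ↔
      S = Finset.univ ∨ Alternates (fun i => decide (0 < β i)) Sᶜ := by
  constructor
  · rintro ⟨w, w0, w1, h1, h2⟩
    rcases (exists_positive_relation_iff hβ S).1 ⟨w, w0, w1, h1⟩ with h | ⟨⟨p, hp, hp0⟩, q, hq, hq0⟩
    · exact .inl h
    right
    by_contra hT
    have hp0' : 0 < β p := by simpa using hp0
    have hq0' : β q < 0 := lt_of_le_of_ne (by simpa using hq0) (hβ q)
    have hw0 : ∀ i ∉ Sᶜ, w i = 0 := fun i hi => w0 i (by simpa using hi)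
    have hw : ∀ i ∈ Sᶜ, 0 < w i := fun i hi => w1 i (by simpa using hi)
    have hno : ∀ i ∈ Sᶜ, ∀ j ∈ Sᶜ, ∀ k ∈ Sᶜ, i < j → j < k → (0 < β i ↔ ¬ 0 < β j) →
        (0 < β j ↔ ¬ 0 < β k) → False := fun i hi j hj k hk hij hjk a b =>
      hT ⟨j, hj, i, hi, hij, by simpa [decide_eq_decide] using by tauto, k, hk, hjk,
        by simpa [decide_eq_decide] using by tauto⟩
    rcases lt_trichotomy p q with hpq | rfl | hpq
    · refine not_balanced_of_separated hs hpar hβ hw0 hw (fun p' hp' q' hq' a b => ?_)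
        ⟨p, hp, hp0'⟩ ⟨q, hq, hq0'⟩ h1 h2
      have b' := b.not_gt
      have c' := hq0'.not_gt
      by_contra! hle
      have hlt : q' < p' := lt_of_le_of_ne hle (by rintro rfl; exact b' a)
      rcases lt_trichotomy q p' with h | rfl | h
      · exact hno p hp q hq p' hp' hpq h (by tauto) (by tauto)
      · exact c' a
      · exact hno q' hq' p' hp' q hq hlt h (by tauto) (by tauto)
    · exact lt_asymm hp0' hq0'
    · refine not_balanced_of_separated (β := -β) hs (fun i j h => ?_)
        (fun i => neg_ne_zero.2 (hβ i)) hw0 hw (fun q' hq' p' hp' b a => ?_)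
        ⟨q, hq, neg_pos.2 hq0'⟩ ⟨p, hp, neg_lt_zero.2 hp0'⟩ (by simpa using h1) (by simpa using h2)
      · have e : ∀ l, 0 < (-β) l ↔ ¬ 0 < β l := fun l => by
          rw [Pi.neg_apply, neg_pos, not_lt]
          exact ⟨le_of_lt, fun h => lt_of_le_of_ne h (hβ l)⟩
        rw [e, e, hpar i j h]
      · have a' : 0 < β p' := by simpa using a
        have b' : ¬ 0 < β q' := by
          have : β q' < 0 := by simpa using b
          exact this.not_gt
        have c' := hq0'.not_gt
        by_contra! hle
        have hlt : p' < q' := lt_of_le_of_ne hle (by rintro rfl; exact b' a')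
        rcases lt_trichotomy p q' with h | rfl | h
        · exact hno q hq p hp q' hq' hpq h (by tauto) (by tauto)
        · exact b' hp0'
        · exact hno p' hp' q' hq' p hp hlt h (by tauto) (by tauto)
  · rintro (rfl | hT)
    · exact ⟨0, by simp, by simp, by simp, by simp⟩
    have hex : ∀ l : Fin n, ∃ w : Fin n → ℝ, l ∈ Sᶜ → (∀ i, 0 ≤ w i) ∧ (∀ i ∈ S, w i = 0) ∧ 0 < w l ∧
        ∑ i, w i * β i = 0 ∧ ∑ i, w i * (β i * s i) = 0 := by
      intro l
      by_cases hl : l ∈ Sᶜ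
      swap
      · exact ⟨0, fun h => absurd h hl⟩
      obtain ⟨i, hi, j, hj, k, hk, hij, hjk, e1, e2, hmem⟩ := hT.exists_triple hl
      have slt : ∀ {a b : Fin n}, a < b → decide (0 < β a) ≠ decide (0 < β b) → s a < s b :=
        fun hab hne => lt_of_le_of_ne (hs hab.le) fun h => hne (by rw [decide_eq_decide]; exact hpar _ _ h)
      obtain ⟨w, w0, w1, wi, wj, wk, r1, r2⟩ :=
        exists_triple_relation hβ hij hjk (slt hij e1) (slt hjk e2) e1 e2
      refine ⟨w, fun _ => ⟨w0, fun x hx => ?_, ?_, r1, r2⟩⟩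
      · rw [Finset.mem_compl] at hi hj hk
        exact w1 x (by rintro rfl; exact hi hx) (by rintro rfl; exact hj hx) (by rintro rfl; exact hk hx)
      · rcases hmem with rfl | rfl | rfl <;> assumption
    choose w hw using hex
    refine ⟨fun i => ∑ l ∈ Sᶜ, w l i, fun i hi => Finset.sum_eq_zero fun l hl => (hw l hl).2.1 i hi,
      fun i hi => Finset.sum_pos' (fun l hl => (hw l hl).1 i)
        ⟨i, Finset.mem_compl.2 hi, (hw i (Finset.mem_compl.2 hi)).2.2.1⟩, ?_, ?_⟩
    · simp only [Finset.sum_mul]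
      rw [Finset.sum_comm]
      exact Finset.sum_eq_zero fun l hl => (hw l hl).2.2.2.1
    · simp only [Finset.sum_mul]
      rw [Finset.sum_comm]
      exact Finset.sum_eq_zero fun l hl => (hw l hl).2.2.2.2

end Classification

/-! ### Simplicial polyhedra with six vertices -/

section Classification

/-- This rules out opposite Gale vectors, and for `i = k` zero ones, because the complement would be
too large a face. -/
lemma isFaceSet_compl_of_relation {n d : ℕ} {v : Fin n → E3} {b : Fin d → Fin n → ℝ}
    (hb : ∀ S : Finset (Fin n), IsFaceSet v S ↔
      ∃ w : Fin n → ℝ, (∀ i ∈ S, w i = 0) ∧ (∀ i ∉ S, 0 < w i) ∧ ∀ j, ∑ i, w i * b j i = 0)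
    {i k : Fin n} {x y : ℝ} (hx : 0 < x) (hy : 0 < y) (h : ∀ j, x * b j i + y * b j k = 0) :
    IsFaceSet v {i, k}ᶜ := by
  refine (hb _).2 ⟨Pi.single i x + Pi.single k y, fun l hl => ?_, fun l hl => ?_, fun j => ?_⟩
  · have : l ≠ i ∧ l ≠ k := by simpa using hl
    simp [this.1, this.2]
  · have hl' : l = i ∨ l = k := by
      by_contra h
      exact hl (by simpa using h)
    have : ∀ (a : Fin n) (r : ℝ), 0 < r → 0 ≤ (Pi.single a r : Fin n → ℝ) l := fun a r hr => by
      rw [Pi.single_apply]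
      split_ifs
      exacts [hr.le, le_rfl]
    rcases hl' with rfl | rfl
    · exact add_pos_of_pos_of_nonneg (by simpa using hx) (this _ _ hy)
    · exact add_pos_of_nonneg_of_pos (this _ _ hx) (by simpa using hy)
  · simpa [Pi.single_apply, add_mul, Finset.sum_add_distrib] using h j

/-- After a suitable reordering, the face sets of a simplicial polytope with six vertices in 3-space
are determined by a sequence of signs. -/
lemma IsSimplicialPosition.exists_signs {v : Fin 6 → E3} (hv : IsSimplicialPosition v) :
    ∃ (σ : Equiv.Perm (Fin 6)) (ε : Fin 6 → Bool), ∀ S : Finset (Fin 6),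
      IsFaceSet (v ∘ σ) S ↔ S = Finset.univ ∨ Alternates ε Sᶜ := by
  obtain ⟨b, hb⟩ := exists_gale_dual (d := 2) rfl hv.span
  have hcard : ∀ i k : Fin 6, ¬ IsFaceSet v {i, k}ᶜ := fun i k h => by
    have h1 := hv.card_le _ h fun hu => by
      simpa using hu.ge (Finset.mem_univ i)
    have h2 : ({i, k} : Finset (Fin 6)).card ≤ 2 := Finset.card_le_two
    rw [Finset.card_compl, Fintype.card_fin] at h1
    omega
  have hne : ∀ i, ¬ (b 0 i = 0 ∧ b 1 i = 0) := fun i h =>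
    hcard i i (isFaceSet_compl_of_relation hb one_pos one_pos fun j => by
      fin_cases j <;> simp [h])
  -- A generic shear makes the second coordinate `β` of every Gale vector nonzero; `s` is then the
  -- slope of the line it spans.
  obtain ⟨t, ht⟩ : ∃ t : ℝ, t ∉ (Finset.univ.image fun i => - b 1 i / b 0 i) :=
    Infinite.exists_notMem_finset _
  have hβ : ∀ i, b 1 i + t * b 0 i ≠ 0 := fun i h => by
    by_cases h0 : b 0 i = 0
    · exact hne i ⟨h0, by simpa [h0] using h⟩
    · refine ht (Finset.mem_image.2 ⟨i, Finset.mem_univ i, ?_⟩)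
      rw [div_eq_iff h0]
      linarith
  set β : Fin 6 → ℝ := fun i => b 1 i + t * b 0 i with hβdef
  set s : Fin 6 → ℝ := fun i => b 0 i / β i with hsdef
  have hbs : ∀ i, b 0 i = β i * s i := fun i => (mul_div_cancel₀ _ (hβ i)).symm
  have hb1 : ∀ i, b 1 i = β i - t * (β i * s i) := fun i => by
    rw [← hbs, hβdef]; ring
  -- Equal slopes with different signs would mean two oppositely directed vectors.
  have hpar : ∀ i k, s i = s k → 0 < β i → 0 < β k := fun i k hik hi => by
    by_contra hk
    have hk' : β k < 0 := lt_of_le_of_ne (not_lt.1 hk) (hβ k)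
    refine hcard i k (isFaceSet_compl_of_relation hb (neg_pos.2 hk') hi fun j => ?_)
    fin_cases j
    · simp only [Fin.zero_eta, Fin.isValue, hbs, hik]; ring
    · simp only [Fin.mk_one, Fin.isValue, hb1, hik]; ring
  let σ := Tuple.sort s
  refine ⟨σ, fun i => decide (0 < β (σ i)), fun S => ?_⟩
  refine Iff.trans ?_ (exists_balanced_iff (s := s ∘ σ) (β := β ∘ σ) (Tuple.monotone_sort s)
    (fun i k h => ⟨hpar _ _ h, hpar _ _ h.symm⟩) (fun i => hβ _) S)
  rw [isFaceSet_comp, hb]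
  have hsum : ∀ w : Fin 6 → ℝ, (∀ j, ∑ i, w i * b j i = 0) ↔
      ∑ i, w (σ i) * β (σ i) = 0 ∧ ∑ i, w (σ i) * (β (σ i) * s (σ i)) = 0 := fun w => by
    rw [Equiv.sum_comp σ fun i => w i * β i, Equiv.sum_comp σ fun i => w i * (β i * s i),
      Fin.forall_fin_two]
    simp only [hb1, hbs, mul_sub, Finset.sum_sub_distrib]
    have : ∑ i, w i * (t * (β i * s i)) = t * ∑ i, w i * (β i * s i) := by
      rw [Finset.mul_sum]
      exact Finset.sum_congr rfl fun i _ => by ring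
    rw [this]
    constructor
    · rintro ⟨h1, h2⟩
      rw [h1, mul_zero, sub_zero] at h2
      exact ⟨h2, h1⟩
    · rintro ⟨h1, h2⟩
      rw [h1, h2, mul_zero, sub_zero]
      exact ⟨rfl, rfl⟩
  constructor
  · rintro ⟨w, w0, w1, w2⟩
    refine ⟨w ∘ σ, fun i hi => w0 _ (Finset.mem_image_of_mem σ hi), fun i hi => w1 _ fun h => ?_,
      (hsum w).1 w2⟩
    obtain ⟨j, hj, e⟩ := Finset.mem_image.1 h
    exact hi (σ.injective e ▸ hj)
  · rintro ⟨w, w0, w1, w2⟩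
    refine ⟨w ∘ σ.symm, fun i hi => ?_, fun i hi => w1 _ fun h => hi ?_,
      (hsum _).2 (by simpa using w2)⟩
    · obtain ⟨j, hj, rfl⟩ := Finset.mem_image.1 hi
      simpa using w0 j hj
    · exact Finset.mem_image.2 ⟨_, h, by simp⟩

/-- The relabelling `q` turns the face sets that belong to the signs `ε` into those of `T`. -/
def Labels (T : CombType 6) (ε : Fin 6 → Bool) (q : Fin 6 → Fin 6) : Prop :=
  Function.Injective q ∧ (∀ S, S ∈ T.edges ↔ S.card = 2 ∧ Alternates ε (S.image q)ᶜ) ∧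
    ∀ S, S ∈ T.faces ↔ S.card = 3 ∧ Alternates ε (S.image q)ᶜ

instance (T : CombType 6) (ε : Fin 6 → Bool) (q : Fin 6 → Fin 6) : Decidable (Labels T ε q) := by
  unfold Labels; infer_instance

/-- Read cyclically with signs reversed after one turn, a sequence has an odd number of blocks, and
it alternates when there are at least three. To keep three after removing any element, the block
sizes must be 2, 2, 2 (octahedron, two positions up to a global sign) or 2, 1, 1, 1, 1 (stacked
bipyramid, six positions); hence the lengths of the two lists. -/
lemma exists_labels : ∀ ε : Fin 6 → Bool, (∀ i, Alternates ε {i}ᶜ) →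
    (∃ q ∈ [![0, 1, 2, 3, 4, 5], ![0, 5, 1, 2, 3, 4]], Labels octahedron ε q) ∨
    ∃ q ∈ [![0, 2, 3, 4, 1, 5], ![0, 4, 2, 3, 5, 1], ![1, 3, 4, 5, 2, 0], ![2, 4, 0, 5, 3, 1],
      ![3, 5, 0, 1, 4, 2], ![4, 0, 1, 2, 5, 3]], Labels stackedBipyramid ε q := by
  decide +kernel

lemma IsSimplicialPosition.hasType_of_labels {v : Fin 6 → E3} (hv : IsSimplicialPosition v)
    {ε : Fin 6 → Bool} (hε : ∀ S, IsFaceSet v S ↔ S = Finset.univ ∨ Alternates ε Sᶜ)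
    {T : CombType 6} {q : Fin 6 → Fin 6} (hq : Labels T ε q) :
    HasType (convexHull ℝ (Set.range v)) T := by
  obtain ⟨hinj, hedges, hfaces⟩ := hq
  let σ : Equiv.Perm (Fin 6) := Equiv.ofBijective q (Finite.injective_iff_bijective.1 hinj)
  have hcard : ∀ {S : Finset (Fin 6)} {k : ℕ}, k ≠ 6 → S.card = k → S ≠ Finset.univ := by
    rintro S k hk hS rfl
    exact hk (by simpa using hS.symm)
  have hface : ∀ S, S ≠ Finset.univ → (IsFaceSet (v ∘ σ) S ↔ Alternates ε (S.image q)ᶜ) :=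
    fun S hS => by
      rw [isFaceSet_comp, hε, image_perm_eq_univ_iff, or_iff_right hS]
      rfl
  rw [← σ.surjective.range_comp]
  refine (hv.comp σ).hasType (fun S => ?_) fun S => ?_
  · rw [hedges]
    exact and_congr_right fun h => (hface S (hcard (by norm_num) h)).symm
  · rw [hfaces]
    refine and_congr_right fun h => ?_
    have := hcard (by norm_num) h
    rw [hface S this, and_iff_right this]

lemma IsSimplicialPosition.hasType_octahedron_or_stackedBipyramid {v : Fin 6 → E3}
    (hv : IsSimplicialPosition v) : HasType (convexHull ℝ (Set.range v)) octahedron ∨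
      HasType (convexHull ℝ (Set.range v)) stackedBipyramid := by
  obtain ⟨σ, ε, hε⟩ := hv.exists_signs
  rw [← σ.surjective.range_comp]
  rcases exists_labels ε fun i => ((hε {i}).1 ((hv.comp σ).singleton i)).resolve_left
    (by revert i; decide) with ⟨q, -, hq⟩ | ⟨q, -, hq⟩
  · exact .inl ((hv.comp σ).hasType_of_labels hε hq)
  · exact .inr ((hv.comp σ).hasType_of_labels hε hq)

theorem hasType_of_isSimplicial {P : Set E3} (hP : IsConvexPolyhedron P) (hs : IsSimplicial P)
    (h6 : (P.extremePoints ℝ).ncard ≤ 6) : HasType P tetrahedron ∨ HasType P triangularBipyramid ∨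
      HasType P octahedron ∨ HasType P stackedBipyramid := by
  obtain ⟨v, hv, hPv⟩ := exists_isSimplicialPosition hP hs
  have h4 := four_le_of_affineSpan hv.span
  rw [hPv]
  generalize (P.extremePoints ℝ).ncard = n at v h4 h6
  obtain rfl | rfl | rfl : n = 4 ∨ n = 5 ∨ n = 6 := by omega
  · exact .inl hv.hasType_tetrahedron
  · exact .inr (.inl hv.hasType_triangularBipyramid)
  · exact .inr (.inr hv.hasType_octahedron_or_stackedBipyramid)

end Classification

end HexGlue

open HexGlue in
theorem mainTheorem3 :
    (∃ P : Set E3, IsHexGlued P ∧ HasType P tetrahedron) ∧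
    (∃ P : Set E3, IsHexGlued P ∧ HasType P triangularBipyramid) ∧
    (∃ P : Set E3, IsHexGlued P ∧ HasType P squarePyramid ∧ IsRightRectangularPyramid P) ∧
    (∃ P : Set E3, IsHexGlued P ∧ HasType P octahedron ∧ IsRegularOctahedron P) ∧
    (∃ P : Set E3, IsHexGlued P ∧ HasType P stackedBipyramid) ∧
    (∃ P : Set E3, IsHexGlued P ∧ HasType P triangularPrism ∧ IsTriangularPrism P) ∧
    (∀ P : Set E3, IsConvexPolyhedron P → IsSimplicial P → (P.extremePoints ℝ).ncard ≤ 6 →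
      HasType P tetrahedron ∨ HasType P triangularBipyramid ∨ HasType P octahedron ∨
        HasType P stackedBipyramid) := by
  have pyramid := pyramidPlan_valid.isHexGlued_and_hasType pyramidPlan_isPolyhedron
  have octa := octahedronPlan_valid.isHexGlued_and_hasType octahedronPlan_isPolyhedron
  have prism := prismPlan_valid.isHexGlued_and_hasType prismPlan_isPolyhedron
  exact ⟨⟨_, tetrahedronPlan_valid.isHexGlued_and_hasType tetrahedronPlan_isPolyhedron⟩,
    ⟨_, bipyramidPlan_valid.isHexGlued_and_hasType bipyramidPlan_isPolyhedron⟩,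
    ⟨_, pyramid.1, pyramid.2, isRightRectangularPyramid_pyramidPlan⟩,
    ⟨_, octa.1, octa.2, isRegularOctahedron_octahedronPlan⟩,
    ⟨_, stackedPlan_valid.isHexGlued_and_hasType stackedPlan_isPolyhedron⟩,
    ⟨_, prism.1, prism.2, isTriangularPrism_prismPlan⟩,
    fun _ hP hs h6 => hasType_of_isSimplicial hP hs h6⟩
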